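/- **Setting.** Let $\Phi$ be a (finite, reduced, crystallographic) root system with Weyl group $W$, and let $s_\alpha\in W$ be the reflection in $\alpha\in\Phi$. To an ordered list $\Omega=(\alpha_1,\dots,\alpha_n)$ of roots, not necessarily simple, we associate the element $w_\Omega=s_{\alpha_1}\cdots s_{\alpha_n}\in W$ and the diagram $\Gamma_\Omega$ whose vertices are the $\alpha_i$, two vertices being joined when the roots are not orthogonal; an edge is called solid if the angle is obtuse and dotted if it is acute. The list $\Omega$ realizes a *Carter (admissible) diagram* if the roots are linearly independent, every cycle of $\Gamma_\Omega$ has an even number of vertices, and the order is bicolored: the list consists of mutually orthogonal roots (the $\alpha$-set) followed by mutually orthogonal roots (the $\beta$-set). Two ordered lists of roots are *equivalent* if each can be obtained from the other by a sequence of the following transformations: conjugation $(\alpha_i)_i\mapsto(u\alpha_i)_i$ with $u\in W$; $s$-permutation, which replaces two adjacent roots $\alpha,\beta$ of the list by $s_\alpha(\beta),\alpha$ or by $\beta,s_\beta(\alpha)$; and the sign change $\alpha\mapsto-\alpha$ of one root. We say that a diagram *contains only $4$-cycles* if each of its cycles is a sum modulo $2$ of $4$-cycles (i.e. its edge set is a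 symmetric difference of edge sets of $4$-cycles of the diagram, so that the cycle space is generated by $4$-cycles). **Theorem (on the exclusion of long cycles).** 1. If $\Omega$ and $\Omega'$ are equivalent, then $w_\Omega$ and $w_{\Omega'}$ are conjugate in $W$. 2. If $\Omega$ realizes a Carter diagram that contains an $l$-cycle with $l>4$, then $\Omega$ is equivalent to a list $\Omega'$ that realizes a Carter diagram which contains a $4$-cycle and contains only $4$-cycles. 3. Let $l>4$ be even. Let $D_l(b_{l/2-1})$ be the pure cycle on $l$ vertices with one dotted edge, and let $D_l(a_{l/2-1})$ be the square with one dotted edge and with two paths, of $l/2-2$ further vertices each, attached to two opposite vertices of the square (all edges simple). Then $D_l(b_{l/2-1})$ and $D_l(a_{l/2-1})$ are equivalent; in particular $D_6(b_2)$ and $D_6(a_2)$ are equivalent. 4. Let $E_7(b_2)$ be the hexagon with one dotted edge and with one further vertex attached to one of its vertices, and let $E_7(a_2)$ be the square with one dotted edge and with three further vertices, attached to three different vertices of the square, one to each (all edges simple). Then $E_7(b_2)$ and $E_7(a_2)$ are equivalent. In 3 and 4, equivalence of diagrams $D$ and $D'$ means: in $\Phi$, every list that realizes a Carter diagram with the same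 simple edges as $D$ (whichever of them are dotted) is equivalent to a list that realizes the Carter diagram $D'$ with the solid and dotted edges described, and the same holds with $D$ and $D'$ exchanged. -/

import Mathlib

namespace Carter

section Graphs

variable {V : Type*}

/-- The indicator vector modulo 2 of the set of edges of a closed walk. -/
noncomputable def cycleVector {G : SimpleGraph V} {v : V} (c : G.Walk v v) : Sym2 V → ZMod 2 :=
  Set.indicator {e | e ∈ c.edges} 1

/-- The graph contains a cycle with exactly `n` vertices. -/
def HasCycle (G : SimpleGraph V) (n : ℕ) : Prop :=
  ∃ (v : V) (c : G.Walk v v), c.IsCycle ∧ c.length = n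

/-- The mod 2 edge vectors of the 4-cycles of the graph. -/
def fourCycleVectors (G : SimpleGraph V) : Set (Sym2 V → ZMod 2) :=
  {x | ∃ (v : V) (c : G.Walk v v), c.IsCycle ∧ c.length = 4 ∧ x = cycleVector c}

/-- All cycles of the graph are made of 4-cycles: every cycle is a sum modulo 2 (an iterated
symmetric difference of edge sets) of 4-cycles of the graph.  This holds for two squares with a
common edge, although the outer contour of such a figure is a cycle on six vertices. -/
def OnlyFourCycles (G : SimpleGraph V) : Prop :=
  ∀ (v : V) (c : G.Walk v v), c.IsCycle →
    cycleVector c ∈ Submodule.span (ZMod 2) (fourCycleVectors G)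

/-- A simply-laced diagram with two kinds of edges: solid edges stand for obtuse angles,
dotted edges for acute angles. -/
structure SignedDiagram (V : Type*) where
  solid : SimpleGraph V
  dotted : SimpleGraph V

/-- The diagram with the distinction of solid and dotted edges forgotten. -/
def SignedDiagram.underlying (D : SignedDiagram V) : SimpleGraph V := D.solid ⊔ D.dotted

end Graphs

/-- The pure cycle on `l` vertices, with one dotted edge.  For even `l` this is
`D_l(b_{l/2-1})`. -/
def pureCycle (l : ℕ) : SignedDiagram (Fin l) where
  solid := SimpleGraph.fromRel fun i j => i.val + 1 = j.val
  dotted := SimpleGraph.fromRel fun i j => i.val = 0 ∧ j.val + 1 = l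

/-- The diagram `D_l(a_k)`, `1 ≤ k ≤ l - 3`: a square, with one dotted edge, to two opposite
vertices of which paths with `k - 1` and with `l - k - 3` further vertices are attached.
The vertices `0, …, l - 2` form a path; the vertex `l - 1` is joined to `k - 1` and to `k + 1`,
so that `k - 1, k, k + 1, l - 1` is the square. -/
def diagramDa (l k : ℕ) : SignedDiagram (Fin l) where
  solid := SimpleGraph.fromRel fun i j =>
    (i.val + 1 = j.val ∧ j.val + 1 < l) ∨ (i.val = k + 1 ∧ j.val + 1 = l)
  dotted := SimpleGraph.fromRel fun i j => i.val + 1 = k ∧ j.val + 1 = l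

/-- The diagram `E_7(b_2)`: a hexagon, with one dotted edge, and one more vertex attached to a
vertex of the hexagon. -/
def diagramE7b2 : SignedDiagram (Fin 7) where
  solid := SimpleGraph.fromRel fun i j =>
    (i = 0 ∧ j = 1) ∨ (i = 1 ∧ j = 2) ∨ (i = 2 ∧ j = 3) ∨ (i = 3 ∧ j = 4) ∨ (i = 4 ∧ j = 5) ∨
      (i = 0 ∧ j = 6)
  dotted := SimpleGraph.fromRel fun i j => i = 0 ∧ j = 5

/-- The diagram `E_7(a_2)`: a square, with one dotted edge, and three more vertices attached to
three different vertices of the square, one to each. -/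
def diagramE7a2 : SignedDiagram (Fin 7) where
  solid := SimpleGraph.fromRel fun i j =>
    (i = 0 ∧ j = 1) ∨ (i = 1 ∧ j = 2) ∨ (i = 2 ∧ j = 3) ∨
      (i = 0 ∧ j = 4) ∨ (i = 1 ∧ j = 5) ∨ (i = 2 ∧ j = 6)
  dotted := SimpleGraph.fromRel fun i j => i = 0 ∧ j = 3

section Roots

variable {ι M N : Type*} [AddCommGroup M] [Module ℝ M] [AddCommGroup N] [Module ℝ N]

/-- The element `s_{α₁} s_{α₂} ⋯ s_{αₙ}` of the Weyl group described by an ordered list of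
roots. -/
noncomputable def weylElement (P : RootPairing ι ℝ M N) (Ω : List ι) : P.weylGroup :=
  (Ω.map (RootPairing.weylGroup.ofIdx P)).prod

/-- The diagram of a list of roots, as a graph: one vertex for each root, two vertices being
joined if the roots are not orthogonal. -/
def diagram (P : RootPairing ι ℝ M N) (Ω : List ι) : SimpleGraph (Fin Ω.length) where
  Adj a b := a ≠ b ∧ ¬ P.IsOrthogonal (Ω.get a) (Ω.get b)
  symm := ⟨fun _ _ h => ⟨h.1.symm, fun h' => h.2 h'.symm⟩⟩
  loopless := ⟨fun _ h => h.1 rfl⟩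

/-- The ordered list of roots realizes a Carter (admissible) diagram: the roots are linearly
independent, every cycle of the diagram has an even number of vertices, and the order is
bicolored, i.e. the list consists of mutually orthogonal roots (the `α`-set) followed by mutually
orthogonal roots (the `β`-set). -/
structure IsCarter (P : RootPairing ι ℝ M N) (Ω : List ι) : Prop where
  linearIndependent : LinearIndependent ℝ fun a : Fin Ω.length => P.root (Ω.get a)
  even_cycles : ∀ n, HasCycle (diagram P Ω) n → Even n
  bicolored : ∃ A B : List ι, Ω = A ++ B ∧ A.Pairwise P.IsOrthogonal ∧ B.Pairwise P.IsOrthogonal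

/-- One elementary transformation of an ordered list of roots. -/
inductive Step (P : RootPairing ι ℝ M N) : List ι → List ι → Prop
  /-- Conjugation by an element of the Weyl group. -/
  | conj (u : P.weylGroup) (Ω : List ι) : Step P Ω (Ω.map fun i => u • i)
  /-- `s`-permutation, `s_α s_β = s_{s_α(β)} s_α`. -/
  | permLeft (L R : List ι) (i j : ι) :
      Step P (L ++ i :: j :: R) (L ++ P.reflectionPerm i j :: i :: R)
  /-- `s`-permutation, `s_α s_β = s_β s_{s_β(α)}`. -/
  | permRight (L R : List ι) (i j : ι) :
      Step P (L ++ i :: j :: R) (L ++ j :: P.reflectionPerm j i :: R)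
  /-- Sign change of one root, `α ↦ s_α(α) = -α`. -/
  | neg (L R : List ι) (i : ι) :
      Step P (L ++ i :: R) (L ++ P.reflectionPerm i i :: R)

/-- Two ordered lists of roots are equivalent if each of them can be obtained from the other one
by a sequence of conjugations, `s`-permutations and sign changes. -/
def Equivalent (P : RootPairing ι ℝ M N) (Ω Ω' : List ι) : Prop :=
  Relation.ReflTransGen (Step P) Ω Ω' ∧ Relation.ReflTransGen (Step P) Ω' Ω

/-- The simply-laced diagram of the list of roots, with acute and obtuse angles not distinguished,
is `G`. -/
def HasShape {V : Type*} (P : RootPairing ι ℝ M N) (Ω : List ι) (G : SimpleGraph V) : Prop :=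
  ∃ e : V ≃ Fin Ω.length, ∀ u v : V, u ≠ v →
    (G.Adj u v → |P.pairing (Ω.get (e u)) (Ω.get (e v))| = 1) ∧
    (¬ G.Adj u v → P.pairing (Ω.get (e u)) (Ω.get (e v)) = 0)

/-- The simply-laced diagram of the list of roots, with its solid and dotted edges, is `D`. -/
def HasDiagram {V : Type*} (P : RootPairing ι ℝ M N) (Ω : List ι) (D : SignedDiagram V) : Prop :=
  ∃ e : V ≃ Fin Ω.length, ∀ u v : V, u ≠ v →
    (D.solid.Adj u v → P.pairing (Ω.get (e u)) (Ω.get (e v)) = -1) ∧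
    (D.dotted.Adj u v → P.pairing (Ω.get (e u)) (Ω.get (e v)) = 1) ∧
    (¬ D.underlying.Adj u v → P.pairing (Ω.get (e u)) (Ω.get (e v)) = 0)

/-- In the given root system, every Carter list of roots of the shape of `D`, whichever of its
edges are dotted, is equivalent to a Carter list of roots with diagram `D'`. -/
def CanBeTransformed {V V' : Type*} (P : RootPairing ι ℝ M N)
    (D : SignedDiagram V) (D' : SignedDiagram V') : Prop :=
  ∀ Ω : List ι, IsCarter P Ω → HasShape P Ω D.underlying →
    ∃ Ω' : List ι, IsCarter P Ω' ∧ HasDiagram P Ω' D' ∧ Equivalent P Ω Ω'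

/-- Equivalence of two diagrams in the given root system. -/
def DiagramsEquivalent {V V' : Type*} (P : RootPairing ι ℝ M N)
    (D : SignedDiagram V) (D' : SignedDiagram V') : Prop :=
  CanBeTransformed P D D' ∧ CanBeTransformed P D' D

end Roots

end Carter

/-! Part 1: an s-permutation or a sign change leaves the product of the reflections unchanged, and a
conjugation conjugates it (`Step.isConj`). The other parts use the moves in the form of `Loc`:
s-permutations, sign changes and rotations of the list. Unlike arbitrary conjugations, these moves
can be carried out on some of the roots without disturbing the roots orthogonal to them
(`Loc.append_right`), and they preserve the span, hence linear independence.

Two principles settle orders and signs. For the order: in a word whose letters, or blocks of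
letters, form a forest with respect to non-commutation, rotations and commutations realize every
rearrangement, as for Coxeter elements (`Cyc.of_isForest`). Folding a diagram with cycles along an
axis produces such a forest of blocks. For the signs: linearly independent roots cannot have a sum
orthogonal to each of them (`IsForm.exists_sum_ne_zero`). So, after sign changes that make a
spanning tree solid, the cycles force the remaining edges to be dotted or solid.

Part 3: the pure cycle and the square with two paths are the extreme cases of one figure, two arms
issuing from a vertex, with one more vertex joined to both arms at height `j`. When the vertex
between the arms is slid through both of them, it becomes the sum of all roots of the chain. Its
negative is joined by solid edges to the two ends of the arms and to nothing else. This turns the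
arms over and replaces `j` by `k - 1 - j` (`IsForm.lens_flip`). Part 4 is a finite computation with
Gram matrices (`HasGram.exists_loc`).

Part 2: a shortest closed walk which is not a sum of 4-cycles is a chordless cycle with `n ≥ 6`
vertices, and for `n = 6` no vertex is joined to three alternate vertices of it
(`exists_isChordless`). Positive definiteness, used as the strict inequality of Bessel, then
restricts the neighbourhood of such a cycle. All edges on it and to it are simple, its roots live in
an orthogonal frame as in type `D`, and an attached root forces `n = 6` and is joined to one vertex
only. Two attached roots sit either at opposite vertices and are orthogonal, or at neighbouring
vertices and are linked; a third is impossible, and nothing is joined to the attached roots from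
outside. The connected component is therefore a pure cycle or one of three explicit diagrams with 7
or 8 vertices. The pure cycle is turned into a square by the flip, the others are treated by
explicit sequences of moves, and induction deals with the remaining roots (`exists_good`). -/

namespace Carter

/-! ### Weyl group elements of lists, local moves and linear spans -/

section Basic

variable {ι M N : Type*} [AddCommGroup M] [Module ℝ M] [AddCommGroup N] [Module ℝ N]
  (P : RootPairing ι ℝ M N)

lemma weyl_eq_of_smul {u v : P.weylGroup} (h : ∀ x : M, u • x = v • x) : u = v := by
  apply Subtype.ext
  apply RootPairing.Equiv.weightHom_injective P
  ext x
  exact h x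

lemma ofIdx_smul_index (i j : ι) :
    RootPairing.weylGroup.ofIdx P i • j = P.reflectionPerm i j := rfl

lemma ofIdx_smul_vec (i : ι) (x : M) :
    RootPairing.weylGroup.ofIdx P i • x = P.reflection i x := rfl

lemma ofIdx_mul_self (i : ι) :
    RootPairing.weylGroup.ofIdx P i * RootPairing.weylGroup.ofIdx P i = 1 := by
  apply weyl_eq_of_smul
  intro x
  rw [mul_smul, one_smul, ofIdx_smul_vec, ofIdx_smul_vec, P.reflection_same]

lemma reflection_weyl_smul (u : P.weylGroup) :
    ∀ (i : ι) (x : M), P.reflection (u • i) (u • x) = u • P.reflection i x := by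
  obtain ⟨u, hu⟩ := u
  induction hu using RootPairing.weylGroup.induction with
  | mem j =>
    intro i x
    change P.reflection (P.reflectionPerm j i) (P.reflection j x) =
      P.reflection j (P.reflection i x)
    rw [P.reflection_reflectionPerm]
    simp
  | one => intro i x; rfl
  | mul v w hv hw ihv ihw =>
    intro i x
    rw [← Submonoid.mk_mul_mk _ _ _ hv hw, mul_smul, mul_smul, mul_smul, ihv, ihw]

lemma ofIdx_smul_eq (u : P.weylGroup) (i : ι) :
    RootPairing.weylGroup.ofIdx P (u • i) = u * RootPairing.weylGroup.ofIdx P i * u⁻¹ := by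
  apply weyl_eq_of_smul
  intro x
  have := reflection_weyl_smul P u i (u⁻¹ • x)
  rw [smul_inv_smul] at this
  rw [ofIdx_smul_vec, this, mul_smul, mul_smul, ofIdx_smul_vec]

lemma ofIdx_reflectionPerm (i j : ι) :
    RootPairing.weylGroup.ofIdx P (P.reflectionPerm i j) =
      RootPairing.weylGroup.ofIdx P i * RootPairing.weylGroup.ofIdx P j *
        RootPairing.weylGroup.ofIdx P i := by
  rw [← ofIdx_smul_index, ofIdx_smul_eq, inv_eq_of_mul_eq_one_left (ofIdx_mul_self P i)]

/-- Only `conj` changes the product. The other steps are the identities `s_α s_β = s_{s_α(β)} s_α`,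
`s_α s_β = s_β s_{s_β(α)}` and `s_{-α} = s_α`. -/
lemma Step.isConj {Ω Ω' : List ι} (h : Step P Ω Ω') :
    IsConj (weylElement P Ω) (weylElement P Ω') := by
  induction h with
  | conj u Ω =>
    rw [isConj_iff]
    refine ⟨u, ?_⟩
    unfold weylElement
    induction Ω with
    | nil => simp
    | cons i L ih =>
      simp only [List.map_cons, List.prod_cons] at ih ⊢
      rw [← ih, ofIdx_smul_eq]
      group
  | permLeft L R i j =>
    have h : weylElement P (L ++ i :: j :: R) =
        weylElement P (L ++ P.reflectionPerm i j :: i :: R) := by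
      simp only [weylElement, List.map_append, List.map_cons, List.prod_append, List.prod_cons,
        ofIdx_reflectionPerm, mul_assoc]
      rw [← mul_assoc (RootPairing.weylGroup.ofIdx P i) (RootPairing.weylGroup.ofIdx P i),
        ofIdx_mul_self, one_mul]
    rw [h]
  | permRight L R i j =>
    have h : weylElement P (L ++ i :: j :: R) =
        weylElement P (L ++ j :: P.reflectionPerm j i :: R) := by
      simp only [weylElement, List.map_append, List.map_cons, List.prod_append, List.prod_cons,
        ofIdx_reflectionPerm, mul_assoc]
      rw [← mul_assoc (RootPairing.weylGroup.ofIdx P j) (RootPairing.weylGroup.ofIdx P j),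
        ofIdx_mul_self, one_mul]
    rw [h]
  | neg L R i =>
    have h : weylElement P (L ++ i :: R) = weylElement P (L ++ P.reflectionPerm i i :: R) := by
      simp only [weylElement, List.map_append, List.map_cons, List.prod_append, List.prod_cons,
        ofIdx_reflectionPerm, ofIdx_mul_self, one_mul]
    rw [h]

theorem Equivalent.isConj {Ω Ω' : List ι} (h : Equivalent P Ω Ω') :
    IsConj (weylElement P Ω) (weylElement P Ω') := by
  obtain ⟨h, -⟩ := h
  induction h with
  | refl => exact IsConj.refl _
  | tail _ hs ih => exact ih.trans (hs.isConj P)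

/-- The equivalence relation generated by `s`-permutations, sign changes and cyclic rotations. -/
inductive Loc : List ι → List ι → Prop
  | refl (L : List ι) : Loc L L
  | symm {L L' : List ι} : Loc L L' → Loc L' L
  | trans {L L' L'' : List ι} : Loc L L' → Loc L' L'' → Loc L L''
  | hurwitz (L R : List ι) (i j : ι) : Loc (L ++ i :: j :: R) (L ++ P.reflectionPerm i j :: i :: R)
  | neg (L R : List ι) (i : ι) : Loc (L ++ i :: R) (L ++ P.reflectionPerm i i :: R)
  | rot (i : ι) (L : List ι) : Loc (i :: L) (L ++ [i])

variable {P}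

/-- The two s-permutations undo each other, and a conjugation or a sign change is undone by one of
the same kind. Hence only one of the two directions in `Equivalent` ever has to be constructed. -/
lemma Step.reverse {Ω Ω' : List ι} (h : Step P Ω Ω') : Step P Ω' Ω := by
  induction h with
  | conj u Ω =>
    have := Step.conj (P := P) u⁻¹ (Ω.map fun i => u • i)
    simpa [List.map_map, Function.comp_def] using this
  | permLeft L R i j =>
    simpa using Step.permRight (P := P) L R (P.reflectionPerm i j) i
  | permRight L R i j =>
    simpa using Step.permLeft (P := P) L R j (P.reflectionPerm j i)
  | neg L R i =>
    have := Step.neg (P := P) L R (P.reflectionPerm i i)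
    have h2 : P.reflectionPerm (P.reflectionPerm i i) (P.reflectionPerm i i) = i := by
      apply P.root.injective
      simp [RootPairing.root_reflectionPerm, RootPairing.reflection_reflectionPerm]
    rwa [h2] at this

lemma equivalent_of_reflTransGen {Ω Ω' : List ι} (h : Relation.ReflTransGen (Step P) Ω Ω') :
    Equivalent P Ω Ω' := by
  refine ⟨h, ?_⟩
  induction h with
  | refl => exact .refl
  | tail _ hs ih => exact .head hs.reverse ih

lemma Equivalent.symm {Ω Ω' : List ι} (h : Equivalent P Ω Ω') : Equivalent P Ω' Ω := ⟨h.2, h.1⟩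

lemma Equivalent.trans {Ω Ω' Ω'' : List ι} (h : Equivalent P Ω Ω') (h' : Equivalent P Ω' Ω'') :
    Equivalent P Ω Ω'' := ⟨h.1.trans h'.1, h'.2.trans h.2⟩

lemma reflTransGen_slide_right (S T L : List ι) (i : ι) :
    Relation.ReflTransGen (Step P) (S ++ i :: (L ++ T))
      (S ++ (L.map (P.reflectionPerm i)) ++ i :: T) := by
  induction L generalizing S with
  | nil => simpa using .refl
  | cons j L ih =>
    refine .head (Step.permLeft S (L ++ T) i j) ?_
    simpa using ih (S ++ [P.reflectionPerm i j])

lemma Loc.equivalent {Ω Ω' : List ι} (h : Loc P Ω Ω') : Equivalent P Ω Ω' := by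
  induction h with
  | refl L => exact ⟨.refl, .refl⟩
  | symm _ ih => exact ih.symm
  | trans _ _ ih1 ih2 => exact ih1.trans ih2
  | hurwitz L R i j => exact equivalent_of_reflTransGen (.single (.permLeft L R i j))
  | neg L R i => exact equivalent_of_reflTransGen (.single (.neg L R i))
  | rot i L =>
    apply equivalent_of_reflTransGen
    -- The slide of `i` to the end reflects all other roots in `i`. Conjugation by this reflection
    -- restores them and turns `i` into its negative, and a sign change restores `i`.
    have h1 := reflTransGen_slide_right (P := P) [] [] L i
    simp only [List.nil_append, List.append_nil] at h1
    refine h1.trans (.head (.conj (RootPairing.weylGroup.ofIdx P i) _) ?_)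
    refine .head ?_ (.refl (a := L ++ [i]))
    have h2 := Step.neg (P := P) L [] (P.reflectionPerm i i)
    have h3 : P.reflectionPerm (P.reflectionPerm i i) (P.reflectionPerm i i) = i := by
      apply P.root.injective
      simp [RootPairing.root_reflectionPerm, RootPairing.reflection_reflectionPerm]
    rw [h3] at h2
    simpa [List.map_map, Function.comp_def, ofIdx_smul_index] using h2

lemma Loc.length_eq {Ω Ω' : List ι} (h : Loc P Ω Ω') : Ω.length = Ω'.length := by
  induction h with
  | refl L => rfl
  | symm _ ih => exact ih.symm
  | trans _ _ ih1 ih2 => exact ih1.trans ih2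
  | hurwitz L R i j => simp
  | neg L R i => simp
  | rot i L => simp

/-- The linear span of the roots of a list. -/
noncomputable def rootSpan (P : RootPairing ι ℝ M N) (Ω : List ι) : Submodule ℝ M :=
  Submodule.span ℝ (P.root '' {i | i ∈ Ω})

lemma root_mem_rootSpan {Ω : List ι} {i : ι} (h : i ∈ Ω) : P.root i ∈ rootSpan P Ω :=
  Submodule.subset_span ⟨i, h, rfl⟩

lemma rootSpan_le {Ω : List ι} {S : Submodule ℝ M} : rootSpan P Ω ≤ S ↔ ∀ i ∈ Ω, P.root i ∈ S := by
  rw [rootSpan, Submodule.span_le]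
  constructor
  · intro h i hi
    exact h ⟨i, hi, rfl⟩
  · rintro h _ ⟨i, hi, rfl⟩
    exact h i hi

lemma rootSpan_perm {Ω Ω' : List ι} (h : Ω.Perm Ω') : rootSpan P Ω = rootSpan P Ω' := by
  simp [rootSpan, h.mem_iff]

lemma Loc.rootSpan_eq {Ω Ω' : List ι} (h : Loc P Ω Ω') : rootSpan P Ω = rootSpan P Ω' := by
  induction h with
  | refl L => rfl
  | symm _ ih => exact ih.symm
  | trans _ _ ih1 ih2 => exact ih1.trans ih2
  | hurwitz L R i j =>
    apply le_antisymm <;> rw [rootSpan_le] <;> intro k hk <;>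
      simp only [List.mem_append, List.mem_cons] at hk
    · have h1 : P.root (P.reflectionPerm i j) ∈
          rootSpan P (L ++ P.reflectionPerm i j :: i :: R) := root_mem_rootSpan (by simp)
      have h2 : P.root i ∈ rootSpan P (L ++ P.reflectionPerm i j :: i :: R) :=
        root_mem_rootSpan (by simp)
      by_cases hkj : k = j
      · subst hkj
        rw [P.root_reflectionPerm, P.reflection_apply_root] at h1
        have := add_mem h1 (Submodule.smul_mem _ (P.pairing k i) h2)
        simpa using this
      · apply root_mem_rootSpan
        simp only [List.mem_append, List.mem_cons]
        tauto
    · have h1 : P.root j ∈ rootSpan P (L ++ i :: j :: R) := root_mem_rootSpan (by simp)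
      have h2 : P.root i ∈ rootSpan P (L ++ i :: j :: R) := root_mem_rootSpan (by simp)
      by_cases hkj : k = P.reflectionPerm i j
      · subst hkj
        rw [P.root_reflectionPerm, P.reflection_apply_root]
        exact sub_mem h1 (Submodule.smul_mem _ _ h2)
      · apply root_mem_rootSpan
        simp only [List.mem_append, List.mem_cons]
        tauto
  | neg L R i =>
    have hi : P.root (P.reflectionPerm i i) = - P.root i := by
      rw [P.root_reflectionPerm, P.reflection_apply_self]
    apply le_antisymm <;> rw [rootSpan_le] <;> intro k hk <;>
      simp only [List.mem_append, List.mem_cons] at hk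
    · by_cases hki : k = i
      · have : P.root (P.reflectionPerm i i) ∈ rootSpan P (L ++ P.reflectionPerm i i :: R) :=
          root_mem_rootSpan (by simp)
        rw [hi] at this
        rw [hki]
        simpa using this
      · apply root_mem_rootSpan
        simp only [List.mem_append, List.mem_cons]
        tauto
    · by_cases hki : k = P.reflectionPerm i i
      · have : P.root i ∈ rootSpan P (L ++ i :: R) := root_mem_rootSpan (by simp)
        rw [hki, hi]
        simpa using this
      · apply root_mem_rootSpan
        simp only [List.mem_append, List.mem_cons]
        tauto
  | rot i L => exact rootSpan_perm (List.perm_append_singleton i L).symm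

/-- The roots of the list are linearly independent. -/
def Indep (P : RootPairing ι ℝ M N) (Ω : List ι) : Prop :=
  LinearIndependent ℝ fun a : Fin Ω.length => P.root (Ω.get a)

/-- Independence becomes a comparison of the length with the dimension of the span, both of which
are invariant under the moves. -/
lemma indep_iff_finrank {Ω : List ι} :
    Indep P Ω ↔ Ω.length = Module.finrank ℝ (rootSpan P Ω) := by
  have h : rootSpan P Ω = Submodule.span ℝ (Set.range fun a : Fin Ω.length => P.root (Ω.get a)) := by
    rw [rootSpan]
    congr 1
    ext x
    simp only [Set.mem_image, Set.mem_ofPred_eq, Set.mem_range, List.mem_iff_get]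
    constructor
    · rintro ⟨i, ⟨n, rfl⟩, rfl⟩; exact ⟨n, rfl⟩
    · rintro ⟨n, rfl⟩; exact ⟨_, ⟨n, rfl⟩, rfl⟩
  rw [Indep, linearIndependent_iff_card_eq_finrank_span, Fintype.card_fin, Set.finrank, h]

lemma Loc.indep {Ω Ω' : List ι} (h : Loc P Ω Ω') (hi : Indep P Ω) : Indep P Ω' := by
  rw [indep_iff_finrank] at hi ⊢
  rw [← h.length_eq, hi, h.rootSpan_eq]

lemma Indep.perm {Ω Ω' : List ι} (hi : Indep P Ω) (h : Ω.Perm Ω') : Indep P Ω' := by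
  rw [indep_iff_finrank] at hi ⊢
  rw [← h.length_eq, hi, rootSpan_perm h]

lemma Indep.nodup {Ω : List ι} (hi : Indep P Ω) : Ω.Nodup := by
  rw [List.nodup_iff_injective_get]
  intro a b hab
  apply hi.injective
  simp only [hab]

lemma Indep.of_append_left {Ω Ω' : List ι} (hi : Indep P (Ω ++ Ω')) : Indep P Ω := by
  have := hi.comp (fun a : Fin Ω.length => ⟨a.1, by simp; omega⟩) (by
    intro a b hab; simpa [Fin.ext_iff] using hab)
  simpa [Indep, Function.comp_def] using this

end Basic

end Carter

namespace Carter

/-! ### Words up to commutation and rotation -/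

section Cyclic

variable {τ : Type*}

/-- The equivalence relation on words generated by the exchange of adjacent commuting letters and
by cyclic rotations. -/
inductive Cyc (R : τ → τ → Prop) : List τ → List τ → Prop
  | refl (L : List τ) : Cyc R L L
  | symm {L L' : List τ} : Cyc R L L' → Cyc R L' L
  | trans {L L' L'' : List τ} : Cyc R L L' → Cyc R L' L'' → Cyc R L L''
  | swap (L T : List τ) (a b : τ) : R a b → Cyc R (L ++ a :: b :: T) (L ++ b :: a :: T)
  | rot (a : τ) (L : List τ) : Cyc R (a :: L) (L ++ [a])

variable {R : τ → τ → Prop}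

lemma Cyc.perm {L L' : List τ} (h : Cyc R L L') : L.Perm L' := by
  induction h with
  | refl L => exact .refl _
  | symm _ ih => exact ih.symm
  | trans _ _ ih1 ih2 => exact ih1.trans ih2
  | swap L T a b _ => exact (List.Perm.swap b a T).append_left L
  | rot a L => exact (List.perm_append_singleton a L).symm

lemma Cyc.append_comm (U V : List τ) : Cyc R (U ++ V) (V ++ U) := by
  induction U generalizing V with
  | nil => simpa using .refl _
  | cons u U ih =>
    have h1 : Cyc R (u :: U ++ V) (U ++ V ++ [u]) := .rot u (U ++ V)
    have h2 := ih (V ++ [u])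
    simp only [List.append_assoc, List.singleton_append] at h1 h2 ⊢
    exact h1.trans h2

lemma Cyc.move (S V T : List τ) (u : τ) (h : ∀ v ∈ V, R u v) :
    Cyc R (S ++ u :: (V ++ T)) (S ++ V ++ u :: T) := by
  induction V generalizing S with
  | nil => simpa using .refl _
  | cons v V ih =>
    refine (Cyc.swap S (V ++ T) u v (h v (by simp))).trans ?_
    simpa using ih (S ++ [v]) fun w hw => h w (by simp [hw])

lemma Cyc.move_append (S U V T : List τ) (h : ∀ u ∈ U, ∀ v ∈ V, R u v) :
    Cyc R (S ++ U ++ V ++ T) (S ++ V ++ U ++ T) := by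
  induction U generalizing T with
  | nil => simpa using .refl _
  | cons u U ih =>
    have h1 := ih T (fun w hw => h w (by simp [hw]))
    have hm : Cyc R (S ++ u :: U ++ V ++ T) (S ++ (u :: (V ++ (U ++ T)))) := by
      clear h1
      have key : ∀ S' : List τ, Cyc R (S' ++ U ++ V ++ T) (S' ++ V ++ U ++ T) := by
        intro S'
        clear ih
        induction U generalizing S' T with
        | nil => simpa using .refl _
        | cons w U ihU =>
          have a1 := ihU T (fun z hz => h z (by
            rcases List.mem_cons.1 hz with rfl | hz <;> simp [*])) (S' ++ [w])
          have a2 := Cyc.move (R := R) S' V (U ++ T) w (h w (by simp))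
          simp only [List.append_assoc, List.cons_append, List.nil_append] at a1 a2 ⊢
          exact a1.trans a2
      have := key (S ++ [u])
      simpa using this
    refine hm.trans ?_
    have := Cyc.move (R := R) S V (U ++ T) u (h u (by simp))
    simpa using this

lemma Cyc.perm_append {A A' : List τ} (hp : A.Perm A') (S T : List τ)
    (hR : ∀ a b, R a b → R b a) (hA : A.Pairwise R) : Cyc R (S ++ A ++ T) (S ++ A' ++ T) := by
  induction hp generalizing S with
  | nil => exact .refl _
  | cons x _ ih =>
    have := ih (S ++ [x]) (List.pairwise_cons.1 hA).2
    simpa using this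
  | swap x y l =>
    have h := (List.pairwise_cons.1 hA).1 x (by simp)
    simpa using Cyc.swap (R := R) S (l ++ T) y x h
  | trans h1 h2 ih1 ih2 =>
    exact (ih1 S hA).trans (ih2 S (hA.perm h1 (fun h => hR _ _ h)))

/-- Each letter commutes with all but at most one of the later letters. -/
def IsForest (R : τ → τ → Prop) : List τ → Prop
  | [] => True
  | v :: L => L.Pairwise (fun a b => R v a ∨ R v b) ∧ IsForest R L

/-- A leaf `v` in front does not obstruct the moves of the rest. The only question is a rotation of
`L`, where either `v` commutes with the rotated letter or this letter is the single neighbour of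
`v`. -/
lemma Cyc.cons_leaf {L L' : List τ} (h : Cyc R L L') (v : τ)
    (hv : L.Pairwise (fun a b => R v a ∨ R v b)) : Cyc R (v :: L) (v :: L') := by
  have hs : ∀ a b : τ, (R v a ∨ R v b) → (R v b ∨ R v a) := fun a b => Or.symm
  induction h with
  | refl L => exact .refl _
  | symm h ih => exact (ih (hv.perm h.perm.symm (hs _ _))).symm
  | trans h1 h2 ih1 ih2 => exact (ih1 hv).trans (ih2 (hv.perm h1.perm (hs _ _)))
  | swap L T a b hab => exact Cyc.swap (v :: L) T a b hab
  | rot a L =>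
    by_cases hva : R v a
    · exact (Cyc.swap [] L v a hva).trans (Cyc.rot a (v :: L))
    -- Since `v` commutes with all of `L`, the words `v a L`, `a L v`, `a v L`, `v L a` are
    -- successively equivalent.
    · have hL : ∀ b ∈ L, R v b := fun b hb =>
        ((List.pairwise_cons.1 hv).1 b hb).resolve_left hva
      have h1 : Cyc R (v :: a :: L) (a :: L ++ [v]) := .rot v (a :: L)
      have h2 : Cyc R ([a] ++ v :: (L ++ [])) ([a] ++ L ++ v :: []) := Cyc.move [a] L [] v hL
      have h3 : Cyc R (a :: (v :: L)) (v :: L ++ [a]) := .rot a (v :: L)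
      simp only [List.append_nil, List.cons_append, List.nil_append] at h1 h2 h3
      exact (h1.trans h2.symm).trans h3

/-- As for the conjugacy of the Coxeter elements of a forest: the word is rotated until a leaf
stands first, and the other letters are rearranged by induction while the leaf stays in place. -/
lemma Cyc.of_isForest {L L' : List τ} (hL : IsForest R L)
    (hp : L'.Perm L) : Cyc R L' L := by
  induction L generalizing L' with
  | nil => rw [List.perm_nil.1 hp]; exact .refl _
  | cons v L ih =>
    obtain ⟨X, Y, rfl⟩ := List.append_of_mem (hp.mem_iff.2 (List.mem_cons_self (a := v)))
    have hp' : (Y ++ X).Perm L := by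
      have : (v :: (X ++ Y)).Perm (v :: L) := List.perm_middle.symm.trans hp
      exact List.perm_append_comm.trans (List.perm_cons v |>.1 this)
    have h1 : Cyc R (X ++ v :: Y) (v :: (Y ++ X)) := by simpa using Cyc.append_comm X (v :: Y)
    refine h1.trans (Cyc.cons_leaf (ih hL.2 hp') v ?_)
    exact hL.1.perm hp'.symm (fun h => h.symm)

/-- Two words commute if each letter of the first commutes with each letter of the second. -/
def WordsCommute (R : τ → τ → Prop) (U V : List τ) : Prop := ∀ u ∈ U, ∀ v ∈ V, R u v

/-- This allows whole words to serve as the letters of a forest, although the diagram of the single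
letters may contain cycles. -/
lemma Cyc.flatten {B B' : List (List τ)} (h : Cyc (WordsCommute R) B B') :
    Cyc R B.flatten B'.flatten := by
  induction h with
  | refl L => exact .refl _
  | symm _ ih => exact ih.symm
  | trans _ _ ih1 ih2 => exact ih1.trans ih2
  | swap L T a b hab =>
    have := Cyc.move_append (R := R) L.flatten a b T.flatten hab
    simpa using this
  | rot a L =>
    have := Cyc.append_comm (R := R) a L.flatten
    simpa using this

/-- A word of two blocks of mutually commuting letters is equivalent to every other arrangement
of its letters in a forest of words, each of them contained in one of the two blocks. -/
lemma Cyc.of_blocks {A B : List τ} {W : List (List τ)} (hR : ∀ a b, R a b → R b a)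
    (hA : A.Pairwise R) (hB : B.Pairwise R) (hnd : (A ++ B).Nodup)
    (hW : IsForest (WordsCommute R) W) (hp : W.flatten.Perm (A ++ B))
    (hm : ∀ U ∈ W, (∀ x ∈ U, x ∈ A) ∨ (∀ x ∈ U, x ∈ B)) : Cyc R (A ++ B) W.flatten := by
  classical
  -- The words contained in `A` are put first. As no letter is repeated, they exhaust `A`, and the
  -- other words exhaust `B`.
  set p : List τ → Bool := fun U => decide (∀ x ∈ U, x ∈ A)
  have hWW : (W.filter p ++ W.filter fun U => !p U).Perm W := List.filter_append_perm p W
  refine Cyc.trans ?_ (Cyc.of_isForest hW hWW).flatten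
  rw [List.flatten_append]
  have hp2 : ((W.filter p).flatten ++ (W.filter fun U => !p U).flatten).Perm (A ++ B) := by
    rw [← List.flatten_append]
    exact (hWW.flatten).trans hp
  have hnd2 := hp2.nodup_iff.2 hnd
  have hsubA : ∀ x ∈ (W.filter p).flatten, x ∈ A := by
    intro x hx
    obtain ⟨U, hU, hxU⟩ := List.mem_flatten.1 hx
    have := (List.mem_filter.1 hU).2
    exact (of_decide_eq_true this) x hxU
  have hsubB : ∀ x ∈ (W.filter fun U => !p U).flatten, x ∈ B := by
    intro x hx
    obtain ⟨U, hU, hxU⟩ := List.mem_flatten.1 hx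
    obtain ⟨hU1, hU2⟩ := List.mem_filter.1 hU
    rcases hm U hU1 with h | h
    · have : p U = true := decide_eq_true h
      simp [this] at hU2
    · exact h x hxU
  have hdisj := List.disjoint_of_nodup_append hnd
  have hpA : A.Perm (W.filter p).flatten := by
    rw [List.perm_ext_iff_of_nodup (List.Nodup.of_append_left hnd)
      (List.Nodup.of_append_left hnd2)]
    intro x
    refine ⟨fun hx => ?_, hsubA x⟩
    have : x ∈ (W.filter p).flatten ++ (W.filter fun U => !p U).flatten :=
      hp2.mem_iff.2 (by simp [hx])
    rcases List.mem_append.1 this with h | h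
    · exact h
    · exact (hdisj hx (hsubB x h)).elim
  have hpB : B.Perm (W.filter fun U => !p U).flatten := by
    rw [List.perm_ext_iff_of_nodup (List.Nodup.of_append_right hnd)
      (List.Nodup.of_append_right hnd2)]
    intro x
    refine ⟨fun hx => ?_, hsubB x⟩
    have : x ∈ (W.filter p).flatten ++ (W.filter fun U => !p U).flatten :=
      hp2.mem_iff.2 (by simp [hx])
    rcases List.mem_append.1 this with h | h
    · exact (hdisj (hsubA x h) hx).elim
    · exact h
  have h1 := Cyc.perm_append hpA [] B hR hA
  have h2 := Cyc.perm_append hpB (W.filter p).flatten [] hR hB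
  simp only [List.nil_append, List.append_nil] at h1 h2
  exact h1.trans h2

end Cyclic

/-! ### Moves in the presence of orthogonal roots -/

section Local

variable {ι M N : Type*} [AddCommGroup M] [Module ℝ M] [AddCommGroup N] [Module ℝ N]
  {P : RootPairing ι ℝ M N}

lemma Cyc.loc {L L' : List ι} (h : Cyc P.IsOrthogonal L L') : Loc P L L' := by
  induction h with
  | refl L => exact .refl _
  | symm _ ih => exact ih.symm
  | trans _ _ ih1 ih2 => exact ih1.trans ih2
  | swap L T a b hab =>
    have := Loc.hurwitz (P := P) L T a b
    rwa [P.reflectionPerm_eq_of_pairing_eq_zero hab.2] at this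
  | rot a L => exact .rot a L

lemma isOrthogonal_reflectionPerm {i j y : ι} (hi : P.IsOrthogonal i y) (hj : P.IsOrthogonal j y) :
    P.IsOrthogonal (P.reflectionPerm i j) y := by
  constructor
  · rw [← P.root_coroot_eq_pairing, P.root_reflectionPerm, P.reflection_apply_root]
    simp [hi.1, hj.1]
  · rw [← P.root_coroot_eq_pairing, P.coroot_reflectionPerm, P.coreflection_apply_coroot]
    simp [hi.2, hj.2]

/-- The moves only permute the roots and reflect them in one another, and reflections in roots
orthogonal to `y` preserve orthogonality to `y`. -/
lemma Loc.forall_isOrthogonal_iff {L L' : List ι} (h : Loc P L L') (y : ι) :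
    (∀ x ∈ L, P.IsOrthogonal x y) ↔ (∀ x ∈ L', P.IsOrthogonal x y) := by
  induction h with
  | refl L => rfl
  | symm _ ih => exact ih.symm
  | trans _ _ ih1 ih2 => exact ih1.trans ih2
  | hurwitz L R i j =>
    simp only [List.mem_append, List.mem_cons, or_imp, forall_and, forall_eq]
    constructor
    · rintro ⟨h1, h2, h3, h4⟩
      exact ⟨h1, isOrthogonal_reflectionPerm h2 h3, h2, h4⟩
    · rintro ⟨h1, h2, h3, h4⟩
      refine ⟨h1, h3, ?_, h4⟩
      have := isOrthogonal_reflectionPerm h3 h2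
      rwa [P.reflectionPerm_self] at this
  | neg L R i =>
    simp only [List.mem_append, List.mem_cons, or_imp, forall_and, forall_eq]
    constructor
    · rintro ⟨h1, h2, h3⟩
      exact ⟨h1, isOrthogonal_reflectionPerm h2 h2, h3⟩
    · rintro ⟨h1, h2, h3⟩
      refine ⟨h1, ?_, h3⟩
      have h4 := isOrthogonal_reflectionPerm h2 h2
      have h3 : P.reflectionPerm (P.reflectionPerm i i) (P.reflectionPerm i i) = i := by
        apply P.root.injective
        simp [RootPairing.root_reflectionPerm, RootPairing.reflection_reflectionPerm]
      rwa [h3] at h4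
  | rot i L => simp [or_imp, forall_and, and_comm]

/-- Only a rotation notices `C`: it carries the first root behind `C`, from where the root returns
because it is orthogonal to `C`. -/
lemma Loc.append_right {L L' : List ι} (h : Loc P L L') (C : List ι)
    (hC : ∀ x ∈ L, ∀ y ∈ C, P.IsOrthogonal x y) : Loc P (L ++ C) (L' ++ C) := by
  have tr : ∀ {L L' : List ι}, Loc P L L' → (∀ x ∈ L, ∀ y ∈ C, P.IsOrthogonal x y) →
      (∀ x ∈ L', ∀ y ∈ C, P.IsOrthogonal x y) := by
    intro L L' h hC x hx y hy
    exact (h.forall_isOrthogonal_iff y).1 (fun x hx => hC x hx y hy) x hx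
  induction h with
  | refl L => exact .refl _
  | symm h ih => exact (ih (tr h.symm hC)).symm
  | trans h1 h2 ih1 ih2 => exact (ih1 hC).trans (ih2 (tr h1 hC))
  | hurwitz L R i j => simpa using Loc.hurwitz (P := P) L (R ++ C) i j
  | neg L R i => simpa using Loc.neg (P := P) L (R ++ C) i
  | rot i L =>
    have h1 : Loc P (i :: L ++ C) (L ++ C ++ [i]) := .rot i (L ++ C)
    refine h1.trans ?_
    have := (Cyc.move (R := P.IsOrthogonal) L C [] i (hC i (by simp))).loc.symm
    simpa using this

lemma Loc.append_left {L L' : List ι} (h : Loc P L L') (C : List ι)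
    (hC : ∀ x ∈ L, ∀ y ∈ C, P.IsOrthogonal x y) : Loc P (C ++ L) (C ++ L') :=
  ((Cyc.append_comm (R := P.IsOrthogonal) C L).loc.trans (h.append_right C hC)).trans
    (Cyc.append_comm (R := P.IsOrthogonal) L' C).loc

end Local

end Carter

namespace Carter

/-! ### The cycle space modulo 2 and minimal chordless cycles -/

section Cycles

variable {V : Type*} {G : SimpleGraph V}

/-- The vector modulo 2 of the edges of a walk, counted with multiplicity. -/
noncomputable def walkVector {u v : V} (w : G.Walk u v) : Sym2 V → ZMod 2 :=
  (w.edges.map fun e => Set.indicator {e} 1).sum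

lemma walkVector_append {u v w : V} (p : G.Walk u v) (q : G.Walk v w) :
    walkVector (p.append q) = walkVector p + walkVector q := by
  simp [walkVector]

lemma walkVector_reverse {u v : V} (p : G.Walk u v) : walkVector p.reverse = walkVector p := by
  simp [walkVector, List.sum_reverse]

lemma cycleVector_eq_walkVector {v : V} {c : G.Walk v v} (hc : c.edges.Nodup) :
    cycleVector c = walkVector c := by
  unfold cycleVector walkVector
  generalize c.edges = L at hc
  induction L with
  | nil => ext; simp
  | cons e L ih =>
    obtain ⟨h1, h2⟩ := List.nodup_cons.1 hc
    rw [List.map_cons, List.sum_cons, ← ih h2]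
    ext x
    by_cases hx : x = e
    · subst hx; simp [Set.indicator, h1]
    · rw [Pi.add_apply, Set.indicator_of_notMem (s := {e}) (by simpa using hx), zero_add]
      by_cases hL : x ∈ L
      · rw [Set.indicator_of_mem (s := {e' | e' ∈ e :: L}) (List.mem_cons_of_mem e hL),
          Set.indicator_of_mem (s := {e' | e' ∈ L}) hL]
      · have hL' : x ∉ e :: L := by simp [hx, hL]
        rw [Set.indicator_of_notMem (s := {e' | e' ∈ e :: L}) hL',
          Set.indicator_of_notMem (s := {e' | e' ∈ L}) hL]

lemma walkVector_add_self {u v : V} (p : G.Walk u v) : walkVector p + walkVector p = 0 := by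
  ext e
  exact CharTwo.add_self_eq_zero _

/-- The closed walk is not made of 4-cycles. -/
def BadWalk {v : V} (c : G.Walk v v) : Prop :=
  walkVector c ∉ Submodule.span (ZMod 2) (fourCycleVectors G)

lemma exists_append_eq {u v : V} (c : G.Walk u v) {i : ℕ} (hi : i ≤ c.length) :
    ∃ (x : V) (a : G.Walk u x) (b : G.Walk x v), c = a.append b ∧ a.length = i ∧
      x = c.getVert i := by
  induction c generalizing i with
  | nil => exact ⟨_, .nil, .nil, rfl, by simp at hi; simp [hi], by simp⟩
  | cons h p ih =>
    cases i with
    | zero => exact ⟨_, .nil, .cons h p, rfl, rfl, by simp⟩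
    | succ i =>
      obtain ⟨x, a, b, h1, h2, h3⟩ := ih (i := i) (by simpa using hi)
      exact ⟨x, .cons h a, b, by simp [h1], by simp [h2], by simpa using h3⟩

lemma exists_append_append_eq {u v : V} (c : G.Walk u v) {i j : ℕ} (hij : i ≤ j)
    (hj : j ≤ c.length) :
    ∃ (x y : V) (a : G.Walk u x) (b : G.Walk x y) (d : G.Walk y v), c = a.append (b.append d) ∧
      a.length = i ∧ b.length = j - i ∧ x = c.getVert i ∧ y = c.getVert j := by
  obtain ⟨x, a, b, rfl, ha, hx⟩ := exists_append_eq c (hij.trans hj)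
  obtain ⟨y, b, d, rfl, hb, hy⟩ := exists_append_eq b (i := j - i) (by
    rw [SimpleGraph.Walk.length_append] at hj; omega)
  refine ⟨x, y, a, b, d, rfl, ha, hb, hx, ?_⟩
  refine hy.trans ?_
  conv_rhs => rw [SimpleGraph.Walk.getVert_append, ha, if_neg (by omega)]

lemma getVert_append_append {u x y v : V} (a : G.Walk u x) (b : G.Walk x y) (d : G.Walk y v)
    {j : ℕ} (hj : a.length + b.length ≤ j) :
    (a.append (b.append d)).getVert j = d.getVert (j - (a.length + b.length)) := by
  rw [SimpleGraph.Walk.getVert_append, if_neg (by omega), SimpleGraph.Walk.getVert_append,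
    if_neg (by omega), Nat.sub_sub]

/-- The two closed walks add up to the given one modulo 2, since `q` is traversed twice. -/
lemma BadWalk.split {v x y : V} {a : G.Walk v x} {b : G.Walk x y} {d : G.Walk y v}
    (h : BadWalk (a.append (b.append d))) (q : G.Walk x y) :
    BadWalk (a.append (q.append d)) ∨ BadWalk (b.append q.reverse) := by
  by_contra hcon
  simp only [BadWalk, not_or, not_not] at hcon h
  apply h
  have := add_mem hcon.1 hcon.2
  simp only [walkVector_append, walkVector_reverse] at this ⊢
  have h2 := walkVector_add_self q
  have e : walkVector a + (walkVector q + walkVector d) + (walkVector b + walkVector q) =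
      walkVector a + (walkVector b + walkVector d) + (walkVector q + walkVector q) := by abel
  rwa [e, h2, add_zero] at this

/-- All shorter closed walks are made of 4-cycles. -/
def ShorterGood (G : SimpleGraph V) (n : ℕ) : Prop :=
  ∀ (v : V) (c : G.Walk v v), c.length < n → ¬ BadWalk c

/-- A shortcut splits `c` into two closed walks. The numerical hypotheses say that both are shorter
than `c`, and one of them would be bad. -/
lemma BadWalk.no_shortcut {v : V} {c : G.Walk v v} (h : BadWalk c)
    (hmin : ShorterGood G c.length) {i j : ℕ} (hij : i ≤ j) (hj : j ≤ c.length)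
    (q : G.Walk (c.getVert i) (c.getVert j)) (h1 : q.length < j - i)
    (h2 : q.length + (j - i) < c.length) : False := by
  obtain ⟨x, y, a, b, d, hc, ha, hb, hx, hy⟩ := exists_append_append_eq c hij hj
  subst hx hy
  have hlen : c.length = a.length + (b.length + d.length) := by
    conv_lhs => rw [hc]
    simp
  have h' : BadWalk (a.append (b.append d)) := by rwa [hc] at h
  rcases h'.split q with h | h
  · refine hmin _ _ ?_ h
    simp only [SimpleGraph.Walk.length_append]
    omega
  · refine hmin _ _ ?_ h
    simp only [SimpleGraph.Walk.length_append, SimpleGraph.Walk.length_reverse]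
    omega

lemma BadWalk.getVert_injOn {v : V} {c : G.Walk v v} (h : BadWalk c)
    (hmin : ShorterGood G c.length) {i j : ℕ} (hij : i < j) (hj : j < c.length) :
    c.getVert i ≠ c.getVert j := by
  intro he
  exact h.no_shortcut hmin hij.le hj.le (SimpleGraph.Walk.nil.copy rfl he) (by simp; omega)
    (by simp; omega)

lemma BadWalk.chordless {v : V} {c : G.Walk v v} (h : BadWalk c)
    (hmin : ShorterGood G c.length) {i j : ℕ} (hij : i < j) (hj : j < c.length)
    (he : G.Adj (c.getVert i) (c.getVert j)) : j = i + 1 ∨ (i = 0 ∧ j + 1 = c.length) := by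
  by_contra hcon
  refine h.no_shortcut hmin hij.le hj.le he.toWalk ?_ ?_ <;> simp <;> omega

/-- Closed walks of length 0 and 2 have the vector zero, and one of length 4 without repeated
vertices is itself a generator of the span. -/
lemma BadWalk.six_le {v : V} {c : G.Walk v v} (h : BadWalk c)
    (hmin : ShorterGood G c.length) (hev : Even c.length) : 6 ≤ c.length := by
  by_contra hlt
  have inj : ∀ i j : ℕ, i < j → j < c.length → c.getVert i ≠ c.getVert j :=
    fun i j h1 h2 => h.getVert_injOn hmin h1 h2
  have hcases : c.length = 0 ∨ c.length = 2 ∨ c.length = 4 := by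
    obtain ⟨k, hk⟩ := hev; omega
  clear hlt hev hmin
  match c, h, inj, hcases with
  | .nil, h, _, _ => exact h (by simp [walkVector])
  | .cons h1 .nil, _, _, hc => simp at hc
  | .cons h1 (.cons h2 .nil), h, _, _ =>
    apply h
    simp only [walkVector, SimpleGraph.Walk.edges_cons, SimpleGraph.Walk.edges_nil, List.map_cons,
      List.map_nil, List.sum_cons, List.sum_nil, add_zero]
    rw [Sym2.eq_swap]
    have h0 : ∀ x : Sym2 V → ZMod 2, x + x = 0 := fun x => by
      ext e
      exact CharTwo.add_self_eq_zero _
    rw [h0]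
    exact zero_mem _
  | .cons h1 (.cons h2 (.cons h3 .nil)), _, _, hc => simp at hc
  | .cons (v := x) h1 (.cons (v := y) h2 (.cons (v := z) h3 (.cons h4 .nil))), h, inj, _ =>
    have e01 := inj 0 1 (by simp) (by simp)
    have e02 := inj 0 2 (by simp) (by simp)
    have e03 := inj 0 3 (by simp) (by simp)
    have e12 := inj 1 2 (by simp) (by simp)
    have e13 := inj 1 3 (by simp) (by simp)
    have e23 := inj 2 3 (by simp) (by simp)
    simp at e01 e02 e03 e12 e13 e23
    have hcyc : (SimpleGraph.Walk.cons h1 (.cons h2 (.cons h3 (.cons h4 .nil)))).IsCycle := by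
      rw [SimpleGraph.Walk.cons_isCycle_iff]
      simp [SimpleGraph.Walk.cons_isPath_iff, *, Ne.symm e01, Ne.symm e02, Ne.symm e03]
    apply h
    apply Submodule.subset_span
    exact ⟨_, _, hcyc, by simp, (cycleVector_eq_walkVector hcyc.edges_nodup).symm⟩
  | .cons h1 (.cons h2 (.cons h3 (.cons h4 (.cons h5 p)))), _, _, hc => simp at hc

/-- The sequence `a 0, …, a (n - 1)` is a cycle without chords in the relation `r`. -/
structure IsChordless {τ : Type*} (r : τ → τ → Prop) (n : ℕ) (a : ℕ → τ) : Prop where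
  inj : ∀ i j, i < j → j < n → a i ≠ a j
  adj : ∀ i j, i < j → j < n → (r (a i) (a j) ↔ (j = i + 1 ∨ (i = 0 ∧ j + 1 = n)))

/-- No letter is related to three alternate letters of the hexagon. -/
def NoCenter {τ : Type*} (r : τ → τ → Prop) (S : τ → Prop) (a : ℕ → τ) : Prop :=
  ∀ v, S v → ¬ (r v (a 0) ∧ r v (a 2) ∧ r v (a 4)) ∧ ¬ (r v (a 1) ∧ r v (a 3) ∧ r v (a 5))

lemma BadWalk.isChordless {v : V} {c : G.Walk v v} (h : BadWalk c)
    (hmin : ShorterGood G c.length) : IsChordless G.Adj c.length c.getVert where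
  inj i j := h.getVert_injOn hmin
  adj i j hij hj := by
    refine ⟨h.chordless hmin hij hj, ?_⟩
    rintro (rfl | ⟨rfl, hj'⟩)
    · exact c.adj_getVert_succ (by omega)
    · have := c.adj_getVert_succ hj
      rw [hj', c.getVert_length] at this
      simpa using this.symm

lemma BadWalk.noCenter {v : V} {c : G.Walk v v} (h : BadWalk c)
    (hmin : ShorterGood G c.length) (h6 : c.length = 6) :
    NoCenter G.Adj (fun _ => True) c.getVert := by
  have key : ∀ (w : V) (i : ℕ), i ≤ 1 → G.Adj w (c.getVert i) → G.Adj w (c.getVert (i + 2)) →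
      G.Adj w (c.getVert (i + 4)) → False := by
    intro w i hi h0 h2 h4
    obtain ⟨x, y, a, b, d, hc, ha, hb, hx, hy⟩ :=
      exists_append_append_eq c (i := i) (j := i + 2) (by omega) (by omega)
    subst hx hy
    have hlen : c.length = a.length + (b.length + d.length) := by
      conv_lhs => rw [hc]
      simp
    have h' : BadWalk (a.append (b.append d)) := by rwa [hc] at h
    -- The vertex `i + 1` of the hexagon is replaced by `w`. The square that is split off is
    -- shorter, hence good, so the new hexagon is bad and again minimal. It would then be chordless,
    -- but `w` is joined to the opposite vertex `i + 4`.
    rcases h'.split (.cons h0.symm (.cons h2 .nil)) with h | h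
    · have hl : (a.append ((SimpleGraph.Walk.cons h0.symm (.cons h2 .nil)).append d)).length =
          c.length := by
        simp only [SimpleGraph.Walk.length_append, SimpleGraph.Walk.length_cons,
          SimpleGraph.Walk.length_nil]
        omega
      have e1 : (a.append ((SimpleGraph.Walk.cons h0.symm (.cons h2 .nil)).append d)).getVert
          (i + 1) = w := by
        rw [SimpleGraph.Walk.getVert_append, ha, if_neg (by omega)]
        simp
      have e2 : (a.append ((SimpleGraph.Walk.cons h0.symm (.cons h2 .nil)).append d)).getVert
          (i + 4) = c.getVert (i + 4) := by
        conv_rhs => rw [hc]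
        rw [getVert_append_append _ _ _ (by simp; omega), getVert_append_append _ _ _ (by omega)]
        simp only [SimpleGraph.Walk.length_cons, SimpleGraph.Walk.length_nil, hb]
        congr 1
        omega
      have := h.chordless (by rw [hl]; exact hmin) (i := i + 1) (j := i + 4) (by omega)
        (by rw [hl]; omega) (by rw [e1, e2]; exact h4)
      rw [hl] at this
      omega
    · refine hmin _ _ ?_ h
      simp only [SimpleGraph.Walk.length_append, SimpleGraph.Walk.length_reverse,
        SimpleGraph.Walk.length_cons, SimpleGraph.Walk.length_nil]
      omega
  intro w _
  exact ⟨fun h => key w 0 (by omega) h.1 h.2.1 h.2.2, fun h => key w 1 (by omega) h.1 h.2.1 h.2.2⟩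

/-- The minimum is taken over all bad closed walks and not only over cycles, because splitting a
cycle produces arbitrary closed walks. -/
theorem exists_isChordless (hev : ∀ (v : V) (c : G.Walk v v), Even c.length)
    (h : ¬ OnlyFourCycles G) :
    ∃ (n : ℕ) (a : ℕ → V), 6 ≤ n ∧ Even n ∧ IsChordless G.Adj n a ∧
      (n = 6 → NoCenter G.Adj (fun _ => True) a) := by
  classical
  have hex : ∃ n, ∃ (v : V) (c : G.Walk v v), c.length = n ∧ BadWalk c := by
    simp only [OnlyFourCycles, not_forall] at h
    obtain ⟨v, c, hc, hbad⟩ := h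
    rw [cycleVector_eq_walkVector hc.edges_nodup] at hbad
    exact ⟨_, v, c, rfl, hbad⟩
  obtain ⟨v, c, hcn, hbad⟩ := Nat.find_spec hex
  have hmin : ShorterGood G c.length := by
    intro u d hd hbd
    rw [hcn] at hd
    exact Nat.find_min hex hd ⟨u, d, rfl, hbd⟩
  have h6 := hbad.six_le hmin (hev v c)
  exact ⟨c.length, c.getVert, h6, hev v c, hbad.isChordless hmin, hbad.noCenter hmin⟩

/-- The vector of a cycle is not zero, so it cannot lie in the span of the empty set. -/
lemma hasCycle_four_of_onlyFourCycles (h : OnlyFourCycles G) {n : ℕ} (hn : HasCycle G n) :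
    HasCycle G 4 := by
  obtain ⟨v, c, hc, -⟩ := hn
  have hmem := h v c hc
  by_contra hcon
  have he : fourCycleVectors G = ∅ := by
    rw [Set.eq_empty_iff_forall_notMem]
    rintro x ⟨u, d, hd, hl, -⟩
    exact hcon ⟨u, d, hd, hl⟩
  rw [he, Submodule.span_empty, Submodule.mem_bot] at hmem
  cases c with
  | nil => exact hc.ne_nil rfl
  | @cons _ w _ h p =>
    have := congrFun hmem s(v, w)
    simp [cycleVector, Set.indicator] at this

lemma hasCycle_four {a b c d : V} (hab : G.Adj a b) (hbc : G.Adj b c) (hcd : G.Adj c d)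
    (hda : G.Adj d a) (hac : a ≠ c) (hbd : b ≠ d) : HasCycle G 4 := by
  refine ⟨a, .cons hab (.cons hbc (.cons hcd (.cons hda .nil))), ?_, by simp⟩
  rw [SimpleGraph.Walk.cons_isCycle_iff]
  simp [SimpleGraph.Walk.cons_isPath_iff, hab.ne, hbc.ne, hcd.ne, hda.ne, hac, hac.symm, hbd,
    hab.ne.symm, hda.ne.symm]

end Cycles

end Carter

namespace Carter

/-! ### The invariant form and the strict inequality of Bessel -/

section Form

variable {ι M N : Type*} [AddCommGroup M] [Module ℝ M] [AddCommGroup N] [Module ℝ N]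
  {P : RootPairing ι ℝ M N}

/-- A positive definite symmetric bilinear form which is compatible with the root pairing. -/
structure IsForm (P : RootPairing ι ℝ M N) (B : LinearMap.BilinForm ℝ M) : Prop where
  symm : ∀ x y, B x y = B y x
  pos : ∀ x, x ≠ 0 → 0 < B x x
  pairing : ∀ i j, 2 * B (P.root i) (P.root j) = P.pairing i j * B (P.root j) (P.root j)

/-- The canonical form is a sum of squares of the coroot functionals. It is definite because a
vector on which all of them vanish lies in the radical. -/
lemma exists_isForm [Finite ι] (P : RootPairing ι ℝ M N) [P.IsRootSystem] [P.IsCrystallographic] :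
    ∃ B : LinearMap.BilinForm ℝ M, IsForm P B := by
  have := Fintype.ofFinite ι
  refine ⟨P.RootForm, fun x y => P.rootForm_symmetric.eq x y, fun x hx => ?_, fun i j => ?_⟩
  · rw [P.rootForm_apply_apply]
    have hnn : ∀ i ∈ Finset.univ, 0 ≤ P.coroot' i x * P.coroot' i x :=
      fun i _ => mul_self_nonneg _
    refine lt_of_le_of_ne (Finset.sum_nonneg hnn) fun h0 => hx ?_
    have hz : ∀ i, P.coroot' i x = 0 := fun i => by
      have := (Finset.sum_eq_zero_iff_of_nonneg hnn).1 h0.symm i (Finset.mem_univ i)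
      simpa using this
    refine P.rootForm_nondegenerate.1 x fun y => ?_
    rw [P.rootForm_apply_apply]
    simp [hz]
  · exact P.toInvariantForm.two_mul_apply_root_root i j

namespace IsForm

variable {B : LinearMap.BilinForm ℝ M} (hB : IsForm P B)

include hB

lemma root_pos (i : ι) : 0 < B (P.root i) (P.root i) := hB.pos _ (P.ne_zero i)

lemma eq_zero {x : M} (h : B x x = 0) : x = 0 := by
  by_contra hx
  exact (hB.pos x hx).ne' h

lemma apply_eq_zero_iff {i j : ι} :
    B (P.root i) (P.root j) = 0 ↔ P.IsOrthogonal i j := by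
  have h1 := hB.pairing i j
  have h2 := hB.pairing j i
  have hi := hB.root_pos i
  have hj := hB.root_pos j
  constructor
  · intro h
    rw [hB.symm, h] at h2
    rw [h] at h1
    constructor
    · have : P.pairing i j * B (P.root j) (P.root j) = 0 := by linarith
      exact (mul_eq_zero.1 this).resolve_right hj.ne'
    · have : P.pairing j i * B (P.root i) (P.root i) = 0 := by linarith
      exact (mul_eq_zero.1 this).resolve_right hi.ne'
  · intro h
    rw [h.1] at h1
    linarith

lemma isOrthogonal_of_pairing {i j : ι} (h : P.pairing i j = 0) : P.IsOrthogonal i j := by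
  rw [← hB.apply_eq_zero_iff]
  have := hB.pairing i j
  rw [h] at this
  linarith

/-- Strict inequality of Bessel. -/
lemma bessel {κ : Type*} (s : Finset κ) (e : κ → M) (x : M)
    (he : ∀ k ∈ s, B (e k) (e k) ≠ 0)
    (ho : ∀ k ∈ s, ∀ l ∈ s, k ≠ l → B (e k) (e l) = 0) (S : Submodule ℝ M)
    (hS : ∀ k ∈ s, e k ∈ S) (hx : x ∉ S) :
    ∑ k ∈ s, B x (e k) ^ 2 / B (e k) (e k) < B x x := by
  set t : κ → ℝ := fun k => B x (e k) / B (e k) (e k)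
  set y : M := ∑ k ∈ s, t k • e k
  have hy : y ∈ S := Submodule.sum_mem _ fun k hk => Submodule.smul_mem _ _ (hS k hk)
  have hxy : x - y ≠ 0 := fun h => hx (by rw [sub_eq_zero] at h; rwa [h])
  have h1 := hB.pos _ hxy
  have hBxy : B x y = ∑ k ∈ s, B x (e k) ^ 2 / B (e k) (e k) := by
    simp only [y, map_sum, map_smul, smul_eq_mul, t]
    refine Finset.sum_congr rfl fun k _ => ?_
    ring
  have hek : ∀ k ∈ s, B (e k) y = B x (e k) := by
    intro k hk
    simp only [y, map_sum, map_smul, smul_eq_mul]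
    rw [Finset.sum_eq_single k]
    · simp only [t]
      field_simp [he k hk]
    · intro l hl hlk
      rw [ho k hk l hl hlk.symm, mul_zero]
    · exact fun h => (h hk).elim
  have hByy : B y y = ∑ k ∈ s, B x (e k) ^ 2 / B (e k) (e k) := by
    have h2 : B y y = ∑ k ∈ s, t k * B y (e k) := by
      conv_lhs => rw [show B y y = B y (∑ k ∈ s, t k • e k) from rfl]
      rw [map_sum]
      exact Finset.sum_congr rfl fun k _ => by rw [map_smul, smul_eq_mul]
    rw [h2]
    refine Finset.sum_congr rfl fun k hk => ?_
    rw [hB.symm, hek k hk]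
    simp only [t]
    ring
  have hexp : B (x - y) (x - y) = B x x - 2 * B x y + B y y := by
    simp only [map_sub, LinearMap.sub_apply]
    rw [hB.symm y x]
    ring
  rw [hexp, hBxy, hByy] at h1
  linarith

variable [P.IsCrystallographic]

omit hB in
lemma exists_int (i j : ι) : ∃ z : ℤ, P.pairing i j = z := by
  obtain ⟨z, hz⟩ := P.exists_value (S := ℤ) i j
  exact ⟨z, by rw [← hz]; simp⟩

/-- Two non-orthogonal roots are joined by a simple edge, or else the angle is far from the right
angle. -/
lemma simple_or {i j : ι} (h : ¬ P.IsOrthogonal i j) :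
    (|P.pairing i j| = 1 ∧ |P.pairing j i| = 1 ∧
      B (P.root i) (P.root i) = B (P.root j) (P.root j)) ∨
    B (P.root i) (P.root i) * B (P.root j) (P.root j) ≤ 2 * B (P.root i) (P.root j) ^ 2 := by
  have h1 := hB.pairing i j
  have h2 := hB.pairing j i
  have hi := hB.root_pos i
  have hj := hB.root_pos j
  rw [hB.symm] at h2
  obtain ⟨a, ha⟩ := exists_int (P := P) i j
  obtain ⟨b, hb⟩ := exists_int (P := P) j i
  have hne : B (P.root i) (P.root j) ≠ 0 := fun h0 => h (hB.apply_eq_zero_iff.1 h0)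
  rw [ha] at h1
  rw [hb] at h2
  -- Four times the squared cosine is the product of the two Cartan integers. It is positive, and
  -- the alternative is whether it equals 1 or is at least 2.
  have h4 : 4 * B (P.root i) (P.root j) ^ 2 =
      ((a * b : ℤ) : ℝ) * (B (P.root i) (P.root i) * B (P.root j) (P.root j)) := by
    push_cast
    linear_combination (2 * B (P.root i) (P.root j)) * h1 + a * B (P.root j) (P.root j) * h2
  have hpos : 0 < a * b := by
    have : (0 : ℝ) < ((a * b : ℤ) : ℝ) := by
      by_contra hle
      push Not at hle
      nlinarith [mul_pos hi hj, sq_pos_of_ne_zero hne]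
    exact_mod_cast this
  rcases (show a * b = 1 ∨ 2 ≤ a * b by omega) with h5 | h5
  · left
    rcases Int.mul_eq_one_iff_eq_one_or_neg_one.1 h5 with ⟨rfl, rfl⟩ | ⟨rfl, rfl⟩
    · rw [ha, hb]
      push_cast at h1 h2
      refine ⟨by simp, by simp, by linarith⟩
    · rw [ha, hb]
      push_cast at h1 h2
      refine ⟨by simp, by simp, by linarith⟩
  · right
    have : (2 : ℝ) ≤ ((a * b : ℤ) : ℝ) := by exact_mod_cast h5
    nlinarith [mul_pos hi hj]

/-- The squared cosine is at least 1/4 in both cases of `simple_or`. -/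
lemma quarter_le {i j : ι} (h : ¬ P.IsOrthogonal i j) :
    B (P.root i) (P.root i) * B (P.root j) (P.root j) ≤ 4 * B (P.root i) (P.root j) ^ 2 := by
  rcases hB.simple_or h with ⟨h1, -, h2⟩ | h1
  · have h3 := hB.pairing i j
    have h4 : P.pairing i j ^ 2 = 1 := by rw [← sq_abs, h1]; norm_num
    rw [h2]
    have : 4 * B (P.root i) (P.root j) ^ 2 = (2 * B (P.root i) (P.root j)) ^ 2 := by ring
    rw [this, h3, mul_pow, h4]
    linarith [sq (B (P.root j) (P.root j))]
  · linarith [sq_nonneg (B (P.root i) (P.root j))]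

end IsForm

lemma Indep.notMem_rootSpan {Ω L : List ι} {v : ι} (hi : Indep P Ω) (hv : v ∈ Ω) (hvL : v ∉ L)
    (hL : ∀ x ∈ L, x ∈ Ω) : P.root v ∉ rootSpan P L := by
  obtain ⟨k, hk⟩ := List.mem_iff_get.1 hv
  have := hi.notMem_span_image (s := {a | Ω.get a ∈ L}) (x := k) (by change Ω.get k ∉ L; rwa [hk])
  rw [← hk]
  intro hmem
  apply this
  refine (rootSpan_le (S := Submodule.span ℝ _)).2 ?_ hmem
  intro x hx
  obtain ⟨a, ha⟩ := List.mem_iff_get.1 (hL x hx)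
  apply Submodule.subset_span
  exact ⟨a, by change Ω.get a ∈ L; rwa [ha], by change P.root (Ω.get a) = _; rw [ha]⟩

end Form

end Carter

namespace Carter

/-! ### Rotations of chordless cycles -/

section Sequences

variable {τ : Type*} {r : τ → τ → Prop}

/-- The cyclic rotation of a sequence with `n` terms. -/
def rotSeq (n s : ℕ) (a : ℕ → τ) (i : ℕ) : τ := if i + s < n then a (i + s) else a (i + s - n)

lemma rotSeq_eq {n s i k : ℕ} (a : ℕ → τ) (hk : k < n)
    (h : i + s = k ∨ i + s = k + n) : rotSeq n s a i = a k := by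
  unfold rotSeq
  split_ifs
  · congr 1; omega
  · congr 1; omega

lemma exists_rotSeq_eq {n s i : ℕ} (a : ℕ → τ) (hs : s < n) (hi : i < n) :
    ∃ k, k < n ∧ (i + s = k ∨ i + s = k + n) ∧ rotSeq n s a i = a k := by
  by_cases h : i + s < n
  · exact ⟨i + s, h, .inl rfl, rotSeq_eq a h (.inl rfl)⟩
  · exact ⟨i + s - n, by omega, by omega, rotSeq_eq a (by omega) (by omega)⟩

lemma IsChordless.ne {n : ℕ} {a : ℕ → τ} (h : IsChordless r n a) {i j : ℕ} (hi : i < n)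
    (hj : j < n) (hij : i ≠ j) : a i ≠ a j := by
  rcases lt_or_gt_of_ne hij with h1 | h1
  · exact h.inj i j h1 hj
  · exact (h.inj j i h1 hi).symm

/-- Neighbours on the cycle with `n` vertices. -/
def CycAdj (n i j : ℕ) : Prop :=
  j = i + 1 ∨ i = j + 1 ∨ (i = 0 ∧ j + 1 = n) ∨ (j = 0 ∧ i + 1 = n)

instance (n i j : ℕ) : Decidable (CycAdj n i j) := by unfold CycAdj; infer_instance

lemma IsChordless.rel_iff {n : ℕ} {a : ℕ → τ} (h : IsChordless r n a)
    (hr : ∀ x y, r x y → r y x) {i j : ℕ} (hi : i < n) (hj : j < n) (hij : i ≠ j) :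
    r (a i) (a j) ↔ CycAdj n i j := by
  unfold CycAdj
  rcases lt_or_gt_of_ne hij with h1 | h1
  · rw [h.adj i j h1 hj]; omega
  · rw [show r (a i) (a j) ↔ r (a j) (a i) from ⟨hr _ _, hr _ _⟩, h.adj j i h1 hi]; omega

lemma IsChordless.of_rel_iff {n : ℕ} {a : ℕ → τ}
    (h1 : ∀ i j, i < n → j < n → i ≠ j → a i ≠ a j)
    (h2 : ∀ i j, i < n → j < n → i ≠ j → (r (a i) (a j) ↔ CycAdj n i j)) : IsChordless r n a where
  inj i j hij hj := h1 i j (by omega) hj hij.ne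
  adj i j hij hj := by
    rw [h2 i j (by omega) hj hij.ne]
    unfold CycAdj
    omega

lemma IsChordless.rotSeq {n s : ℕ} {a : ℕ → τ} (h : IsChordless r n a)
    (hr : ∀ x y, r x y → r y x) (hs : s < n) : IsChordless r n (rotSeq n s a) := by
  apply IsChordless.of_rel_iff
  · intro i j hi hj hij
    obtain ⟨k, hk, hk1, hk2⟩ := exists_rotSeq_eq a hs hi
    obtain ⟨l, hl, hl1, hl2⟩ := exists_rotSeq_eq a hs hj
    rw [hk2, hl2]
    exact h.ne hk hl (by omega)
  · intro i j hi hj hij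
    obtain ⟨k, hk, hk1, hk2⟩ := exists_rotSeq_eq a hs hi
    obtain ⟨l, hl, hl1, hl2⟩ := exists_rotSeq_eq a hs hj
    rw [hk2, hl2, h.rel_iff hr hk hl (by omega)]
    unfold CycAdj
    omega

end Sequences

/-! ### Sign changes and Gram matrices -/

section Signs

variable {ι M N : Type*} [AddCommGroup M] [Module ℝ M] [AddCommGroup N] [Module ℝ N]
  (P : RootPairing ι ℝ M N)

/-- The index of the negative root. -/
def neg (i : ι) : ι := P.reflectionPerm i i

lemma root_neg (i : ι) : P.root (neg P i) = - P.root i := by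
  rw [neg, P.root_reflectionPerm, P.reflection_apply_self]

lemma coroot_neg (i : ι) : P.coroot (neg P i) = - P.coroot i := by
  rw [neg, P.coroot_reflectionPerm, P.coreflection_apply_self]

lemma pairing_neg_left (i j : ι) : P.pairing (neg P i) j = - P.pairing i j := by
  rw [← P.root_coroot_eq_pairing, root_neg]; simp

lemma pairing_neg_right (i j : ι) : P.pairing i (neg P j) = - P.pairing i j := by
  rw [← P.root_coroot_eq_pairing, coroot_neg]; simp

variable {P}

/-- The sequence of roots changed by signs. -/
def IsSigned (P : RootPairing ι ℝ M N) (a b : ℕ → ι) : Prop := ∀ i, b i = a i ∨ b i = neg P (a i)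

lemma IsSigned.root {a b : ℕ → ι} (h : IsSigned P a b) (i : ℕ) :
    P.root (b i) = P.root (a i) ∨ P.root (b i) = - P.root (a i) := by
  rcases h i with h | h
  · exact .inl (by rw [h])
  · exact .inr (by rw [h, root_neg])

lemma IsSigned.abs_pairing {a b : ℕ → ι} (h : IsSigned P a b) (i j : ℕ) :
    |P.pairing (b i) (b j)| = |P.pairing (a i) (a j)| := by
  rcases h i with h1 | h1 <;> rcases h j with h2 | h2 <;>
    simp [h1, h2, pairing_neg_left, pairing_neg_right]

lemma IsSigned.abs_pairing_right {a b : ℕ → ι} (h : IsSigned P a b) (v : ι) (j : ℕ) :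
    |P.pairing v (b j)| = |P.pairing v (a j)| := by
  rcases h j with h2 | h2 <;> simp [h2, pairing_neg_right]

open Classical in
/-- The signs of a sequence of roots are changed in such a way that the angle between each root
and its parent is obtuse. -/
noncomputable def obtuse (P : RootPairing ι ℝ M N) (a : ℕ → ι) (par : ℕ → ℕ) : ℕ → ι
  | i => if _h : par i < i then
      (if 0 < P.pairing (a i) (obtuse P a par (par i)) then neg P (a i) else a i)
    else a i
termination_by i => i

lemma obtuse_isSigned (a : ℕ → ι) (par : ℕ → ℕ) : IsSigned P a (obtuse P a par) := by
  intro i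
  rw [obtuse]
  split_ifs <;> simp

lemma obtuse_pairing {a : ℕ → ι} {par : ℕ → ℕ} {i : ℕ} (hi : par i < i)
    (h : |P.pairing (a i) (a (par i))| = 1) :
    P.pairing (obtuse P a par i) (obtuse P a par (par i)) = -1 := by
  have h1 : |P.pairing (a i) (obtuse P a par (par i))| = 1 := by
    rw [(obtuse_isSigned a par).abs_pairing_right, h]
  rw [obtuse, dif_pos hi]
  split_ifs with h2
  · rw [pairing_neg_left]
    rw [abs_of_pos h2] at h1
    rw [h1]
  · rcases abs_eq (by norm_num) |>.1 h1 with h3 | h3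
    · rw [h3] at h2; norm_num at h2
    · exact h3

/-- Both pairings are positive multiples of the same value of the symmetric form, so they have the
same sign. -/
lemma IsForm.pairing_eq_of_abs {B : LinearMap.BilinForm ℝ M} (hB : IsForm P B) {i j : ι}
    (h1 : |P.pairing i j| = 1) (h2 : |P.pairing j i| = 1) : P.pairing i j = P.pairing j i := by
  have hi := hB.root_pos i
  have hj := hB.root_pos j
  have e1 := hB.pairing i j
  have e2 := hB.pairing j i
  rw [hB.symm] at e2
  rcases abs_eq (by norm_num) |>.1 h1 with h3 | h3 <;>
    rcases abs_eq (by norm_num) |>.1 h2 with h4 | h4 <;> rw [h3, h4] <;>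
    rw [h3] at e1 <;> rw [h4] at e2 <;> exfalso <;> linarith

/-- Roots whose sum is orthogonal to each of them are not linearly independent. -/
lemma IsForm.exists_sum_ne_zero {B : LinearMap.BilinForm ℝ M} (hB : IsForm P B) {Ω : List ι}
    (hi : Indep P Ω) {a b : ℕ → ι} (hab : IsSigned P a b) (C : Finset ℕ) (hC : C.Nonempty)
    (ha : ∀ i ∈ C, a i ∈ Ω) (hinj : ∀ i ∈ C, ∀ j ∈ C, i ≠ j → a i ≠ a j) :
    ∃ j ∈ C, ∑ i ∈ C, P.pairing (b i) (b j) ≠ 0 := by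
  by_contra! hcon
  set z : M := ∑ i ∈ C, P.root (b i)
  have hz : ∀ j ∈ C, B z (P.root (b j)) = 0 := by
    intro j hj
    have h2 : 2 * B z (P.root (b j)) = 0 := by
      simp only [z, map_sum, LinearMap.sum_apply, Finset.mul_sum, hB.pairing]
      rw [← Finset.sum_mul, hcon j hj, zero_mul]
    linarith
  have hzz : z = 0 := by
    apply hB.eq_zero
    conv_lhs => rw [show B z z = B z (∑ i ∈ C, P.root (b i)) from rfl]
    rw [map_sum]
    exact Finset.sum_eq_zero hz
  obtain ⟨k, hk⟩ := hC
  have hnot := hi.notMem_rootSpan (v := a k) (L := (C.erase k).toList.map a) (ha k hk) (by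
    simp only [List.mem_map, Finset.mem_toList, Finset.mem_erase, not_exists, not_and]
    rintro j ⟨hjk, hj⟩
    exact hinj j hj k hk hjk) (by
    simp only [List.mem_map, Finset.mem_toList, Finset.mem_erase]
    rintro x ⟨j, ⟨-, hj⟩, rfl⟩
    exact ha j hj)
  have hmem : P.root (b k) ∈ rootSpan P ((C.erase k).toList.map a) := by
    have h3 : P.root (b k) = - ∑ i ∈ C.erase k, P.root (b i) := by
      rw [eq_neg_iff_add_eq_zero, Finset.add_sum_erase C (fun i => P.root (b i)) hk]
      exact hzz
    rw [h3]
    refine neg_mem (Submodule.sum_mem _ fun j hj => ?_)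
    have h4 : P.root (a j) ∈ rootSpan P ((C.erase k).toList.map a) :=
      root_mem_rootSpan (List.mem_map.2 ⟨j, by simpa using hj, rfl⟩)
    rcases hab.root j with h | h
    · rwa [h]
    · rw [h]; exact neg_mem h4
  apply hnot
  rcases hab.root k with h | h
  · rwa [h] at hmem
  · rw [h] at hmem
    simpa using neg_mem hmem

/-- The pairings of the roots of a sequence are given by an integral matrix. -/
def HasGram (P : RootPairing ι ℝ M N) (n : ℕ) (g : ℕ → ℕ → ℤ) (b : ℕ → ι) : Prop :=
  ∀ i < n, ∀ j < n, P.pairing (b i) (b j) = g i j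

/-- The pairings of the roots of a sequence are given, up to signs, by an integral matrix. -/
def HasAbsGram (P : RootPairing ι ℝ M N) (n : ℕ) (g : ℕ → ℕ → ℤ) (b : ℕ → ι) : Prop :=
  ∀ i < n, ∀ j < n, |P.pairing (b i) (b j)| = |(g i j : ℝ)|

lemma HasGram.abs {n : ℕ} {g : ℕ → ℕ → ℤ} {b : ℕ → ι} (h : HasGram P n g b) :
    HasAbsGram P n g b := fun i hi j hj => by rw [h i hi j hj]

lemma HasAbsGram.signed {n : ℕ} {g : ℕ → ℕ → ℤ} {a b : ℕ → ι} (h : HasAbsGram P n g a)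
    (hs : IsSigned P a b) : HasAbsGram P n g b :=
  fun i hi j hj => by rw [hs.abs_pairing, h i hi j hj]

end Signs

/-! ### Signs on a cycle of independent roots -/

section CycleGram

/-- The matrix of the pure cycle with one dotted edge. -/
def cycleGram (n i j : ℕ) : ℤ :=
  if i = j then 2 else if j = i + 1 ∨ i = j + 1 then -1
  else if (i = 0 ∧ j + 1 = n) ∨ (j = 0 ∧ i + 1 = n) then 1 else 0

variable {ι M N : Type*} [AddCommGroup M] [Module ℝ M] [AddCommGroup N] [Module ℝ N]
  {P : RootPairing ι ℝ M N}

/-- These are the column sums `2 - 1 - 1` of the affine Cartan matrix of the cycle, which serves to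
exclude a cycle with solid edges only. -/
lemma sum_affine_cycle {n j : ℕ} (hn : 3 ≤ n) (hj : j < n) :
    ∑ i ∈ Finset.range n, (if i = j then (2 : ℝ) else if CycAdj n i j then -1 else 0) = 0 := by
  set s := if j + 1 = n then 0 else j + 1
  set p := if j = 0 then n - 1 else j - 1
  have hs : s = if j + 1 = n then 0 else j + 1 := rfl
  have hp : p = if j = 0 then n - 1 else j - 1 := rfl
  have h : ∀ i ∈ Finset.range n, (if i = j then (2 : ℝ) else if CycAdj n i j then -1 else 0) =
      (if j = i then 2 else 0) + (if s = i then -1 else 0) + (if p = i then -1 else 0) := by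
    intro i hi
    rw [Finset.mem_range] at hi
    have h1 : (j = i) ↔ (i = j) := eq_comm
    by_cases e1 : i = j
    · have e2 : ¬ s = i := by split_ifs at hs <;> omega
      have e3 : ¬ p = i := by split_ifs at hp <;> omega
      simp [e1] at e2 e3 ⊢
      simp [e2, e3]
    · by_cases e2 : s = i
      · have e3 : ¬ p = i := by split_ifs at hs hp <;> omega
        have e4 : CycAdj n i j := by unfold CycAdj; split_ifs at hs <;> omega
        simp [h1, e1, e2, e3, e4]
      · by_cases e3 : p = i
        · have e4 : CycAdj n i j := by unfold CycAdj; split_ifs at hp <;> omega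
          simp [h1, e1, e2, e3, e4]
        · have e4 : ¬ CycAdj n i j := by
            unfold CycAdj; split_ifs at hs hp <;> omega
          simp [h1, e1, e2, e3, e4]
  have hsn : s < n := by split_ifs at hs <;> omega
  have hpn : p < n := by split_ifs at hp <;> omega
  rw [Finset.sum_congr rfl h, Finset.sum_add_distrib, Finset.sum_add_distrib, Finset.sum_ite_eq,
    Finset.sum_ite_eq, Finset.sum_ite_eq]
  simp only [Finset.mem_range, hj, hsn, hpn, if_true]
  norm_num

/-- The signs of a cycle of linearly independent roots can be chosen in such a way that exactly one
edge is dotted. -/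
lemma IsForm.exists_cycleGram {B : LinearMap.BilinForm ℝ M} (hB : IsForm P B) {Ω : List ι}
    (hi : Indep P Ω) {n : ℕ} (hn : 3 ≤ n) {a : ℕ → ι} (ha : ∀ i < n, a i ∈ Ω)
    (hinj : ∀ i < n, ∀ j < n, i ≠ j → a i ≠ a j) (hg : HasAbsGram P n (cycleGram n) a) :
    ∃ b, IsSigned P a b ∧ HasGram P n (cycleGram n) b := by
  set b := obtuse P a (fun i => i - 1)
  have hab : IsSigned P a b := obtuse_isSigned a _
  have hb := hg.signed hab
  have hsucc : ∀ i, i + 1 < n → P.pairing (b (i + 1)) (b i) = -1 := by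
    intro i hi
    have := obtuse_pairing (P := P) (a := a) (par := fun i => i - 1) (i := i + 1) (by simp) (by
      rw [hg _ hi _ (by simp; omega)]
      simp [cycleGram])
    simpa using this
  have hsucc' : ∀ i, i + 1 < n → P.pairing (b i) (b (i + 1)) = -1 := by
    intro i hi
    rw [← hsucc i hi]
    apply hB.pairing_eq_of_abs
    · rw [hb i (by omega) (i + 1) hi]; simp [cycleGram]
    · rw [hb (i + 1) hi i (by omega)]; simp [cycleGram]
  have hlast : |P.pairing (b 0) (b (n - 1))| = 1 := by
    rw [hb 0 (by omega) (n - 1) (by omega)]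
    have : cycleGram n 0 (n - 1) = 1 := by
      unfold cycleGram
      rw [if_neg (by omega), if_neg (by omega), if_pos (by omega)]
    simp [this]
  have hlast' : |P.pairing (b (n - 1)) (b 0)| = 1 := by
    rw [hb (n - 1) (by omega) 0 (by omega)]
    have : cycleGram n (n - 1) 0 = 1 := by
      unfold cycleGram
      rw [if_neg (by omega), if_neg (by omega), if_pos (by omega)]
    simp [this]
  have hsym := hB.pairing_eq_of_abs hlast hlast'
  have hzero : ∀ i < n, ∀ j < n, i ≠ j → ¬ CycAdj n i j → P.pairing (b i) (b j) = 0 := by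
    intro i hi j hj hij hadj
    have := hb i hi j hj
    unfold CycAdj at hadj
    have h0 : cycleGram n i j = 0 := by
      unfold cycleGram
      rw [if_neg hij, if_neg (by omega), if_neg (by omega)]
    rw [h0] at this
    simpa using this
  -- The edges of the path are already solid. If the closing edge were solid too, the matrix would
  -- be affine and the sum of the roots orthogonal to each of them.
  have hone : P.pairing (b 0) (b (n - 1)) = 1 := by
    rcases abs_eq (by norm_num) |>.1 hlast with h | h
    · exact h
    exfalso
    obtain ⟨j, hj, hne⟩ := hB.exists_sum_ne_zero hi hab (Finset.range n)
      ⟨0, Finset.mem_range.2 (by omega)⟩ (fun i hi => ha i (Finset.mem_range.1 hi))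
      (fun i hi j hj => hinj i (Finset.mem_range.1 hi) j (Finset.mem_range.1 hj))
    rw [Finset.mem_range] at hj
    apply hne
    rw [← sum_affine_cycle hn hj]
    refine Finset.sum_congr rfl fun i hi => ?_
    rw [Finset.mem_range] at hi
    by_cases hij : i = j
    · rw [if_pos hij, hij, P.pairing_same]
    rw [if_neg hij]
    by_cases hadj : CycAdj n i j
    · rw [if_pos hadj]
      rcases hadj with rfl | rfl | ⟨rfl, h2⟩ | ⟨rfl, h2⟩
      · exact hsucc' i hj
      · exact hsucc j hi
      · rw [show j = n - 1 by omega]; exact h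
      · rw [show i = n - 1 by omega, ← hsym]; exact h
    · rw [if_neg hadj]
      exact hzero i hi j hj hij hadj
  refine ⟨b, hab, fun i hi j hj => ?_⟩
  unfold cycleGram
  split_ifs with h1 h2 h3
  · rw [h1, P.pairing_same]; simp
  · rcases h2 with rfl | rfl
    · rw [hsucc' i hj]; simp
    · rw [hsucc j hi]; simp
  · rcases h3 with ⟨rfl, h3⟩ | ⟨rfl, h3⟩
    · rw [show j = n - 1 by omega, hone]; simp
    · rw [show i = n - 1 by omega, ← hsym, hone]; simp
  · rw [hzero i hi j hj h1 (by unfold CycAdj; omega)]; simp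

end CycleGram

end Carter

namespace Carter

/-! ### The orthogonal frame of a cycle, as in type D -/

section Frame

variable {ι M N : Type*} [AddCommGroup M] [Module ℝ M] [AddCommGroup N] [Module ℝ N]
  {P : RootPairing ι ℝ M N}

/-- Twice the coordinates of a vector in the orthogonal frame of a cycle, in terms of its pairings
with the roots of the cycle. -/
def frameCoord (n : ℕ) (m : ℕ → ℤ) (k : ℕ) : ℤ :=
  ∑ j ∈ Finset.range n, m j - 2 * ∑ j ∈ Finset.range k, m j

/-- An orthogonal frame in which the roots of the cycle are differences of consecutive vectors. -/
structure IsFrame (P : RootPairing ι ℝ M N) (B : LinearMap.BilinForm ℝ M) (L : ℝ) (n : ℕ)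
    (b : ℕ → ι) (e : ℕ → M) : Prop where
  norm : ∀ k < n, B (e k) (e k) = L / 2
  orth : ∀ k < n, ∀ l < n, k ≠ l → B (e k) (e l) = 0
  length : ∀ i < n, B (P.root (b i)) (P.root (b i)) = L
  mem : ∀ k < n, e k ∈ Submodule.span ℝ ((fun i => P.root (b i)) '' {i | i < n})
  coord : ∀ (v : ι) (m : ℕ → ℤ), (∀ j < n, P.pairing v (b j) = m j) → ∀ k ≤ n,
    B (P.root v) (e k) = L / 4 * frameCoord n m k

/-- The frame is half the sum of all the roots minus the partial sums. Consecutive vectors differ by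
the roots of the cycle, and `e n = - e 0`. So the last root, the one on the far side of the dotted
edge, is `e (n - 1) + e 0`, as in the standard model of `D_n`. -/
lemma IsForm.exists_isFrame {B : LinearMap.BilinForm ℝ M} (hB : IsForm P B) {n : ℕ} (hn : 3 ≤ n)
    {b : ℕ → ι} (hg : HasGram P n (cycleGram n) b) :
    ∃ (L : ℝ) (e : ℕ → M), 0 < L ∧ IsFrame P B L n b e := by
  set L := B (P.root (b 0)) (P.root (b 0))
  have hL : ∀ i < n, B (P.root (b i)) (P.root (b i)) = L := by
    intro i hi
    induction i with
    | zero => rfl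
    | succ i ih =>
      have h1 := hB.pairing (b (i + 1)) (b i)
      have h2 := hB.pairing (b i) (b (i + 1))
      rw [hg _ hi _ (by omega), ih (by omega)] at h1
      rw [hg _ (by omega) _ hi, hB.symm] at h2
      simp [cycleGram] at h1 h2
      linarith
  have hr : ∀ i < n, ∀ j < n, B (P.root (b i)) (P.root (b j)) = L / 2 * cycleGram n i j := by
    intro i hi j hj
    have := hB.pairing (b i) (b j)
    rw [hg i hi j hj, hL j hj] at this
    linarith
  set E : M := (1 / 2 : ℝ) • ∑ j ∈ Finset.range n, P.root (b j)
  set e : ℕ → M := fun k => E - ∑ j ∈ Finset.range k, P.root (b j)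
  have hsucc : ∀ k, e (k + 1) = e k - P.root (b k) := by
    intro k
    simp only [e, Finset.sum_range_succ]
    abel
  -- The matrix differs from the affine one, whose columns sum to zero, only by 2 at the two entries
  -- of the dotted edge.
  have hE : ∀ j < n, B E (P.root (b j)) = L / 2 * (if j = 0 ∨ j + 1 = n then 1 else 0) := by
    intro j hj
    have h1 : B E (P.root (b j)) = 1 / 2 * ∑ i ∈ Finset.range n, L / 2 * (cycleGram n i j : ℝ) := by
      simp only [E, map_smul, map_sum, LinearMap.smul_apply, LinearMap.sum_apply, smul_eq_mul]
      congr 1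
      exact Finset.sum_congr rfl fun i hi => hr i (Finset.mem_range.1 hi) j hj
    have h2 := sum_affine_cycle hn hj
    have h3 : ∀ i ∈ Finset.range n, (cycleGram n i j : ℝ) =
        (if i = j then (2 : ℝ) else if CycAdj n i j then -1 else 0) +
        (if (if j = 0 then n - 1 else 0) = i then (if j = 0 ∨ j + 1 = n then 2 else 0) else 0) := by
      intro i hi
      rw [Finset.mem_range] at hi
      unfold cycleGram
      by_cases e1 : i = j
      · subst e1
        rw [if_pos rfl, if_pos rfl]
        split_ifs <;> first | omega | norm_num
      · rw [if_neg e1, if_neg e1]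
        by_cases e2 : CycAdj n i j
        · rw [if_pos e2]
          unfold CycAdj at e2
          split_ifs <;> first | omega | norm_num
        · rw [if_neg e2]
          unfold CycAdj at e2
          split_ifs <;> first | omega | norm_num
    rw [h1, ← Finset.mul_sum, Finset.sum_congr rfl h3, Finset.sum_add_distrib, h2,
      Finset.sum_ite_eq, if_pos (by rw [Finset.mem_range]; split_ifs <;> omega)]
    split_ifs <;> ring
  have her : ∀ k < n, ∀ j < n, B (e k) (P.root (b j)) =
      L / 2 * (if j = k then 1 else if j + 1 = k then -1 else
        if k = 0 ∧ j + 1 = n then 1 else 0) := by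
    intro k hk j hj
    induction k with
    | zero =>
      simp only [e, Finset.range_zero, Finset.sum_empty, sub_zero]
      rw [hE j hj]
      congr 1
      rw [if_neg (show ¬ j + 1 = 0 by omega)]
      by_cases e1 : j = 0
      · simp [e1]
      · simp [e1]
    | succ k ih =>
      rw [hsucc, map_sub, LinearMap.sub_apply, ih (by omega), hr k (by omega) j hj]
      rw [← mul_sub]
      congr 1
      rw [if_neg (show ¬ (k + 1 = 0 ∧ j + 1 = n) by omega)]
      unfold cycleGram
      by_cases e1 : k = j
      · subst e1
        rw [if_pos rfl, if_pos rfl, if_neg (by omega), if_pos rfl]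
        norm_num
      · rw [if_neg (Ne.symm e1), if_neg e1]
        split_ifs <;> first | omega | norm_num
  have hnorm : ∀ k < n, B (e k) (e k) = L / 2 := by
    intro k hk
    induction k with
    | zero =>
      have h0 : e 0 = E := by simp [e]
      conv_lhs => rw [show B (e 0) (e 0) = B (e 0) E by rw [h0]]
      simp only [E, map_smul, map_sum, smul_eq_mul]
      have h3 : ∀ i ∈ Finset.range n, B (e 0) (P.root (b i)) =
          (if 0 = i then L / 2 else 0) + (if n - 1 = i then L / 2 else 0) := by
        intro i hi
        rw [Finset.mem_range] at hi
        rw [her 0 (by omega) i hi, if_neg (show ¬ i + 1 = 0 by omega)]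
        split_ifs <;> first | omega | ring1
      rw [Finset.sum_congr rfl h3, Finset.sum_add_distrib, Finset.sum_ite_eq, Finset.sum_ite_eq,
        if_pos (by rw [Finset.mem_range]; omega), if_pos (by rw [Finset.mem_range]; omega)]
      ring
    | succ k ih =>
      have h1 := her k (by omega) k (by omega)
      rw [if_pos rfl] at h1
      have h2 := hL k (by omega)
      simp only [hsucc, map_sub, LinearMap.sub_apply]
      rw [ih (by omega), h2, hB.symm (P.root (b k)), h1]
      ring
  have horth : ∀ k l, k < l → l < n → B (e k) (e l) = 0 := by
    intro k l hkl hl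
    obtain ⟨d, rfl⟩ := Nat.exists_eq_add_of_lt hkl
    induction d with
    | zero =>
      have h1 := her k (by omega) k (by omega)
      rw [if_pos rfl] at h1
      rw [Nat.add_zero, hsucc, map_sub, hnorm k (by omega), h1]
      ring
    | succ d ih =>
      rw [show k + (d + 1) + 1 = (k + d + 1) + 1 by ring, hsucc, map_sub, ih (by omega) (by omega),
        her k (by omega) _ (by omega), if_neg (by omega), if_neg (by omega), if_neg (by omega)]
      ring
  refine ⟨L, e, hB.root_pos _, hnorm, ?_, hL, ?_, ?_⟩
  · intro k hk l hl hkl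
    rcases lt_or_gt_of_ne hkl with h | h
    · exact horth k l h hl
    · rw [hB.symm]; exact horth l k h hk
  · intro k hk
    have hE' : E ∈ Submodule.span ℝ ((fun i => P.root (b i)) '' {i | i < n}) :=
      Submodule.smul_mem _ _ (Submodule.sum_mem _ fun i hi =>
        Submodule.subset_span ⟨i, Finset.mem_range.1 hi, rfl⟩)
    exact sub_mem hE' (Submodule.sum_mem _ fun i hi =>
      Submodule.subset_span ⟨i, (Finset.mem_range.1 hi).trans hk, rfl⟩)
  · intro v m hm k hk
    have hBv : ∀ j < n, B (P.root v) (P.root (b j)) = L / 2 * m j := by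
      intro j hj
      have := hB.pairing v (b j)
      rw [hm j hj, hL j hj] at this
      linarith
    simp only [e, E, map_sub, map_smul, map_sum, smul_eq_mul, frameCoord]
    rw [Finset.sum_congr rfl fun j hj => hBv j (Finset.mem_range.1 hj),
      Finset.sum_congr (s₁ := Finset.range k) rfl fun j hj =>
        hBv j ((Finset.mem_range.1 hj).trans_le hk), ← Finset.mul_sum, ← Finset.mul_sum]
    push_cast
    ring

lemma frameCoord_succ (n : ℕ) (m : ℕ → ℤ) (k : ℕ) :
    frameCoord n m (k + 1) = frameCoord n m k - 2 * m k := by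
  unfold frameCoord
  rw [Finset.sum_range_succ]
  ring

/-- This expresses `e n = - e 0`. -/
lemma frameCoord_self (n : ℕ) (m : ℕ → ℤ) : frameCoord n m n = - frameCoord n m 0 := by
  unfold frameCoord
  simp
  ring

/-- The possible coordinates of a vector which is joined to a cycle by simple edges. -/
lemma frameCoord_cases {n : ℕ} (hn : 6 ≤ n) (hev : Even n) {m : ℕ → ℤ}
    (halt : ∀ i < n, ∀ j < n, CycAdj n i j → m i = 0 ∨ m j = 0)
    (hsum : ∑ k ∈ Finset.range n, frameCoord n m k ^ 2 < 8) :
    (∀ j < n, m j = 0) ∨ (n = 6 ∧ ∀ k < n, frameCoord n m k ^ 2 = 1) := by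
  set X := frameCoord n m
  have hpar : ∀ k, X k % 2 = X 0 % 2 := by
    intro k
    induction k with
    | zero => rfl
    | succ k ih => rw [← ih, show X (k + 1) = X k - 2 * m k from frameCoord_succ n m k]; omega
  -- All coordinates have the same parity. If they are even, two nonzero ones already contribute 8
  -- to the sum. A single one, at `k`, makes the pairings with both roots that involve `e k`
  -- nonzero, although these roots are neighbours on the cycle.
  rcases Int.emod_two_eq_zero_or_one (X 0) with h0 | h1
  · left
    have hsmall : ∀ k < n, ∀ l < n, k ≠ l → X k ^ 2 + X l ^ 2 < 8 := by
      intro k hk l hl hkl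
      refine lt_of_le_of_lt ?_ hsum
      have := Finset.sum_le_sum_of_subset_of_nonneg (s := {k, l}) (t := Finset.range n)
        (f := fun k => X k ^ 2) (by
          intro x hx
          simp only [Finset.mem_insert, Finset.mem_singleton] at hx
          rw [Finset.mem_range]; omega) (fun i _ _ => sq_nonneg _)
      rwa [Finset.sum_pair hkl] at this
    have hX : ∀ k < n, X k = 0 ∨ X k = 2 ∨ X k = -2 := by
      intro k hk
      have h2 : X k ^ 2 < 8 := by
        have := hsmall k hk (if k = 0 then 1 else 0) (by split_ifs <;> omega)
          (by split_ifs <;> omega)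
        nlinarith [sq_nonneg (X (if k = 0 then 1 else 0))]
      have h3 := hpar k
      have h4 : X k < 3 := by nlinarith
      have h5 : -3 < X k := by nlinarith
      omega
    have hone : ∀ k < n, ∀ l < n, k ≠ l → X k = 0 ∨ X l = 0 := by
      intro k hk l hl hkl
      have := hsmall k hk l hl hkl
      rcases hX k hk with h | h | h
      · exact .inl h
      · rcases hX l hl with h' | h' | h' <;> rw [h, h'] at this <;>
          norm_num at this <;> exact .inr h'
      · rcases hX l hl with h' | h' | h' <;> rw [h, h'] at this <;>
          norm_num at this <;> exact .inr h'
    have hzero : ∀ k < n, X k = 0 := by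
      intro k hk
      by_contra hk0
      have hk1 : m k ≠ 0 := by
        intro hmk
        have hs : X (k + 1) = X k := by 
          rw [show X (k + 1) = X k - 2 * m k from frameCoord_succ n m k, hmk]
          ring
        by_cases hkn : k + 1 < n
        · rcases hone k hk (k + 1) hkn (by omega) with h | h
          · exact hk0 h
          · exact hk0 (by rw [← hs, h])
        · have h2 : X n = - X 0 := frameCoord_self n m
          rw [show n = k + 1 by omega, hs] at h2
          rcases hone k hk 0 (by omega) (by omega) with h | h
          · exact hk0 h
          · exact hk0 (by rw [h2, h]; rfl)
      rcases Nat.eq_zero_or_pos k with rfl | hkpos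
      · have h2 : X n = - X 0 := frameCoord_self n m
        have h3 : X n = X (n - 1) - 2 * m (n - 1) := by
          have := frameCoord_succ n m (n - 1)
          rwa [show n - 1 + 1 = n by omega] at this
        have h4 := (hone 0 hk (n - 1) (by omega) (by omega)).resolve_left hk0
        rcases halt 0 hk (n - 1) (by omega) (by unfold CycAdj; omega) with h | h
        · exact hk1 h
        · rw [h, h4] at h3
          omega
      · have h3 : X k = X (k - 1) - 2 * m (k - 1) := by
          have := frameCoord_succ n m (k - 1)
          rwa [show k - 1 + 1 = k by omega] at this
        have h4 := (hone k hk (k - 1) (by omega) (by omega)).resolve_left hk0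
        rcases halt k hk (k - 1) (by omega) (by unfold CycAdj; omega) with h | h
        · exact hk1 h
        · rw [h, h4] at h3
          exact hk0 (by rw [h3]; ring)
    intro j hj
    have h2 : X (j + 1) = X j - 2 * m j := frameCoord_succ n m j
    have h3 := hzero j hj
    by_cases hjn : j + 1 < n
    · have := hzero _ hjn
      omega
    · have h4 : X n = - X 0 := frameCoord_self n m
      have := hzero 0 (by omega)
      rw [show j + 1 = n by omega] at h2
      omega
  -- If they are odd, each square is at least 1, so `n < 8` and `n = 6`. A square other than 1 is at
  -- least 9 and exceeds the bound.
  · right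
    have hodd : ∀ k, 1 ≤ X k ^ 2 := by
      intro k
      have h3 := hpar k
      have h4 : X k ≠ 0 := by intro h; rw [h] at h3; omega
      have : 0 < X k ^ 2 := by positivity
      omega
    have hle : (n : ℤ) ≤ ∑ k ∈ Finset.range n, X k ^ 2 := by
      have := Finset.sum_le_sum (s := Finset.range n) (f := fun _ => (1 : ℤ))
        (g := fun k => X k ^ 2) (fun k _ => hodd k)
      simpa using this
    obtain ⟨c, hc⟩ := hev
    have hn6 : n = 6 := by omega
    refine ⟨hn6, fun k hk => ?_⟩
    by_contra hne
    have h3 := hpar k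
    have h4 : 9 ≤ X k ^ 2 := by
      have h5 : 3 ≤ X k ∨ X k ≤ -3 := by
        by_contra hcon
        have : X k = 1 ∨ X k = -1 := by omega
        rcases this with h | h <;> rw [h] at hne <;> simp at hne
      rcases h5 with h | h <;> nlinarith
    have h6 : X k ^ 2 ≤ ∑ k ∈ Finset.range n, X k ^ 2 :=
      Finset.single_le_sum (f := fun k => X k ^ 2) (fun i _ => sq_nonneg _)
        (Finset.mem_range.2 hk)
    omega

end Frame

end Carter

namespace Carter

/-! ### Simplicity of the edges on and at a chordless cycle -/

section Neighbours

variable {ι M N : Type*} [AddCommGroup M] [Module ℝ M] [AddCommGroup N] [Module ℝ N]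
  {P : RootPairing ι ℝ M N}

/-- The roots are not orthogonal. -/
def Linked (P : RootPairing ι ℝ M N) (i j : ι) : Prop := ¬ P.IsOrthogonal i j

lemma Linked.symm {i j : ι} (h : Linked P i j) : Linked P j i := fun h' => h h'.symm

/-- The predicate is a colouring of the list of roots: distinct roots of the same colour are
orthogonal. -/
def IsColouring (P : RootPairing ι ℝ M N) (Ω : List ι) (C : ι → Prop) : Prop :=
  ∀ x ∈ Ω, ∀ y ∈ Ω, x ≠ y → Linked P x y → (C x ↔ ¬ C y)

lemma IsColouring.not_linked {Ω : List ι} {C : ι → Prop} (hC : IsColouring P Ω C) {x y z : ι}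
    (hx : x ∈ Ω) (hy : y ∈ Ω) (hz : z ∈ Ω) (hxy : x ≠ y) (hyz : y ≠ z) (hxz : x ≠ z)
    (h1 : Linked P x y) (h2 : Linked P y z) : P.IsOrthogonal x z := by
  by_contra h3
  have e1 := hC x hx y hy hxy h1
  have e2 := hC y hy z hz hyz h2
  have e3 := hC x hx z hz hxz h3
  tauto

/-- A chordless cycle in a list of linearly independent roots with a colouring. -/
structure ChordlessIn (P : RootPairing ι ℝ M N) (Ω : List ι) (n : ℕ) (a : ℕ → ι) : Prop where
  six_le : 6 ≤ n
  mem : ∀ i < n, a i ∈ Ω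
  chordless : IsChordless (Linked P) n a

lemma ChordlessIn.rotSeq {Ω : List ι} {n s : ℕ} {a : ℕ → ι} (h : ChordlessIn P Ω n a)
    (hs : s < n) : ChordlessIn P Ω n (rotSeq n s a) where
  six_le := h.six_le
  mem i hi := by
    obtain ⟨k, hk, -, hk2⟩ := exists_rotSeq_eq a hs hi
    rw [hk2]; exact h.mem k hk
  chordless := h.chordless.rotSeq (fun _ _ => Linked.symm) hs

lemma ChordlessIn.linked_iff {Ω : List ι} {n : ℕ} {a : ℕ → ι} (h : ChordlessIn P Ω n a) {i j : ℕ}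
    (hi : i < n) (hj : j < n) (hij : i ≠ j) : Linked P (a i) (a j) ↔ CycAdj n i j :=
  h.chordless.rel_iff (fun _ _ => Linked.symm) hi hj hij

lemma ChordlessIn.orth {Ω : List ι} {n : ℕ} {a : ℕ → ι} (h : ChordlessIn P Ω n a) {i j : ℕ}
    (hi : i < n) (hj : j < n) (hij : i ≠ j) (hadj : ¬ CycAdj n i j) :
    P.IsOrthogonal (a i) (a j) := by
  by_contra h'
  exact hadj ((h.linked_iff hi hj hij).1 h')

variable [P.IsCrystallographic] {B : LinearMap.BilinForm ℝ M} {Ω : List ι} {n : ℕ} {a : ℕ → ι}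

/-- On the path `0, …, 4`, the roots at 1 and 3 are made orthogonal to those at 0 and 4, which
leaves at most 3/4 of their squared lengths. If the edge `2, 3` were not simple, the two squared
cosines of root 2 with the shortened vectors would be at least `(1/4)/(3/4)` and `(1/2)/(3/4)`.
Their sum 1 contradicts the strict inequality of Bessel. Since `6 ≤ n`, vertices 0 and 4 are not
neighbours. -/
lemma IsForm.simple_two_three (hB : IsForm P B) (hi : Indep P Ω) (h : ChordlessIn P Ω n a) :
    |P.pairing (a 2) (a 3)| = 1 ∧ |P.pairing (a 3) (a 2)| = 1 ∧
      B (P.root (a 2)) (P.root (a 2)) = B (P.root (a 3)) (P.root (a 3)) := by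
  have h6 := h.six_le
  have hlink : ∀ i j, i < n → j < n → i ≠ j → CycAdj n i j → Linked P (a i) (a j) :=
    fun i j hi hj hij => (h.linked_iff hi hj hij).2
  have horth : ∀ i j, i < n → j < n → i ≠ j → ¬ CycAdj n i j →
      B (P.root (a i)) (P.root (a j)) = 0 :=
    fun i j hi hj hij hadj => hB.apply_eq_zero_iff.2 (h.orth hi hj hij hadj)
  rcases hB.simple_or (hlink 2 3 (by omega) (by omega) (by omega) (by unfold CycAdj; omega))
    with h1 | h23
  · exact h1
  exfalso
  have q01 := hB.quarter_le (hlink 0 1 (by omega) (by omega) (by omega) (by unfold CycAdj; omega))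
  have q12 := hB.quarter_le (hlink 1 2 (by omega) (by omega) (by omega) (by unfold CycAdj; omega))
  have q34 := hB.quarter_le (hlink 3 4 (by omega) (by omega) (by omega) (by unfold CycAdj; omega))
  have o02 := horth 0 2 (by omega) (by omega) (by omega) (by unfold CycAdj; omega)
  have o03 := horth 0 3 (by omega) (by omega) (by omega) (by unfold CycAdj; omega)
  have o04 := horth 0 4 (by omega) (by omega) (by omega) (by unfold CycAdj; omega)
  have o13 := horth 1 3 (by omega) (by omega) (by omega) (by unfold CycAdj; omega)
  have o14 := horth 1 4 (by omega) (by omega) (by omega) (by unfold CycAdj; omega)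
  have o24 := horth 2 4 (by omega) (by omega) (by omega) (by unfold CycAdj; omega)
  have p0 := hB.root_pos (a 0)
  have p1 := hB.root_pos (a 1)
  have p2 := hB.root_pos (a 2)
  have p3 := hB.root_pos (a 3)
  have p4 := hB.root_pos (a 4)
  set S := rootSpan P [a 0, a 1, a 3, a 4]
  have hnot : P.root (a 2) ∉ S := by
    apply hi.notMem_rootSpan (h.mem 2 (by omega))
    · have n0 := h.chordless.ne (i := 2) (j := 0) (by omega) (by omega) (by omega)
      have n1 := h.chordless.ne (i := 2) (j := 1) (by omega) (by omega) (by omega)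
      have n3 := h.chordless.ne (i := 2) (j := 3) (by omega) (by omega) (by omega)
      have n4 := h.chordless.ne (i := 2) (j := 4) (by omega) (by omega) (by omega)
      simp [n0, n1, n3, n4]
    · have m0 := h.mem 0 (by omega)
      have m1 := h.mem 1 (by omega)
      have m3 := h.mem 3 (by omega)
      have m4 := h.mem 4 (by omega)
      simp [m0, m1, m3, m4]
  set r0 := P.root (a 0)
  set r1 := P.root (a 1)
  set r2 := P.root (a 2)
  set r3 := P.root (a 3)
  set r4 := P.root (a 4)
  set w : M := r1 - (B r0 r1 / B r0 r0) • r0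
  set u : M := r3 - (B r3 r4 / B r4 r4) • r4
  have hww : B w w = B r1 r1 - B r0 r1 ^ 2 / B r0 r0 := by
    simp only [w, map_sub, map_smul, LinearMap.sub_apply, LinearMap.smul_apply, smul_eq_mul,
      hB.symm r1 r0]
    field_simp
    ring
  have huu : B u u = B r3 r3 - B r3 r4 ^ 2 / B r4 r4 := by
    simp only [u, map_sub, map_smul, LinearMap.sub_apply, LinearMap.smul_apply, smul_eq_mul,
      hB.symm r4 r3]
    field_simp
    ring
  have hwu : B w u = 0 := by
    simp only [w, u, map_sub, map_smul, LinearMap.sub_apply, LinearMap.smul_apply, smul_eq_mul,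
      o03, o04, o13, o14]
    ring
  have h2w : B r2 w = B r1 r2 := by
    simp only [w, map_sub, map_smul, smul_eq_mul, hB.symm r2 r0, o02, hB.symm r2 r1]
    ring
  have h2u : B r2 u = B r2 r3 := by
    simp only [u, map_sub, map_smul, smul_eq_mul, o24]
    ring
  have mS : ∀ i ∈ [a 0, a 1, a 3, a 4], P.root i ∈ S := fun i hi => root_mem_rootSpan hi
  have hwS : w ∈ S := sub_mem (mS _ (by simp)) (Submodule.smul_mem _ _ (mS _ (by simp)))
  have huS : u ∈ S := sub_mem (mS _ (by simp)) (Submodule.smul_mem _ _ (mS _ (by simp)))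
  have hw0 : w ≠ 0 := by
    intro hw0
    have : r1 ∈ rootSpan P [a 0] := by
      rw [show r1 = (B r0 r1 / B r0 r0) • r0 from sub_eq_zero.1 hw0]
      exact Submodule.smul_mem _ _ (root_mem_rootSpan (by simp))
    refine hi.notMem_rootSpan (h.mem 1 (by omega)) ?_ ?_ this
    · simpa using h.chordless.ne (i := 1) (j := 0) (by omega) (by omega) (by omega)
    · simpa using h.mem 0 (by omega)
  have hu0 : u ≠ 0 := by
    intro hu0
    have : r3 ∈ rootSpan P [a 4] := by
      rw [show r3 = (B r3 r4 / B r4 r4) • r4 from sub_eq_zero.1 hu0]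
      exact Submodule.smul_mem _ _ (root_mem_rootSpan (by simp))
    refine hi.notMem_rootSpan (h.mem 3 (by omega)) ?_ ?_ this
    · simpa using h.chordless.ne (i := 3) (j := 4) (by omega) (by omega) (by omega)
    · simpa using h.mem 4 (by omega)
  have hwpos := hB.pos w hw0
  have hupos := hB.pos u hu0
  have hb := hB.bessel (Finset.univ : Finset (Fin 2)) ![w, u] r2
    (by intro k _; fin_cases k <;> simp [hwpos.ne', hupos.ne'])
    (by
      intro k _ l _ hkl
      fin_cases k <;> fin_cases l <;> simp at hkl ⊢
      · exact hwu
      · rw [hB.symm]; exact hwu) S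
    (by intro k _; fin_cases k; exacts [hwS, huS]) hnot
  rw [Fin.sum_univ_two] at hb
  simp only [Matrix.cons_val_zero, Matrix.cons_val_one, h2w, h2u] at hb
  have hw34 : B w w ≤ 3 / 4 * B r1 r1 := by
    have : B r1 r1 / 4 ≤ B r0 r1 ^ 2 / B r0 r0 := by
      rw [le_div_iff₀ p0]; linarith
    rw [hww]; linarith
  have hu34 : B u u ≤ 3 / 4 * B r3 r3 := by
    have : B r3 r3 / 4 ≤ B r3 r4 ^ 2 / B r4 r4 := by
      rw [le_div_iff₀ p4]; linarith
    rw [huu]; linarith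
  have b1 : B r2 r2 / 3 ≤ B r1 r2 ^ 2 / B w w := by
    rw [le_div_iff₀ hwpos]
    nlinarith [mul_le_mul_of_nonneg_left hw34 p2.le]
  have b2 : 2 / 3 * B r2 r2 ≤ B r2 r3 ^ 2 / B u u := by
    rw [le_div_iff₀ hupos]
    nlinarith [mul_le_mul_of_nonneg_left hu34 p2.le]
  linarith

lemma IsForm.simple_edge (hB : IsForm P B) (hi : Indep P Ω) (h : ChordlessIn P Ω n a) {i j : ℕ}
    (hin : i < n) (hjn : j < n) (hadj : CycAdj n i j) :
    |P.pairing (a i) (a j)| = 1 ∧ |P.pairing (a j) (a i)| = 1 ∧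
      B (P.root (a i)) (P.root (a i)) = B (P.root (a j)) (P.root (a j)) := by
  have h6 := h.six_le
  have key : ∀ i j, i < n → j < n → (j = i + 1 ∨ (j = 0 ∧ i + 1 = n)) →
      |P.pairing (a i) (a j)| = 1 ∧ |P.pairing (a j) (a i)| = 1 ∧
      B (P.root (a i)) (P.root (a i)) = B (P.root (a j)) (P.root (a j)) := by
    intro i j hin hjn hadj
    -- Rotation by `s` brings the edge to the places 2 and 3.
    obtain ⟨s, hs, hs'⟩ : ∃ s, s < n ∧ (2 + s = i ∨ 2 + s = i + n) := by
      by_cases h2 : 2 ≤ i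
      · exact ⟨i - 2, by omega, by omega⟩
      · exact ⟨i + n - 2, by omega, by omega⟩
    have := hB.simple_two_three hi (h.rotSeq hs)
    rwa [rotSeq_eq a (i := 2) (k := i) hin hs',
      rotSeq_eq a (i := 3) (k := j) hjn (by omega)] at this
  rcases hadj with h1 | h1 | h1 | h1
  · exact key i j hin hjn (.inl h1)
  · obtain ⟨e1, e2, e3⟩ := key j i hjn hin (.inl h1)
    exact ⟨e2, e1, e3.symm⟩
  · obtain ⟨e1, e2, e3⟩ := key j i hjn hin (.inr h1)
    exact ⟨e2, e1, e3.symm⟩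
  · exact key i j hin hjn (.inr h1)

lemma IsForm.cycle_absGram (hB : IsForm P B) (hi : Indep P Ω) (h : ChordlessIn P Ω n a) :
    HasAbsGram P n (cycleGram n) a := by
  intro i hin j hjn
  unfold cycleGram
  by_cases hij : i = j
  · rw [if_pos hij, hij, P.pairing_same]; simp
  rw [if_neg hij]
  by_cases hadj : CycAdj n i j
  · rw [(hB.simple_edge hi h hin hjn hadj).1]
    unfold CycAdj at hadj
    split_ifs <;> first | omega | simp
  · rw [(h.orth hin hjn hij hadj).1]
    unfold CycAdj at hadj
    rw [if_neg (by omega), if_neg (by omega)]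
    simp

/-- The colouring makes `v` and the two neighbours of `a 0` on the cycle mutually orthogonal. With a
multiple edge, the squared cosines would sum to at least `1/4 + 1/4 + 1/2`, against the strict
inequality of Bessel. -/
lemma IsForm.simple_attached_zero (hB : IsForm P B) (hi : Indep P Ω) {C : ι → Prop}
    (hC : IsColouring P Ω C) (h : ChordlessIn P Ω n a) {v : ι} (hv : v ∈ Ω)
    (hva : ∀ i < n, v ≠ a i) (hl : Linked P (a 0) v) :
    |P.pairing (a 0) v| = 1 ∧ |P.pairing v (a 0)| = 1 ∧
      B (P.root (a 0)) (P.root (a 0)) = B (P.root v) (P.root v) := by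
  have h6 := h.six_le
  rcases hB.simple_or hl with h1 | h1
  · exact h1
  exfalso
  have a01 : CycAdj n 0 1 := by unfold CycAdj; omega
  have a0n : CycAdj n 0 (n - 1) := by unfold CycAdj; omega
  have m0 := h.mem 0 (by omega)
  have m1 := h.mem 1 (by omega)
  have mn := h.mem (n - 1) (by omega)
  have l01 := (h.linked_iff (by omega) (by omega) (by omega)).2 a01
  have l0n := (h.linked_iff (by omega) (by omega) (by omega)).2 a0n
  have n01 := h.chordless.ne (i := 0) (j := 1) (by omega) (by omega) (by omega)
  have n0n := h.chordless.ne (i := 0) (j := n - 1) (by omega) (by omega) (by omega)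
  have ov1 : P.IsOrthogonal v (a 1) := hC.not_linked hv m0 m1 (hva 0 (by omega)) n01
    (hva 1 (by omega)) hl.symm l01
  have ovn : P.IsOrthogonal v (a (n - 1)) := hC.not_linked hv m0 mn (hva 0 (by omega)) n0n
    (hva _ (by omega)) hl.symm l0n
  have o1n : P.IsOrthogonal (a 1) (a (n - 1)) :=
    h.orth (by omega) (by omega) (by omega) (by unfold CycAdj; omega)
  rw [← hB.apply_eq_zero_iff] at ov1 ovn o1n
  have q1 := hB.quarter_le l01
  have qn := hB.quarter_le l0n
  have p0 := hB.root_pos (a 0)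
  have p1 := hB.root_pos (a 1)
  have pn := hB.root_pos (a (n - 1))
  have pv := hB.root_pos v
  have hnot : P.root (a 0) ∉ rootSpan P [a 1, a (n - 1), v] := by
    apply hi.notMem_rootSpan m0
    · simp [n01, n0n, (hva 0 (by omega)).symm]
    · simp [m1, mn, hv]
  have hb := hB.bessel (Finset.univ : Finset (Fin 3))
    ![P.root (a 1), P.root (a (n - 1)), P.root v] (P.root (a 0))
    (by intro k _; fin_cases k; exacts [p1.ne', pn.ne', pv.ne'])
    (by
      intro k _ l _ hkl
      fin_cases k <;> fin_cases l <;> simp at hkl ⊢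
      · exact o1n
      · rw [hB.symm]; exact ov1
      · rw [hB.symm]; exact o1n
      · rw [hB.symm]; exact ovn
      · exact ov1
      · exact ovn) (rootSpan P [a 1, a (n - 1), v])
    (by intro k _; fin_cases k <;> exact root_mem_rootSpan (by simp)) hnot
  rw [Fin.sum_univ_three] at hb
  simp only [Matrix.cons_val_zero, Matrix.cons_val_one, Matrix.cons_val] at hb
  have b1 : B (P.root (a 0)) (P.root (a 0)) / 4 ≤
      B (P.root (a 0)) (P.root (a 1)) ^ 2 / B (P.root (a 1)) (P.root (a 1)) := by
    rw [le_div_iff₀ p1]; linarith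
  have b2 : B (P.root (a 0)) (P.root (a 0)) / 4 ≤
      B (P.root (a 0)) (P.root (a (n - 1))) ^ 2 /
        B (P.root (a (n - 1))) (P.root (a (n - 1))) := by
    rw [le_div_iff₀ pn]; linarith
  have b3 : B (P.root (a 0)) (P.root (a 0)) / 2 ≤
      B (P.root (a 0)) (P.root v) ^ 2 / B (P.root v) (P.root v) := by
    rw [le_div_iff₀ pv]; linarith
  linarith

lemma IsForm.simple_attached (hB : IsForm P B) (hi : Indep P Ω) {C : ι → Prop}
    (hC : IsColouring P Ω C) (h : ChordlessIn P Ω n a) {v : ι} (hv : v ∈ Ω)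
    (hva : ∀ i < n, v ≠ a i) {i : ℕ} (hin : i < n) (hl : Linked P v (a i)) :
    |P.pairing (a i) v| = 1 ∧ |P.pairing v (a i)| = 1 ∧
      B (P.root (a i)) (P.root (a i)) = B (P.root v) (P.root v) := by
  have h6 := h.six_le
  have e0 : Carter.rotSeq n i a 0 = a i := rotSeq_eq a hin (.inl (by omega))
  have := hB.simple_attached_zero hi hC (h.rotSeq hin) hv (fun j hj => by
    obtain ⟨k, hk, -, hk2⟩ := exists_rotSeq_eq a hin hj
    rw [hk2]; exact hva k hk) (by rw [e0]; exact hl.symm)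
  rwa [e0] at this

end Neighbours

end Carter

namespace Carter

/-! ### Roots attached to a chordless cycle -/

section Hexagon

variable {ι M N : Type*} [AddCommGroup M] [Module ℝ M] [AddCommGroup N] [Module ℝ N]
  {P : RootPairing ι ℝ M N} {B : LinearMap.BilinForm ℝ M} {Ω : List ι} {n : ℕ} {a b : ℕ → ι}
  {L : ℝ} {e : ℕ → M}

lemma IsFrame.mem_rootSpan (he : IsFrame P B L n b e) (hab : IsSigned P a b) {T : List ι}
    (hT : ∀ i < n, a i ∈ T) {k : ℕ} (hk : k < n) : e k ∈ rootSpan P T := by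
  refine Submodule.span_le.2 ?_ (he.mem k hk)
  rintro _ ⟨i, hi, rfl⟩
  have := root_mem_rootSpan (P := P) (hT i hi)
  rcases hab.root i with h | h <;> change P.root (b i) ∈ _ <;> rw [h]
  · exact this
  · exact neg_mem this

/-- In the frame, whose vectors have square `L / 2`, the coordinates of `v` are the halves of
`frameCoord`. The inequality is strict since `v` is independent of the cycle. -/
lemma IsFrame.bessel (he : IsFrame P B L n b e) (hB : IsForm P B) (hL : 0 < L) (hi : Indep P Ω)
    (hab : IsSigned P a b) (ha : ∀ i < n, a i ∈ Ω) {v : ι} (hv : v ∈ Ω) (hva : ∀ i < n, v ≠ a i)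
    {m : ℕ → ℤ} (hm : ∀ j < n, P.pairing v (b j) = m j) :
    L / 8 * ∑ k ∈ Finset.range n, (frameCoord n m k : ℝ) ^ 2 < B (P.root v) (P.root v) := by
  have hnot := hi.notMem_rootSpan (v := v) (L := (List.range n).map a) hv
    (by simpa using fun i hi h => hva i hi h.symm) (by simpa using ha)
  have hb := hB.bessel (Finset.range n) e (P.root v)
    (fun k hk => by rw [he.norm k (Finset.mem_range.1 hk)]; positivity)
    (fun k hk l hl => he.orth k (Finset.mem_range.1 hk) l (Finset.mem_range.1 hl)) _
    (fun k hk => he.mem_rootSpan hab (T := (List.range n).map a)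
      (fun i hi => List.mem_map.2 ⟨i, List.mem_range.2 hi, rfl⟩) (Finset.mem_range.1 hk)) hnot
  refine lt_of_eq_of_lt ?_ hb
  rw [Finset.mul_sum]
  refine Finset.sum_congr rfl fun k hk => ?_
  rw [Finset.mem_range] at hk
  rw [he.norm k hk, he.coord v m hm k hk.le]
  field_simp
  ring

/-- The frame is enlarged by the component of `v` orthogonal to it. By `hvv` and `hX` the square of
this component is `L - 6 L / 8 = L / 4`. -/
lemma IsFrame.bessel_two (he : IsFrame P B L n b e) (hB : IsForm P B) (hL : 0 < L)
    (hi : Indep P Ω) (hab : IsSigned P a b) (ha : ∀ i < n, a i ∈ Ω) {v y : ι} (hv : v ∈ Ω)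
    (hy : y ∈ Ω) (hya : ∀ i < n, y ≠ a i) (hyv : y ≠ v)
    {m m' : ℕ → ℤ} (hm : ∀ j < n, P.pairing v (b j) = m j)
    (hm' : ∀ j < n, P.pairing y (b j) = m' j) (hvv : B (P.root v) (P.root v) = L)
    (hX : ∑ k ∈ Finset.range n, (frameCoord n m k : ℝ) ^ 2 = 6) :
    L / 8 * ∑ k ∈ Finset.range n, (frameCoord n m' k : ℝ) ^ 2 +
      (B (P.root y) (P.root v) -
        L / 8 * ∑ k ∈ Finset.range n, (frameCoord n m k * frameCoord n m' k : ℝ)) ^ 2 / (L / 4) <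
      B (P.root y) (P.root y) := by
  set T := v :: (List.range n).map a
  have hnot := hi.notMem_rootSpan (v := y) (L := T) hy
    (by simpa [T, hyv] using fun i hi h => hya i hi h.symm) (by simpa [T, hv] using ha)
  have heT : ∀ k < n, e k ∈ rootSpan P T := fun k hk => he.mem_rootSpan hab (T := T)
      (fun i hi => by simp only [T, List.mem_cons, List.mem_map, List.mem_range]
                      exact .inr ⟨i, hi, rfl⟩) hk
  set u : M := P.root v - ∑ k ∈ Finset.range n, (frameCoord n m k / 2 : ℝ) • e k with hu
  have huT : u ∈ rootSpan P T := sub_mem (root_mem_rootSpan (by simp [T]))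
    (Submodule.sum_mem _ fun k hk => Submodule.smul_mem _ _ (heT k (Finset.mem_range.1 hk)))
  have hue : ∀ k < n, B u (e k) = 0 := by
    intro k hk
    simp only [hu, map_sub, map_sum, map_smul, LinearMap.sub_apply, LinearMap.sum_apply,
      LinearMap.smul_apply, smul_eq_mul]
    rw [Finset.sum_eq_single k, he.norm k hk, he.coord v m hm k hk.le]
    · ring
    · intro l hl hlk
      rw [he.orth l (Finset.mem_range.1 hl) k hk hlk, mul_zero]
    · simp [hk]
  have hyu : B (P.root y) u = B (P.root y) (P.root v) -
      L / 8 * ∑ k ∈ Finset.range n, (frameCoord n m k * frameCoord n m' k : ℝ) := by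
    simp only [hu, map_sub, map_sum, map_smul, smul_eq_mul, Finset.mul_sum]
    congr 1
    refine Finset.sum_congr rfl fun k hk => ?_
    rw [he.coord y m' hm' k (Finset.mem_range.1 hk).le]
    ring
  have huu : B u u = L / 4 := by
    have h0 : B u (∑ k ∈ Finset.range n, (frameCoord n m k / 2 : ℝ) • e k) = 0 := by
      rw [map_sum]
      refine Finset.sum_eq_zero fun k hk => ?_
      rw [map_smul, hue k (Finset.mem_range.1 hk), smul_zero]
    have h1 : B u u = B u (P.root v) := by
      calc B u u = B u (P.root v - ∑ k ∈ Finset.range n, (frameCoord n m k / 2 : ℝ) • e k) := rfl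
        _ = B u (P.root v) := by rw [map_sub, h0, sub_zero]
    rw [h1, hB.symm]
    simp only [hu, map_sub, map_sum, map_smul, smul_eq_mul]
    rw [hvv, Finset.sum_congr rfl (g := fun k => L / 8 * (frameCoord n m k : ℝ) ^ 2), 
      ← Finset.mul_sum, hX]
    · ring
    · intro k hk
      rw [he.coord v m hm k (Finset.mem_range.1 hk).le]
      ring
  set e' : ℕ → M := fun k => if k < n then e k else u
  have e1 : ∀ k < n, e' k = e k := fun k hk => if_pos hk
  have e2 : ∀ k ∈ Finset.range (n + 1), ¬ k < n → k = n ∧ e' k = u := fun k hk hkn => by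
    rw [Finset.mem_range] at hk
    exact ⟨by omega, if_neg hkn⟩
  have hb := hB.bessel (Finset.range (n + 1)) e' (P.root y)
    (fun k hk => by
      by_cases hkn : k < n
      · rw [e1 k hkn, he.norm k hkn]; positivity
      · rw [(e2 k hk hkn).2, huu]; positivity)
    (fun k hk l hl hkl => by
      by_cases hkn : k < n <;> by_cases hln : l < n
      · rw [e1 k hkn, e1 l hln]; exact he.orth k hkn l hln hkl
      · rw [e1 k hkn, (e2 l hl hln).2, hB.symm]; exact hue k hkn
      · rw [e1 l hln, (e2 k hk hkn).2]; exact hue l hln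
      · exact absurd ((e2 k hk hkn).1.trans (e2 l hl hln).1.symm) hkl) (rootSpan P T)
    (fun k hk => by
      by_cases hkn : k < n
      · rw [e1 k hkn]; exact heT k hkn
      · rw [(e2 k hk hkn).2]; exact huT) hnot
  rw [Finset.sum_range_succ, (e2 n (by simp) (by simp)).2, huu, hyu] at hb
  refine lt_of_eq_of_lt ?_ hb
  congr 1
  rw [Finset.mul_sum]
  refine Finset.sum_congr rfl fun k hk => ?_
  rw [Finset.mem_range] at hk
  rw [e1 k hk, he.norm k hk, he.coord y m' hm' k hk.le]
  field_simp
  ring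

variable [P.IsCrystallographic]

/-- The pairings of a root with the roots of a chordless cycle. -/
lemma IsForm.exists_cycle_pairing (hB : IsForm P B) (hi : Indep P Ω) {C : ι → Prop}
    (hC : IsColouring P Ω C) (h : ChordlessIn P Ω n a) (hab : IsSigned P a b) {v : ι}
    (hv : v ∈ Ω) (hva : ∀ i < n, v ≠ a i) :
    ∃ m : ℕ → ℤ, (∀ j < n, P.pairing v (b j) = m j) ∧
      (∀ j < n, m j = 0 ∨ m j = 1 ∨ m j = -1) ∧ (∀ j < n, Linked P v (a j) ↔ m j ≠ 0) ∧
      (∀ i < n, ∀ j < n, i ≠ j → CycAdj n i j → m i = 0 ∨ m j = 0) := by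
  choose m hm using fun j => exists_int (P := P) v (b j)
  have hlink : ∀ j < n, Linked P v (a j) ↔ m j ≠ 0 := by
    intro j hj
    have h1 : |(m j : ℝ)| = |P.pairing v (a j)| := by rw [← hm j, hab.abs_pairing_right]
    constructor
    · intro hl h0
      apply hl
      apply hB.isOrthogonal_of_pairing
      rw [h0] at h1
      simpa using h1.symm
    · intro h0 ho
      rw [ho.1] at h1
      simp at h1
      exact h0 h1
  refine ⟨m, fun j _ => hm j, fun j hj => ?_, hlink, fun i hin j hjn hij hadj => ?_⟩
  · by_cases h0 : m j = 0
    · exact .inl h0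
    right
    have h2 := (hB.simple_attached hi hC h hv hva hj ((hlink j hj).2 h0)).2.1
    rw [← hab.abs_pairing_right, hm j] at h2
    have h3 : |m j| = 1 := by exact_mod_cast h2
    exact eq_or_eq_neg_of_abs_eq h3
  · by_contra! hcon
    have l1 := (hlink i hin).2 hcon.1
    have l2 := (hlink j hjn).2 hcon.2
    exact l2 (hC.not_linked hv (h.mem i hin) (h.mem j hjn) (hva i hin)
      (h.chordless.ne hin hjn hij) (hva j hjn) l1 ((h.linked_iff hin hjn hij).2 hadj))

lemma odd_sum_cases {x y z : ℤ} (h : (x + y + z) % 2 = 1) (hx : x = 0 ∨ x = 1 ∨ x = -1)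
    (hy : y = 0 ∨ y = 1 ∨ y = -1) (hz : z = 0 ∨ z = 1 ∨ z = -1) :
    (y = 0 ∧ z = 0) ∨ (x = 0 ∧ z = 0) ∨ (x = 0 ∧ y = 0) ∨ (x ≠ 0 ∧ y ≠ 0 ∧ z ≠ 0) := by
  omega

/-- A root which is joined to a hexagon by simple edges. -/
lemma hexagon_cases {m : ℕ → ℤ} (hval : ∀ j < 6, m j = 0 ∨ m j = 1 ∨ m j = -1)
    (halt : ∀ i < 6, ∀ j < 6, i ≠ j → CycAdj 6 i j → m i = 0 ∨ m j = 0)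
    (hX : ∀ k < 6, frameCoord 6 m k ^ 2 = 1) :
    (∃ i < 6, ∀ j < 6, j ≠ i → m j = 0) ∨ (m 0 ≠ 0 ∧ m 2 ≠ 0 ∧ m 4 ≠ 0) ∨
      (m 1 ≠ 0 ∧ m 3 ≠ 0 ∧ m 5 ≠ 0) := by
  -- The coordinate at 0 is the sum of all pairings, so this sum is odd. As no two neighbouring
  -- pairings are nonzero, parity leaves one nonzero pairing or three alternate ones.
  have hsum : m 0 + m 1 + m 2 + m 3 + m 4 + m 5 = 1 ∨
      m 0 + m 1 + m 2 + m 3 + m 4 + m 5 = -1 := by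
    have := hX 0 (by omega)
    simpa [frameCoord, Finset.sum_range_succ] using this
  have h01 := halt 0 (by omega) 1 (by omega) (by omega) (by decide)
  have h12 := halt 1 (by omega) 2 (by omega) (by omega) (by decide)
  have h23 := halt 2 (by omega) 3 (by omega) (by omega) (by decide)
  have h34 := halt 3 (by omega) 4 (by omega) (by omega) (by decide)
  have h45 := halt 4 (by omega) 5 (by omega) (by omega) (by decide)
  have h50 := halt 5 (by omega) 0 (by omega) (by omega) (by decide)
  have v0 := hval 0 (by omega)
  have v1 := hval 1 (by omega)
  have v2 := hval 2 (by omega)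
  have v3 := hval 3 (by omega)
  have v4 := hval 4 (by omega)
  have v5 := hval 5 (by omega)
  have key : ∀ i < 6, (∀ j < 6, j ≠ i → m j = 0) → (∃ i < 6, ∀ j < 6, j ≠ i → m j = 0) ∨
      (m 0 ≠ 0 ∧ m 2 ≠ 0 ∧ m 4 ≠ 0) ∨ (m 1 ≠ 0 ∧ m 3 ≠ 0 ∧ m 5 ≠ 0) :=
    fun i hi h => .inl ⟨i, hi, h⟩
  have all : ∀ i, (0 = i ∨ m 0 = 0) → (1 = i ∨ m 1 = 0) → (2 = i ∨ m 2 = 0) →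
      (3 = i ∨ m 3 = 0) → (4 = i ∨ m 4 = 0) → (5 = i ∨ m 5 = 0) → ∀ j < 6, j ≠ i → m j = 0 := by
    intro i a0 a1 a2 a3 a4 a5 j hj hji
    interval_cases j
    exacts [a0.resolve_left hji, a1.resolve_left hji, a2.resolve_left hji, a3.resolve_left hji,
      a4.resolve_left hji, a5.resolve_left hji]
  by_cases z0 : m 0 = 0 <;> by_cases z2 : m 2 = 0 <;> by_cases z4 : m 4 = 0 <;>
    simp only [z0, z2, z4, true_or, or_true, false_or, or_false] at h01 h12 h23 h34 h45 h50
  · rcases odd_sum_cases (x := m 1) (y := m 3) (z := m 5) (by omega) v1 v3 v5 with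
      ⟨h, h'⟩ | ⟨h, h'⟩ | ⟨h, h'⟩ | h
    · exact key 1 (by omega) (all 1 (by simp [*]) (by simp [*]) (by simp [*]) (by simp [*])
        (by simp [*]) (by simp [*]))
    · exact key 3 (by omega) (all 3 (by simp [*]) (by simp [*]) (by simp [*]) (by simp [*])
        (by simp [*]) (by simp [*]))
    · exact key 5 (by omega) (all 5 (by simp [*]) (by simp [*]) (by simp [*]) (by simp [*])
        (by simp [*]) (by simp [*]))
    · exact .inr (.inr h)
  · have : m 1 = 0 := by omega
    exact key 4 (by omega) (all 4 (by simp [*]) (by simp [*]) (by simp [*]) (by simp [*])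
        (by simp [*]) (by simp [*]))
  · have : m 5 = 0 := by omega
    exact key 2 (by omega) (all 2 (by simp [*]) (by simp [*]) (by simp [*]) (by simp [*])
        (by simp [*]) (by simp [*]))
  · omega
  · have : m 3 = 0 := by omega
    exact key 0 (by omega) (all 0 (by simp [*]) (by simp [*]) (by simp [*]) (by simp [*])
        (by simp [*]) (by simp [*]))
  · omega
  · omega
  · exact .inr (.inl ⟨z0, z2, z4⟩)

/-- All edges being simple, `v` has square `L`, and Bessel's inequality bounds the sum in
`frameCoord_cases` by 8. That lemma yields the hexagon, and `NoCenter` removes the possibility of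
three alternate neighbours. -/
lemma IsForm.hexagon_pairing (hB : IsForm P B) (hi : Indep P Ω) {C : ι → Prop}
    (hC : IsColouring P Ω C) (h : ChordlessIn P Ω n a) (hev : Even n)
    (hnc : n = 6 → NoCenter (Linked P) (· ∈ Ω) a) (hab : IsSigned P a b)
    (he : IsFrame P B L n b e) (hL : 0 < L) {v : ι}
    (hv : v ∈ Ω) (hva : ∀ i < n, v ≠ a i) {i : ℕ} (hin : i < n) (hl : Linked P v (a i)) :
    n = 6 ∧ B (P.root v) (P.root v) = L ∧
      ∃ m : ℕ → ℤ, (∀ j < n, P.pairing v (b j) = m j) ∧ (m i = 1 ∨ m i = -1) ∧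
        (∀ j < n, j ≠ i → m j = 0) ∧ (∀ j < n, j ≠ i → P.IsOrthogonal v (a j)) := by
  obtain ⟨m, hm, hval, hlink, halt⟩ := hB.exists_cycle_pairing hi hC h hab hv hva
  have hvv : B (P.root v) (P.root v) = L := by
    rw [← (hB.simple_attached hi hC h hv hva hin hl).2.2, ← he.length i hin]
    rcases hab.root i with h1 | h1 <;> rw [h1] <;> simp
  have hb := he.bessel hB hL hi hab h.mem hv hva hm
  have h6 := h.six_le
  rw [hvv] at hb
  have hb2 : ∑ k ∈ Finset.range n, frameCoord n m k ^ 2 < 8 := by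
    have h1 : (∑ k ∈ Finset.range n, (frameCoord n m k : ℝ) ^ 2) < 8 := by nlinarith
    exact_mod_cast h1
  have hmi := (hlink i hin).1 hl
  rcases frameCoord_cases h6 hev (fun i hi j hj hadj => halt i hi j hj
    (by unfold CycAdj at hadj; omega) hadj) hb2 with h0 | ⟨rfl, hX⟩
  · exact absurd (h0 i hin) hmi
  refine ⟨rfl, hvv, m, hm, (hval i hin).resolve_left hmi, ?_⟩
  have key : ∀ j < 6, j ≠ i → m j = 0 := by
    have hn := hnc rfl v hv
    rw [hlink 0 (by omega), hlink 1 (by omega), hlink 2 (by omega), hlink 3 (by omega),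
      hlink 4 (by omega), hlink 5 (by omega)] at hn
    rcases hexagon_cases hval halt hX with ⟨k, hk, hk2⟩ | h1 | h1
    · have hik : i = k := by
        by_contra hne
        exact hmi (hk2 i hin hne)
      rw [hik]; exact hk2
    · exact absurd h1 hn.1
    · exact absurd h1 hn.2
  refine ⟨key, fun j hj hji => ?_⟩
  by_contra hcon
  exact (hlink j hj).1 hcon (key j hj hji)

lemma sum_frameCoord_sq {m : ℕ → ℤ} {i : ℕ} (hi6 : i < 6) (hi : m i = 1 ∨ m i = -1)
    (h0 : ∀ j < 6, j ≠ i → m j = 0) : ∑ k ∈ Finset.range 6, (frameCoord 6 m k : ℝ) ^ 2 = 6 := by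
  have h1 : ∑ k ∈ Finset.range 6, (frameCoord 6 m k) ^ 2 = 6 := by
    have e0 := h0 0
    have e1 := h0 1
    have e2 := h0 2
    have e3 := h0 3
    have e4 := h0 4
    have e5 := h0 5
    simp only [frameCoord, Finset.sum_range_succ, Finset.sum_range_zero]
    interval_cases i <;> simp at e0 e1 e2 e3 e4 e5 <;> simp only [e0, e1, e2, e3, e4, e5] <;>
      rcases hi with hi | hi <;> rw [hi] <;> norm_num
  exact_mod_cast h1

/-- A root which is orthogonal to a hexagon is orthogonal to the roots attached to it. -/
lemma IsForm.orth_of_orth_hexagon (hB : IsForm P B) (hi : Indep P Ω) {C : ι → Prop}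
    (hC : IsColouring P Ω C) (h : ChordlessIn P Ω n a) (hev : Even n)
    (hnc : n = 6 → NoCenter (Linked P) (· ∈ Ω) a) {v w : ι}
    (hv : v ∈ Ω) (hva : ∀ i < n, v ≠ a i) {i : ℕ} (hin : i < n) (hl : Linked P v (a i))
    (hw : w ∈ Ω) (hwa : ∀ i < n, w ≠ a i) (hwv : w ≠ v)
    (hwo : ∀ i < n, P.IsOrthogonal w (a i)) : P.IsOrthogonal w v := by
  have h6 := h.six_le
  obtain ⟨b, hab, hg⟩ := hB.exists_cycleGram hi (by omega) h.mem
    (fun i hi j hj => h.chordless.ne hi hj) (hB.cycle_absGram hi h)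
  obtain ⟨L, e, hL, he⟩ := hB.exists_isFrame (by omega) hg
  obtain ⟨rfl, hvv, m, hm, hmi, hm0, -⟩ :=
    hB.hexagon_pairing hi hC h hev hnc hab he hL hv hva hin hl
  have hX := sum_frameCoord_sq hin hmi hm0
  by_contra hcon
  have hq := hB.quarter_le hcon
  have hw0 : ∀ j < 6, P.pairing w (b j) = ((fun _ => 0 : ℕ → ℤ) j : ℤ) := by
    intro j hj
    have : |P.pairing w (b j)| = 0 := by
      rw [hab.abs_pairing_right, (hwo j hj).1, abs_zero]
    simpa using this
  -- As `w` is orthogonal to the frame, the square of its product with `v` must be less than `L / 4`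
  -- times its own square. A root linked to `v` violates this.
  have hb := he.bessel_two hB hL hi hab h.mem hv hw hwa hwv hm hw0 hvv hX
  have hz : ∀ k, frameCoord 6 (fun _ => 0) k = 0 := fun k => by simp [frameCoord]
  simp only [hz] at hb
  simp at hb
  rw [div_lt_iff₀ (by positivity)] at hb
  rw [hvv] at hq
  linarith

/-- Two roots attached to a hexagon. -/
lemma IsForm.two_attached (hB : IsForm P B) (hi : Indep P Ω) {C : ι → Prop}
    (hC : IsColouring P Ω C) (h : ChordlessIn P Ω 6 a)
    (hnc : NoCenter (Linked P) (· ∈ Ω) a) {v w : ι}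
    (hv : v ∈ Ω) (hva : ∀ i < 6, v ≠ a i) (hl : Linked P v (a 0))
    (hw : w ∈ Ω) (hwa : ∀ i < 6, w ≠ a i) (hwv : w ≠ v) {j : ℕ} (hj : j < 6)
    (hlw : Linked P w (a j)) : (j = 3 ∧ P.IsOrthogonal w v) ∨
      ((j = 1 ∨ j = 5) ∧ |P.pairing w v| = 1 ∧ |P.pairing v w| = 1) := by
  obtain ⟨b, hab, hg⟩ := hB.exists_cycleGram hi (by omega) h.mem
    (fun i hi j hj => h.chordless.ne hi hj) (hB.cycle_absGram hi h)
  obtain ⟨L, e, hL, he⟩ := hB.exists_isFrame (by omega) hg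
  obtain ⟨-, hvv, m, hm, hmi, hm0, -⟩ :=
    hB.hexagon_pairing hi hC h (by decide) (fun _ => hnc) hab he hL hv hva (by omega) hl
  obtain ⟨-, hww, m', hm', hmi', hm0', -⟩ :=
    hB.hexagon_pairing hi hC h (by decide) (fun _ => hnc) hab he hL hw hwa hj hlw
  have hX := sum_frameCoord_sq (by omega) hmi hm0
  have hY := sum_frameCoord_sq hj hmi' hm0'
  obtain ⟨t, ht⟩ := exists_int (P := P) w v
  have hb := he.bessel_two hB hL hi hab h.mem hv hw hwa hwv hm hm' hvv hX
  have hwv2 := hB.pairing w v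
  have hvw2 := hB.pairing v w
  rw [hvv, ht] at hwv2
  rw [hww, hB.symm] at hvw2
  have hsym : P.pairing v w = t := by
    have : (P.pairing v w - t) * L = 0 := by linarith
    rcases mul_eq_zero.1 this with h1 | h1
    · linarith
    · exact absurd h1 hL.ne'
  set S := ∑ k ∈ Finset.range 6, frameCoord 6 m k * frameCoord 6 m' k with hS
  have hS' : ∑ k ∈ Finset.range 6, (frameCoord 6 m k * frameCoord 6 m' k : ℝ) = S := by
    rw [hS]; push_cast; rfl
  rw [hS', hY, hww, show B (P.root w) (P.root v) = t * L / 2 by linarith] at hb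
  -- This is `6 L / 8 + (L / 16) (4 t - S) ^ 2 < L`.
  have hlt : (4 * t - S) ^ 2 < 4 := by
    have h1 : (t * L / 2 - L / 8 * S) ^ 2 / (L / 4) = L / 16 * (4 * t - S : ℝ) ^ 2 := by
      field_simp
      ring
    rw [h1] at hb
    have h2 : (4 * t - S : ℝ) ^ 2 < 4 := by nlinarith
    exact_mod_cast h2
  have hlt1 : 4 * t - S < 2 := by nlinarith
  have hlt2 : -2 < 4 * t - S := by nlinarith
  -- Up to sign, `S` is 6, 4, 2 or 0 for the distances 0, 1, 2, 3 between the two points of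
  -- attachment. Only 4 and 0 differ by less than 2 from a multiple `4 t`, and they determine `t` up
  -- to sign.
  have hSv : S = m 0 * m' j * (if j = 0 then 6 else 6 - 2 * (j : ℤ)) := by
    have e1 := hm0 1
    have e2 := hm0 2
    have e3 := hm0 3
    have e4 := hm0 4
    have e5 := hm0 5
    simp at e1 e2 e3 e4 e5
    have f0 := hm0' 0
    have f1 := hm0' 1
    have f2 := hm0' 2
    have f3 := hm0' 3
    have f4 := hm0' 4
    have f5 := hm0' 5
    simp only [hS, frameCoord, Finset.sum_range_succ, Finset.sum_range_zero, e1, e2, e3, e4, e5]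
    interval_cases j <;> simp at f0 f1 f2 f3 f4 f5 <;>
      simp only [f0, f1, f2, f3, f4, f5] <;> norm_num <;> ring
  have hmm : m 0 * m' j = 1 ∨ m 0 * m' j = -1 := by
    rcases hmi with h1 | h1 <;> rcases hmi' with h2 | h2 <;> rw [h1, h2] <;> simp
  rw [ht, hsym]
  have hfin : (j = 3 ∧ t = 0) ∨ ((j = 1 ∨ j = 5) ∧ (t = 1 ∨ t = -1)) := by
    rcases hmm with h1 | h1 <;> rw [h1] at hSv <;> interval_cases j <;> norm_num at hSv <;> omega
  rcases hfin with ⟨h1, h2⟩ | ⟨h1, h2⟩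
  · refine .inl ⟨h1, ?_, ?_⟩
    · rw [ht, h2]; simp
    · rw [hsym, h2]; simp
  · refine .inr ⟨h1, ?_⟩
    rcases h2 with h2 | h2 <;> rw [h2] <;> simp

end Hexagon

end Carter

namespace Carter

/-! ### Two arms joined by a further vertex: matrix and signs -/

section Lens

variable {ι M N : Type*} [AddCommGroup M] [Module ℝ M] [AddCommGroup N] [Module ℝ N]
  {P : RootPairing ι ℝ M N}

lemma IsSigned.loc {a b : ℕ → ι} (h : IsSigned P a b) (J : List ℕ) :
    Loc P (J.map a) (J.map b) := by
  have key : ∀ S : List ι, Loc P (S ++ J.map a) (S ++ J.map b) := by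
    induction J with
    | nil => exact fun S => .refl _
    | cons i J ih =>
      intro S
      have h1 := ih (S ++ [b i])
      simp only [List.append_assoc, List.singleton_append] at h1
      refine Loc.trans ?_ h1
      rcases h i with h2 | h2 <;> rw [List.map_cons, h2]
      · exact .refl _
      · exact .neg S _ (a i)
  exact key []

/-- The Gram matrix of two arms with `k` vertices which begin at the vertex `0`, their vertices of
number `j` being joined to the vertex `2 * k + 1`, one of them by a dotted edge. -/
def lensGram (k j y z : ℕ) : ℤ :=
  if y = z then 2
  else if (z = y + 2 ∨ y = z + 2 ∨ (y = 0 ∧ z = 1) ∨ (y = 1 ∧ z = 0)) ∧ y ≤ 2 * k ∧ z ≤ 2 * k then -1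
  else if (y = 2 * k + 1 ∧ z = 1 + 2 * j) ∨ (z = 2 * k + 1 ∧ y = 1 + 2 * j) then 1
  else if (y = 2 * k + 1 ∧ z = 2 + 2 * j) ∨ (z = 2 * k + 1 ∧ y = 2 + 2 * j) then -1
  else 0

lemma lensGram_comm (k j y z : ℕ) : lensGram k j y z = lensGram k j z y := by
  unfold lensGram
  grind

/-- The first `t` vertices form a segment of the chain of both arms. Their sum makes acute angles
with the two ends of the segment and obtuse angles with the vertices that follow them. The
hypothesis `hty` excludes a segment of one vertex paired with itself. -/
lemma sum_lensGram {k j t y : ℕ} (ht : 1 ≤ t) (htk : t ≤ 2 * k + 1) (hy : y ≤ 2 * k)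
    (hty : t = 1 → 1 ≤ y) : ∑ i ∈ Finset.range t, lensGram k j i y =
      if y + 2 < t then 0 else if y < t then 1 else if y < t + 2 then -1 else 0 := by
  induction t, ht using Nat.le_induction with
  | base =>
    have := hty rfl
    rw [Finset.sum_range_one]
    unfold lensGram
    grind
  | succ t ht ih =>
    rw [Finset.sum_range_succ]
    by_cases h : t = 1 ∧ y = 0
    · obtain ⟨rfl, rfl⟩ := h
      rw [Finset.sum_range_one]
      unfold lensGram
      grind
    · rw [ih (by omega) (by omega)]
      unfold lensGram
      grind

/-- The last vertex has one dotted and one solid edge, and their contributions cancel once both are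
reached. -/
lemma sum_lensGram_last {k j t : ℕ} (htk : t ≤ 2 * k + 1) :
    ∑ i ∈ Finset.range t, lensGram k j i (2 * k + 1) =
      (if 1 + 2 * j < t then 1 else 0) - (if 2 + 2 * j < t then 1 else 0) := by
  induction t with
  | zero => simp
  | succ t ih =>
    rw [Finset.sum_range_succ, ih (by omega)]
    unfold lensGram
    grind

lemma lensGram_zero_iff {k j y z : ℕ} : lensGram k j y z ≠ 0 ↔ y = z ∨
    ((z = y + 2 ∨ y = z + 2 ∨ (y = 0 ∧ z = 1) ∨ (y = 1 ∧ z = 0)) ∧ y ≤ 2 * k ∧ z ≤ 2 * k) ∨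
    (y = 2 * k + 1 ∧ z = 1 + 2 * j) ∨ (z = 2 * k + 1 ∧ y = 1 + 2 * j) ∨
    (y = 2 * k + 1 ∧ z = 2 + 2 * j) ∨ (z = 2 * k + 1 ∧ y = 2 + 2 * j) := by
  unfold lensGram
  grind

lemma lensGram_dotted {k j : ℕ} (hj : j < k) : lensGram k j (1 + 2 * j) (2 * k + 1) = 1 := by
  unfold lensGram
  grind

/-- The parent of a vertex in the tree obtained by removal of the dotted edge. -/
def lensParent (k j i : ℕ) : ℕ := if i = 2 * k + 1 then 2 + 2 * j else i - 2

lemma lensGram_parent {k j i : ℕ} (hj : j < k) (hi : i < 2 * k + 2) (hi0 : i ≠ 0) :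
    lensGram k j i (lensParent k j i) = -1 := by
  by_cases h : i = 2 * k + 1
  · rw [lensParent, if_pos h, h]
    unfold lensGram
    grind
  · rw [lensParent, if_neg h]
    unfold lensGram
    grind

lemma lensGram_eq_zero {k j y z : ℕ} (hyz : y < z) (hz : z < 2 * k + 2)
    (hne : ¬ (z = 2 * k + 1 ∧ y = 1 + 2 * j)) (hp : y ≠ lensParent k j z) :
    lensGram k j z y = 0 := by
  by_cases h : z = 2 * k + 1
  · rw [lensParent, if_pos h] at hp
    unfold lensGram
    grind
  · rw [lensParent, if_neg h] at hp
    unfold lensGram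
    grind

lemma lensParent_lt {k j i : ℕ} (hj : j < k) (hi0 : i ≠ 0) : lensParent k j i < i := by
  unfold lensParent
  split_ifs <;> omega

lemma IsForm.isOrthogonal_iff_of_absGram {B : LinearMap.BilinForm ℝ M} (hB : IsForm P B) {n : ℕ}
    {g : ℕ → ℕ → ℤ} {f : ℕ → ι} (h : HasAbsGram P n g f) {y z : ℕ} (hy : y < n) (hz : z < n) :
    P.IsOrthogonal (f y) (f z) ↔ g y z = 0 := by
  constructor
  · intro ho
    have := h y hy z hz
    rw [ho.1] at this
    simpa using this.symm
  · intro h0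
    apply hB.isOrthogonal_of_pairing
    have := h y hy z hz
    rw [h0] at this
    simpa using this

/-- The signs can be chosen in such a way that exactly one edge is dotted. -/
lemma IsForm.exists_lensGram {B : LinearMap.BilinForm ℝ M} (hB : IsForm P B) {Ω : List ι}
    (hi : Indep P Ω) {k j : ℕ} (hj : j < k) {a : ℕ → ι} (ha : ∀ i < 2 * k + 2, a i ∈ Ω)
    (hinj : ∀ i < 2 * k + 2, ∀ j < 2 * k + 2, i ≠ j → a i ≠ a j)
    (hg : HasAbsGram P (2 * k + 2) (lensGram k j) a) :
    ∃ b, IsSigned P a b ∧ HasGram P (2 * k + 2) (lensGram k j) b := by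
  set b := obtuse P a (lensParent k j)
  have hab : IsSigned P a b := obtuse_isSigned a _
  have hb := hg.signed hab
  have hsym : ∀ y < 2 * k + 2, ∀ z < 2 * k + 2, P.pairing (b y) (b z) = P.pairing (b z) (b y) := by
    intro y hy z hz
    have h1 := hb y hy z hz
    have h2 := hb z hz y hy
    rw [lensGram_comm k j z y] at h2
    by_cases hyz : y = z
    · rw [hyz]
    have h3 : lensGram k j y z = 0 ∨ |lensGram k j y z| = 1 := by
      unfold lensGram
      split_ifs <;> simp
    rcases h3 with h3 | h3
    · rw [h3] at h1 h2
      simp at h1 h2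
      rw [h1, h2]
    · have h3' : |(lensGram k j y z : ℝ)| = 1 := by exact_mod_cast h3
      rw [h3'] at h1 h2
      exact hB.pairing_eq_of_abs h1 h2
  have hpar : ∀ i < 2 * k + 2, i ≠ 0 → P.pairing (b i) (b (lensParent k j i)) = -1 := by
    intro i hi hi0
    have hlt := lensParent_lt hj hi0
    apply obtuse_pairing hlt
    rw [hg i hi _ (by omega), lensGram_parent hj hi hi0]
    simp
  set c := P.pairing (b (1 + 2 * j)) (b (2 * k + 1))
  have hc : c = 1 ∨ c = -1 := by
    have h1 := hb (1 + 2 * j) (by omega) (2 * k + 1) (by omega)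
    rw [lensGram_dotted hj, Int.cast_one, abs_one] at h1
    exact eq_or_eq_neg_of_abs_eq h1
  have hlt : ∀ y z, y < z → z < 2 * k + 2 → ¬ (z = 2 * k + 1 ∧ y = 1 + 2 * j) →
      P.pairing (b z) (b y) = lensGram k j z y := by
    intro y z hyz hz hne
    by_cases hp : y = lensParent k j z
    · rw [hp, hpar z hz (by omega), lensGram_parent hj hz (by omega)]
      simp
    · have h1 := hb z hz y (by omega)
      rw [lensGram_eq_zero hyz hz hne hp] at h1 ⊢
      simpa using h1
  -- All other edges are fixed. If this edge were solid as well, the roots of the cycle formed by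
  -- `0, …, 2 * j + 2` and the last vertex would have a sum orthogonal to each of them.
  have hc1 : c = 1 := by
    refine hc.resolve_right fun hc => ?_
    obtain ⟨y, hy, hne⟩ := hB.exists_sum_ne_zero hi hab
      (insert (2 * k + 1) (Finset.range (2 * j + 3))) ⟨2 * k + 1, by simp⟩
      (fun i hi => ha i (by simp at hi; omega))
      (fun i hi j hj hij => hinj i (by simp at hi; omega) j (by simp at hj; omega) hij)
    apply hne
    rw [Finset.mem_insert, Finset.mem_range] at hy
    rw [Finset.sum_insert (by simp; omega)]
    have hval : ∀ z < 2 * k + 2, P.pairing (b z) (b y) = lensGram k j z y -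
        if (z = 2 * k + 1 ∧ y = 1 + 2 * j) ∨ (y = 2 * k + 1 ∧ z = 1 + 2 * j) then 2 else 0 := by
      intro z hz
      split_ifs with h
      · have e1 : lensGram k j z y = 1 := by
          rcases h with ⟨rfl, rfl⟩ | ⟨rfl, rfl⟩
          · rw [lensGram_comm, lensGram_dotted hj]
          · exact lensGram_dotted hj
        rw [e1]
        rcases h with ⟨rfl, rfl⟩ | ⟨rfl, rfl⟩
        · rw [hsym _ hz _ (by omega)]
          change c = _
          rw [hc]; norm_num
        · change c = _
          rw [hc]; norm_num
      · rw [sub_zero]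
        rcases lt_trichotomy y z with h1 | rfl | h1
        · exact hlt y z h1 hz (by omega)
        · rw [P.pairing_same]; simp [lensGram]
        · rw [hsym _ hz _ (by omega), lensGram_comm]
          exact hlt z y h1 (by omega) (by omega)
    rw [hval _ (by omega), Finset.sum_congr rfl (fun z hz => hval z (by
      rw [Finset.mem_range] at hz; omega)), Finset.sum_sub_distrib]
    have h0 := fun hy' hty => sum_lensGram (k := k) (j := j) (t := 2 * j + 3) (y := y) (by omega)
      (by omega) hy' hty
    have h00 := sum_lensGram_last (k := k) (j := j) (t := 2 * j + 3) (by omega)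
    have e2 : ∑ z ∈ Finset.range (2 * j + 3), (if (z = 2 * k + 1 ∧ y = 1 + 2 * j) ∨
        (y = 2 * k + 1 ∧ z = 1 + 2 * j) then (2 : ℝ) else 0) =
        if y = 2 * k + 1 then 2 else 0 := by
      by_cases hyk : y = 2 * k + 1
      · rw [if_pos hyk, Finset.sum_eq_single (1 + 2 * j)]
        · rw [if_pos (by omega)]
        · intro z hz hne
          rw [if_neg (by simp at hz; omega)]
        · simp; omega
      · rw [if_neg hyk]
        refine Finset.sum_eq_zero fun z hz => ?_
        rw [if_neg (by simp at hz; omega)]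
    rw [e2]
    by_cases hyk : y = 2 * k + 1
    · subst hyk
      have h1 : (∑ z ∈ Finset.range (2 * j + 3), (lensGram k j z (2 * k + 1) : ℝ)) =
          ((0 : ℤ) : ℝ) := by
        rw [← Int.cast_sum, h00]
        congr 1
        split_ifs <;> omega
      rw [h1, if_neg (by omega), if_pos rfl]
      simp [lensGram]
    · have h1 : (∑ z ∈ Finset.range (2 * j + 3), (lensGram k j z y : ℝ)) =
          ((if y + 2 < 2 * j + 3 then 0 else 1 : ℤ) : ℝ) := by
        rw [← Int.cast_sum, h0 (by omega) (by omega)]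
        congr 1
        split_ifs <;> omega
      rw [h1, if_neg hyk]
      by_cases hy1 : y = 1 + 2 * j
      · rw [if_pos (.inl ⟨rfl, hy1⟩), if_neg (by omega), hy1, lensGram_comm, lensGram_dotted hj]
        norm_num
      · rw [if_neg (by omega)]
        by_cases hy2 : y = lensParent k j (2 * k + 1)
        · rw [hy2, lensGram_parent hj (by omega) (by omega), ← hy2, if_neg]
          · norm_num
          · rw [lensParent, if_pos rfl] at hy2
            omega
        · rw [lensGram_eq_zero (by omega) (by omega) (by omega) hy2, if_pos]
          · norm_num
          · rw [lensParent, if_pos rfl] at hy2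
            omega
  refine ⟨b, hab, fun y hy z hz => ?_⟩
  have hge : ∀ y z, y < z → z < 2 * k + 2 → P.pairing (b z) (b y) = lensGram k j z y := by
    intro y z hyz hz
    by_cases h : z = 2 * k + 1 ∧ y = 1 + 2 * j
    · obtain ⟨rfl, rfl⟩ := h
      rw [hsym _ hz _ (by omega)]
      change c = _
      rw [hc1]
      simp [lensGram]
      omega
    · exact hlt y z hyz hz h
  rcases lt_trichotomy y z with h1 | rfl | h1
  · rw [hsym _ hy _ hz, lensGram_comm]
    exact hge y z h1 hz
  · rw [P.pairing_same]; simp [lensGram]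
  · exact hge z y h1 hy

end Lens

end Carter

namespace Carter

/-! ### Turning the arms over -/

section Slide

variable {ι M N : Type*} [AddCommGroup M] [Module ℝ M] [AddCommGroup N] [Module ℝ N]
  {P : RootPairing ι ℝ M N}

lemma Loc.permRight (L R : List ι) (i j : ι) :
    Loc P (L ++ i :: j :: R) (L ++ j :: P.reflectionPerm j i :: R) := by
  have := Loc.hurwitz (P := P) L R j (P.reflectionPerm j i)
  rw [P.reflectionPerm_self] at this
  exact this.symm

lemma HasGram.pairing_sum_left {n : ℕ} {g : ℕ → ℕ → ℤ} {f : ℕ → ι} (hg : HasGram P n g f) {u : ι}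
    {t : ℕ} (ht : t ≤ n) (hu : P.root u = ∑ i ∈ Finset.range t, P.root (f i)) {y : ℕ} (hy : y < n) :
    P.pairing u (f y) = ((∑ i ∈ Finset.range t, g i y : ℤ) : ℝ) := by
  rw [← P.root_coroot_eq_pairing, hu, map_sum, LinearMap.sum_apply, Int.cast_sum]
  refine Finset.sum_congr rfl fun i hi => ?_
  rw [Finset.mem_range] at hi
  rw [P.root_coroot_eq_pairing, hg i (by omega) y hy]

lemma HasGram.pairing_sum_right {n : ℕ} {g : ℕ → ℕ → ℤ} {f : ℕ → ι} (hg : HasGram P n g f)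
    {u : ι} {t : ℕ} (ht : t ≤ n) (hu : P.coroot u = ∑ i ∈ Finset.range t, P.coroot (f i)) {y : ℕ}
    (hy : y < n) : P.pairing (f y) u = ((∑ i ∈ Finset.range t, g y i : ℤ) : ℝ) := by
  rw [← P.root_coroot_eq_pairing, hu, map_sum, Int.cast_sum]
  refine Finset.sum_congr rfl fun i hi => ?_
  rw [Finset.mem_range] at hi
  rw [P.root_coroot_eq_pairing, hg y hy i (by omega)]

/-- The first root is moved to the right through roots which make obtuse angles with the sums of
the preceding ones. -/
lemma HasGram.exists_slide {n : ℕ} {g : ℕ → ℕ → ℤ} {f : ℕ → ι} (hg : HasGram P n g f)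
    (hcomm : ∀ y z, g y z = g z y) {m : ℕ} (hmn : m ≤ n) (hm : 1 ≤ m)
    (hsum : ∀ t, 1 ≤ t → t < m → ∑ i ∈ Finset.range t, g i t = -1) :
    ∃ u, (∀ T, Loc P (f 0 :: ((List.range' 1 (m - 1)).map f ++ T))
        ((List.range' 1 (m - 1)).map f ++ u :: T)) ∧
      P.root u = ∑ i ∈ Finset.range m, P.root (f i) ∧
      P.coroot u = ∑ i ∈ Finset.range m, P.coroot (f i) := by
  induction m, hm using Nat.le_induction with
  | base => exact ⟨f 0, fun T => by simpa using .refl _, by simp, by simp⟩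
  | succ t ht ih =>
    obtain ⟨u, hu1, hu2, hu3⟩ := ih (by omega) (fun s hs1 hs2 => hsum s hs1 (by omega))
    have h1 := hg.pairing_sum_left (by omega) hu2 (y := t) (by omega)
    have h2 := hg.pairing_sum_right (by omega) hu3 (y := t) (by omega)
    rw [hsum t ht (by omega)] at h1
    rw [Finset.sum_congr rfl (fun i _ => hcomm t i), hsum t ht (by omega)] at h2
    refine ⟨P.reflectionPerm (f t) u, fun T => ?_, ?_, ?_⟩
    · have h3 := hu1 (f t :: T)
      have h4 := Loc.permRight (P := P) ((List.range' 1 (t - 1)).map f) T u (f t)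
      have h5 : List.range' 1 (t + 1 - 1) = List.range' 1 (t - 1) ++ [t] := by
        have := List.range'_concat (s := 1) (n := t - 1) (step := 1)
        rw [show t - 1 + 1 = t + 1 - 1 by omega] at this
        rw [this, show 1 + 1 * (t - 1) = t by omega]
      rw [h5]
      simpa using h3.trans h4
    · rw [P.root_reflectionPerm, P.reflection_apply_root, Finset.sum_range_succ, ← hu2, h1]
      simp
    · rw [P.coroot_reflectionPerm, P.coreflection_apply_coroot, Finset.sum_range_succ, ← hu3, h2]
      simp

/-- The blocks of vertices of the same distance from the vertex `0`. -/
def lensBlock (i : ℕ) : List ℕ := [1 + 2 * i, 2 + 2 * i]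

lemma flatten_lensBlock (k : ℕ) :
    ((List.range k).map lensBlock).flatten = List.range' 1 (2 * k) := by
  induction k with
  | zero => rfl
  | succ k ih =>
    rw [List.range_succ, List.map_append, List.flatten_append, ih,
      show 2 * (k + 1) = 2 * k + 1 + 1 by omega, List.range'_concat, List.range'_concat]
    simp [lensBlock]
    omega

lemma range_eq_lens (k : ℕ) :
    List.range (2 * k + 2) = 0 :: (List.range' 1 (2 * k) ++ [2 * k + 1]) := by
  rw [List.range_eq_range', show 2 * k + 2 = (2 * k + 1) + 1 by omega, List.range'_succ,
    List.range'_concat]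
  simp
  omega

variable {B : LinearMap.BilinForm ℝ M}

/-- Folding the two arms together leaves a tree: the path of heights starting at `0`, and the last
vertex attached at height `j`. -/
lemma IsForm.lens_isForest (hB : IsForm P B) {k j : ℕ} {f : ℕ → ι}
    (hg : HasAbsGram P (2 * k + 2) (lensGram k j) f) :
    IsForest (WordsCommute P.IsOrthogonal)
      (([2 * k + 1] :: [0] :: (List.range k).map lensBlock).map (List.map f)) := by
  have hcomm : ∀ U V : List ℕ, (∀ y ∈ U, y < 2 * k + 2) → (∀ z ∈ V, z < 2 * k + 2) →
      (∀ y ∈ U, ∀ z ∈ V, lensGram k j y z = 0) →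
      WordsCommute P.IsOrthogonal (U.map f) (V.map f) := by
    intro U V hU hV h u hu v hv
    obtain ⟨y, hy, rfl⟩ := List.mem_map.1 hu
    obtain ⟨z, hz, rfl⟩ := List.mem_map.1 hv
    exact (hB.isOrthogonal_iff_of_absGram hg (hU y hy) (hV z hz)).2 (h y hy z hz)
  have hz : ∀ y z, ¬ (y = z ∨
    ((z = y + 2 ∨ y = z + 2 ∨ (y = 0 ∧ z = 1) ∨ (y = 1 ∧ z = 0)) ∧ y ≤ 2 * k ∧ z ≤ 2 * k) ∨
    (y = 2 * k + 1 ∧ z = 1 + 2 * j) ∨ (z = 2 * k + 1 ∧ y = 1 + 2 * j) ∨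
    (y = 2 * k + 1 ∧ z = 2 + 2 * j) ∨ (z = 2 * k + 1 ∧ y = 2 + 2 * j)) → lensGram k j y z = 0 := by
    intro y z h
    by_contra h'
    exact h (lensGram_zero_iff.1 h')
  have hlast0 : 1 ≤ k → WordsCommute P.IsOrthogonal ([2 * k + 1].map f) ([0].map f) := by
    intro hk
    refine hcomm _ _ (by simp) (by simp) ?_
    simp only [List.mem_singleton, forall_eq]
    exact hz _ _ (by omega)
  have hlast : ∀ i < k, i ≠ j →
      WordsCommute P.IsOrthogonal ([2 * k + 1].map f) ((lensBlock i).map f) := by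
    intro i hi hij
    refine hcomm _ _ (by simp) (by simp [lensBlock]; omega) ?_
    simp only [forall_eq, lensBlock, List.mem_cons, List.not_mem_nil, or_false]
    rintro z (rfl | rfl) <;> exact hz _ _ (by omega)
  have hzero : ∀ i < k, i ≠ 0 →
      WordsCommute P.IsOrthogonal ([0].map f) ((lensBlock i).map f) := by
    intro i hi hij
    refine hcomm _ _ (by simp) (by simp [lensBlock]; omega) ?_
    simp only [forall_eq, lensBlock, List.mem_cons, List.not_mem_nil, or_false]
    rintro z (rfl | rfl) <;> exact hz _ _ (by omega)
  have hblock : ∀ i < k, ∀ i' < k, i + 1 < i' →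
      WordsCommute P.IsOrthogonal ((lensBlock i).map f) ((lensBlock i').map f) := by
    intro i hi i' hi' hii
    refine hcomm _ _ (by simp [lensBlock]; omega) (by simp [lensBlock]; omega) ?_
    simp only [lensBlock, List.mem_cons, List.not_mem_nil, or_false]
    rintro y (rfl | rfl) z (rfl | rfl) <;> exact hz _ _ (by omega)
  have hpw : ∀ s len, (List.range' s len).Pairwise (· < ·) := fun s len =>
    List.pairwise_lt_range'
  have hrest : ∀ s len, s + len ≤ k → IsForest (WordsCommute P.IsOrthogonal)
      (((List.range' s len).map lensBlock).map (List.map f)) := by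
    intro s len
    induction len generalizing s with
    | zero => intro _; trivial
    | succ len ih =>
      intro hs
      rw [List.range'_succ]
      refine ⟨?_, ih (s + 1) (by omega)⟩
      rw [List.map_map]
      refine List.pairwise_map.2 ?_
      refine List.Pairwise.imp_of_mem ?_ (hpw (s + 1) len)
      intro i i' hi hi' hlt
      rw [List.mem_range'_1] at hi hi'
      exact .inr (hblock s (by omega) i' (by omega) (by omega))
  have h0 := hrest 0 k (by omega)
  rw [← List.range_eq_range'] at h0
  refine ⟨?_, ?_, h0⟩
  · rw [List.map_cons (f := List.map f) (a := [0]), List.pairwise_cons]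
    constructor
    · intro U hU
      obtain ⟨V, hV, rfl⟩ := List.mem_map.1 hU
      obtain ⟨i, hi, rfl⟩ := List.mem_map.1 hV
      rw [List.mem_range] at hi
      exact .inl (hlast0 (by omega))
    · rw [List.map_map]
      refine List.pairwise_map.2 ?_
      refine List.Pairwise.imp_of_mem ?_ (List.pairwise_lt_range (n := k))
      intro i i' hi hi' hlt
      rw [List.mem_range] at hi hi'
      by_cases hij : i = j
      · exact .inr (hlast i' hi' (by omega))
      · exact .inl (hlast i hi hij)
  · rw [List.map_map]
    refine List.pairwise_map.2 ?_
    refine List.Pairwise.imp_of_mem ?_ (List.pairwise_lt_range (n := k))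
    intro i i' hi hi' hlt
    rw [List.mem_range] at hi hi'
    exact .inr (hzero i' hi' (by omega))

lemma mem_left_iff {A A' : List ι} (hA : A.Pairwise P.IsOrthogonal)
    (hA' : A'.Pairwise P.IsOrthogonal) {x y : ι} (hx : x ∈ A ++ A') (hy : y ∈ A ++ A')
    (hxy : x ≠ y) (hl : Linked P x y) : x ∈ A ↔ y ∉ A := by
  have : Std.Symm P.IsOrthogonal := ⟨fun _ _ h => h.symm⟩
  constructor
  · intro h h'
    exact hl (hA.forall h h' hxy)
  · intro h
    by_contra h'
    exact hl (hA'.forall ((List.mem_append.1 hx).resolve_left h')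
      ((List.mem_append.1 hy).resolve_left h) hxy)

/-- The two vertices of equal height have the same colour, so each word lies in one of the two
blocks and `Cyc.of_blocks` applies. The order of the words is then free, since they form a forest.
-/
lemma IsForm.lens_cyc (hB : IsForm P B) {k j : ℕ} {f : ℕ → ι}
    (hg : HasAbsGram P (2 * k + 2) (lensGram k j) f) {A A' : List ι}
    (hA : A.Pairwise P.IsOrthogonal) (hA' : A'.Pairwise P.IsOrthogonal) (hi : Indep P (A ++ A'))
    (hp : (A ++ A').Perm ((List.range (2 * k + 2)).map f)) {W : List (List ℕ)}
    (hW : W.Perm ([2 * k + 1] :: [0] :: (List.range k).map lensBlock)) :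
    Cyc P.IsOrthogonal (A ++ A') (W.flatten.map f) := by
  have hs : ∀ a b : ι, P.IsOrthogonal a b → P.IsOrthogonal b a := fun _ _ h => h.symm
  have hmem : ∀ y < 2 * k + 2, f y ∈ A ++ A' := fun y hy =>
    hp.mem_iff.2 (List.mem_map.2 ⟨y, List.mem_range.2 hy, rfl⟩)
  have hinj : ∀ y < 2 * k + 2, ∀ z < 2 * k + 2, y ≠ z → f y ≠ f z := by
    intro y hy z hz hyz h
    exact hyz (List.inj_on_of_nodup_map (hp.nodup_iff.1 hi.nodup) (List.mem_range.2 hy)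
      (List.mem_range.2 hz) h)
  have hcol : ∀ y < 2 * k + 2, ∀ z < 2 * k + 2, y ≠ z → lensGram k j y z ≠ 0 →
      (f y ∈ A ↔ f z ∉ A) := by
    intro y hy z hz hyz h
    refine mem_left_iff hA hA' (hmem y hy) (hmem z hz) (hinj y hy z hz hyz) fun ho => ?_
    exact h ((hB.isOrthogonal_iff_of_absGram hg hy hz).1 ho)
  have hblock : ∀ i < k, (f (1 + 2 * i) ∈ A ↔ f (2 + 2 * i) ∈ A) := by
    intro i
    induction i with
    | zero =>
      intro hk
      have h1 := hcol 0 (by omega) 1 (by omega) (by omega) (lensGram_zero_iff.2 (by omega))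
      have h2 := hcol 0 (by omega) 2 (by omega) (by omega) (lensGram_zero_iff.2 (by omega))
      change f 1 ∈ A ↔ f 2 ∈ A
      tauto
    | succ i ih =>
      intro hk
      have h1 := hcol (1 + 2 * i) (by omega) (1 + 2 * (i + 1)) (by omega) (by omega)
        (lensGram_zero_iff.2 (by omega))
      have h2 := hcol (2 + 2 * i) (by omega) (2 + 2 * (i + 1)) (by omega) (by omega)
        (lensGram_zero_iff.2 (by omega))
      have h3 := ih (by omega)
      tauto
  have hor : ∀ y < 2 * k + 2, f y ∈ A ∨ f y ∈ A' := fun y hy => List.mem_append.1 (hmem y hy)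
  set W₀ : List (List ℕ) := [2 * k + 1] :: [0] :: (List.range k).map lensBlock
  have hflat : W₀.flatten.Perm (List.range (2 * k + 2)) := by
    simp only [W₀, List.flatten_cons, flatten_lensBlock, range_eq_lens]
    have : ([2 * k + 1] ++ ([0] ++ List.range' 1 (2 * k))).Perm
        ([0] ++ List.range' 1 (2 * k) ++ [2 * k + 1]) := List.perm_append_comm
    simpa using this
  have h1 : Cyc P.IsOrthogonal (A ++ A') (W₀.map (List.map f)).flatten := by
    refine Cyc.of_blocks hs hA hA' hi.nodup (hB.lens_isForest hg) ?_ ?_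
    · rw [← List.map_flatten]
      exact (hflat.map f).trans hp.symm
    · intro U hU
      obtain ⟨V, hV, rfl⟩ := List.mem_map.1 hU
      simp only [W₀, List.mem_cons, List.mem_map, List.mem_range] at hV
      rcases hV with rfl | rfl | ⟨i, hik, rfl⟩
      · simpa using hor (2 * k + 1) (by omega)
      · simpa using hor 0 (by omega)
      · have e1 := hor (1 + 2 * i) (by omega)
        have e2 := hor (2 + 2 * i) (by omega)
        have e3 := hblock i hik
        have hd := List.disjoint_of_nodup_append hi.nodup
        simp only [lensBlock, List.map_cons, List.map_nil, List.mem_cons, List.not_mem_nil,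
          or_false, forall_eq_or_imp, forall_eq]
        by_cases h : f (1 + 2 * i) ∈ A
        · exact .inl ⟨h, e3.1 h⟩
        · exact .inr ⟨e1.resolve_left h, e2.resolve_left fun h' => h (e3.2 h')⟩
  refine h1.trans ?_
  rw [List.map_flatten]
  exact (Cyc.of_isForest (hB.lens_isForest hg) (hW.map _)).flatten.symm

/-- The colour of a vertex. -/
def lensColour (k j y : ℕ) : Bool := (if y = 2 * k + 1 then j else (y + 1) / 2) % 2 == 0

lemma IsForm.exists_lens_bicolored (hB : IsForm P B) {k j : ℕ} {f : ℕ → ι}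
    (hg : HasAbsGram P (2 * k + 2) (lensGram k j) f) :
    ∃ A A' : List ι, A.Pairwise P.IsOrthogonal ∧ A'.Pairwise P.IsOrthogonal ∧
      (A ++ A').Perm ((List.range (2 * k + 2)).map f) := by
  have key : ∀ c : Bool, (((List.range (2 * k + 2)).filter fun y => lensColour k j y == c).map
      f).Pairwise P.IsOrthogonal := by
    intro c
    refine List.pairwise_map.2 ?_
    refine List.Pairwise.imp_of_mem ?_ (List.pairwise_lt_range.filter _)
    intro y z hy hz hlt
    rw [List.mem_filter, List.mem_range] at hy hz
    rw [hB.isOrthogonal_iff_of_absGram hg hy.1 hz.1]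
    by_contra h
    have h1 := lensGram_zero_iff.1 h
    have h2 : lensColour k j y = lensColour k j z := by
      rw [beq_iff_eq.1 hy.2, beq_iff_eq.1 hz.2]
    unfold lensColour at h2
    rw [Bool.eq_iff_iff, beq_iff_eq, beq_iff_eq] at h2
    split_ifs at h2 <;> omega
  refine ⟨_, _, key true, key false, ?_⟩
  rw [← List.map_append]
  refine List.Perm.map f ?_
  have := List.filter_append_perm (fun y => lensColour k j y == true) (List.range (2 * k + 2))
  refine List.Perm.trans (List.Perm.of_eq ?_) this
  congr 2
  ext y
  cases lensColour k j y <;> rfl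

lemma map_flatten_reverse_lensBlock {k : ℕ} {f f' : ℕ → ι}
    (h1 : ∀ i < k, f' (1 + 2 * i) = f (1 + 2 * (k - 1 - i)))
    (h2 : ∀ i < k, f' (2 + 2 * i) = f (2 + 2 * (k - 1 - i))) :
    ((List.range k).reverse.map lensBlock).flatten.map f' = (List.range' 1 (2 * k)).map f := by
  rw [← flatten_lensBlock, List.map_flatten, List.map_flatten]
  congr 1
  rw [List.map_map, List.map_map]
  apply List.ext_getElem (by simp)
  intro i hi hi'
  simp at hi
  simp [lensBlock]
  rw [h1 _ (by omega), h2 _ (by omega)]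
  simp only [show k - 1 - (k - 1 - i) = i by omega, and_self]

/-- The numerical hypotheses encode the reversal of the heights, `i ↦ k - 1 - i`, in each arm, the
last vertex being fixed. -/
lemma lensGram_flip {k j y z y' z' : ℕ} (hj : j < k) (hy0 : y ≠ 0) (hz0 : z ≠ 0)
    (hy : (y = 2 * k + 1 ∧ y' = 2 * k + 1) ∨ (y % 2 = 1 ∧ y ≤ 2 * k ∧ y' + y = 2 * k) ∨
      (y % 2 = 0 ∧ y ≤ 2 * k ∧ y' + y = 2 * k + 2))
    (hz : (z = 2 * k + 1 ∧ z' = 2 * k + 1) ∨ (z % 2 = 1 ∧ z ≤ 2 * k ∧ z' + z = 2 * k) ∨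
      (z % 2 = 0 ∧ z ≤ 2 * k ∧ z' + z = 2 * k + 2)) :
    lensGram k j y' z' = lensGram k (k - 1 - j) y z := by
  unfold lensGram
  rcases hy with hy | hy | hy <;> rcases hz with hz | hz | hz <;>
  exact if_congr (by omega) rfl (if_congr (by omega) rfl (if_congr (by omega) rfl
    (if_congr (by omega) rfl rfl)))

/-- The end of the arms at which the second vertex is attached is changed. -/
theorem IsForm.lens_flip (hB : IsForm P B) {k j : ℕ} (hj : j < k) {A A' : List ι} {a : ℕ → ι}
    (hA : A.Pairwise P.IsOrthogonal) (hA' : A'.Pairwise P.IsOrthogonal) (hi : Indep P (A ++ A'))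
    (hp : (A ++ A').Perm ((List.range (2 * k + 2)).map a))
    (hg : HasAbsGram P (2 * k + 2) (lensGram k j) a) :
    ∃ (f : ℕ → ι) (C C' : List ι), C.Pairwise P.IsOrthogonal ∧ C'.Pairwise P.IsOrthogonal ∧
      (C ++ C').Perm ((List.range (2 * k + 2)).map f) ∧
      HasGram P (2 * k + 2) (lensGram k (k - 1 - j)) f ∧ Loc P (A ++ A') (C ++ C') := by
  have hmem : ∀ y < 2 * k + 2, a y ∈ A ++ A' := fun y hy =>
    hp.mem_iff.2 (List.mem_map.2 ⟨y, List.mem_range.2 hy, rfl⟩)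
  have hinj : ∀ y < 2 * k + 2, ∀ z < 2 * k + 2, y ≠ z → a y ≠ a z := by
    intro y hy z hz hyz h
    exact hyz (List.inj_on_of_nodup_map (hp.nodup_iff.1 hi.nodup) (List.mem_range.2 hy)
      (List.mem_range.2 hz) h)
  obtain ⟨b, hab, hb⟩ := hB.exists_lensGram hi hj hmem hinj hg
  have l1 : Loc P (A ++ A') ((List.range (2 * k + 2)).map b) := by
    refine Loc.trans ?_ (hab.loc _)
    have := (hB.lens_cyc hg hA hA' hi hp
      (W := [0] :: ((List.range k).map lensBlock ++ [[2 * k + 1]])) ?_).loc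
    · rw [range_eq_lens]
      simpa [flatten_lensBlock] using this
    · have : ([[2 * k + 1]] ++ ([0] :: (List.range k).map lensBlock)).Perm
        (([0] :: (List.range k).map lensBlock) ++ [[2 * k + 1]]) := List.perm_append_comm
      exact this.symm
  -- Vertex `0` is slid through both arms and stops just before the last vertex.
  obtain ⟨u, hu1, hu2, hu3⟩ := hb.exists_slide (lensGram_comm k j) (m := 2 * k + 1) (by omega)
    (by omega) (fun t ht1 ht2 => by
      rw [sum_lensGram ht1 (by omega) (by omega) (by omega), if_neg (by omega), if_neg (by omega),
        if_pos (by omega)])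
  -- The new vertex `0` is the negative of the slid root. It now sits between the former ends of the
  -- arms, so the arms are numbered from their other ends.
  set f : ℕ → ι := fun y => if y = 0 then neg P u else if y = 2 * k + 1 then b y
    else if y % 2 = 1 then b (2 * k - y) else b (2 * k + 2 - y)
  have f0 : f 0 = neg P u := if_pos rfl
  have f1 : f (2 * k + 1) = b (2 * k + 1) := by
    simp only [f]; rw [if_neg (by omega), if_pos trivial]
  have f2 : ∀ i < k, f (1 + 2 * i) = b (1 + 2 * (k - 1 - i)) := by
    intro i hi
    simp only [f]
    rw [if_neg (by omega), if_neg (by omega), if_pos (by omega)]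
    congr 1; omega
  have f3 : ∀ i < k, f (2 + 2 * i) = b (2 + 2 * (k - 1 - i)) := by
    intro i hi
    simp only [f]
    rw [if_neg (by omega), if_neg (by omega), if_neg (by omega)]
    congr 1; omega
  have hfg : HasGram P (2 * k + 2) (lensGram k (k - 1 - j)) f := by
    -- The sum of the chain meets only its two ends; the two edges of the last vertex cancel.
    have e1 : ∀ y < 2 * k + 2, y ≠ 0 → P.pairing u (b y) =
        if y = 2 * k ∨ y + 1 = 2 * k then 1 else 0 := by
      intro y hy hy0
      rw [hb.pairing_sum_left (by omega) hu2 hy]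
      by_cases hyk : y = 2 * k + 1
      · rw [hyk, sum_lensGram_last (by omega),
          if_neg (show ¬ (2 * k + 1 = 2 * k ∨ 2 * k + 1 + 1 = 2 * k) by omega),
          if_pos (show 1 + 2 * j < 2 * k + 1 by omega), if_pos (show 2 + 2 * j < 2 * k + 1 by omega)]
        simp
      · rw [sum_lensGram (by omega) (by omega) (by omega) (by omega)]
        by_cases h : y = 2 * k ∨ y + 1 = 2 * k
        · rw [if_pos h, if_neg (by omega), if_pos (by omega)]; simp
        · rw [if_neg h, if_pos (by omega)]; simp
    have e2 : ∀ y < 2 * k + 2, y ≠ 0 → P.pairing (b y) u =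
        if y = 2 * k ∨ y + 1 = 2 * k then 1 else 0 := by
      intro y hy hy0
      rw [← e1 y hy hy0, hb.pairing_sum_left (by omega) hu2 hy,
        hb.pairing_sum_right (by omega) hu3 hy]
      congr 1
      exact Finset.sum_congr rfl fun i _ => lensGram_comm _ _ _ _
    have hf : ∀ y < 2 * k + 2, y ≠ 0 → ∃ y', y' < 2 * k + 2 ∧ y' ≠ 0 ∧ f y = b y' ∧
        ((y = 2 * k + 1 ∧ y' = 2 * k + 1) ∨ (y % 2 = 1 ∧ y ≤ 2 * k ∧ y' + y = 2 * k) ∨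
          (y % 2 = 0 ∧ y ≤ 2 * k ∧ y' + y = 2 * k + 2)) := by
      intro y hy hy0
      simp only [f]
      rw [if_neg hy0]
      split_ifs with h1 h2
      · exact ⟨y, hy, hy0, rfl, .inl ⟨h1, h1⟩⟩
      · exact ⟨_, by omega, by omega, rfl, .inr (.inl (by omega))⟩
      · exact ⟨_, by omega, by omega, rfl, .inr (.inr (by omega))⟩
    have hz : ∀ z < 2 * k + 2, z ≠ 0 → lensGram k (k - 1 - j) 0 z = if z = 1 ∨ z = 2 then -1 else 0 := by
      intro z hz hz0
      unfold lensGram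
      rw [if_neg hz0.symm]
      by_cases h : z = 1 ∨ z = 2
      · rw [if_pos (by omega), if_pos h]
      · rw [if_neg (by omega), if_neg (by omega), if_neg (by omega), if_neg h]
    intro y hy z hz'
    by_cases hy0 : y = 0
    · subst hy0
      rw [f0]
      by_cases hz0 : z = 0
      · subst hz0
        rw [f0, P.pairing_same]; simp [lensGram]
      · obtain ⟨z', hz1, hz2, hz3, hz4⟩ := hf z hz' hz0
        rw [hz3, pairing_neg_left, e1 z' hz1 hz2, hz z hz' hz0]
        by_cases h : z = 1 ∨ z = 2
        · rw [if_pos h, if_pos (by omega)]; simp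
        · rw [if_neg h, if_neg (by omega)]; simp
    · obtain ⟨y', hy1, hy2, hy3, hy4⟩ := hf y hy hy0
      by_cases hz0 : z = 0
      · subst hz0
        rw [f0, hy3, pairing_neg_right, e2 y' hy1 hy2, lensGram_comm, hz y hy hy0]
        by_cases h : y = 1 ∨ y = 2
        · rw [if_pos h, if_pos (by omega)]; simp
        · rw [if_neg h, if_neg (by omega)]; simp
      · obtain ⟨z', hz1, hz2, hz3, hz4⟩ := hf z hz' hz0
        rw [hy3, hz3, hb y' hy1 z' hz1]
        congr 1
        exact lensGram_flip hj hy0 hz0 hy4 hz4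
  obtain ⟨C, C', hC, hC', hCp⟩ := hB.exists_lens_bicolored hfg.abs
  refine ⟨f, C, C', hC, hC', hCp, hfg, ?_⟩
  have l2 : Loc P ((List.range (2 * k + 2)).map b)
      ((List.range' 1 (2 * k)).map b ++ [neg P u, b (2 * k + 1)]) := by
    rw [range_eq_lens]
    have h1 := hu1 [b (2 * k + 1)]
    have h2 := Loc.neg (P := P) ((List.range' 1 (2 * k)).map b) [b (2 * k + 1)] u
    simpa [neg] using h1.trans h2
  have hl := l1.trans l2
  have hW : (((List.range k).reverse.map lensBlock) ++ [[0], [2 * k + 1]]).Perm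
      ([2 * k + 1] :: [0] :: (List.range k).map lensBlock) := by
    have p1 : ((List.range k).reverse.map lensBlock).Perm ((List.range k).map lensBlock) :=
      (List.reverse_perm _).map _
    have p2 : ([[0], [2 * k + 1]] : List (List ℕ)).Perm [[2 * k + 1], [0]] := List.Perm.swap _ _ _
    exact List.perm_append_comm.trans (p2.append p1)
  have hflat : (((List.range k).reverse.map lensBlock) ++ [[0], [2 * k + 1]]).flatten.map f =
      (List.range' 1 (2 * k)).map b ++ [neg P u, b (2 * k + 1)] := by
    rw [List.flatten_append, List.map_append, map_flatten_reverse_lensBlock f2 f3]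
    simp [f0, f1]
  have hiC : Indep P (C ++ C') := by
    refine (hl.indep hi).perm ?_
    rw [← hflat]
    refine List.Perm.trans ?_ hCp.symm
    refine List.Perm.map f (hW.flatten.trans ?_)
    rw [range_eq_lens]
    have : ([2 * k + 1] ++ ([0] ++ List.range' 1 (2 * k))).Perm
        ([0] ++ List.range' 1 (2 * k) ++ [2 * k + 1]) := List.perm_append_comm
    simpa [flatten_lensBlock] using this
  have := (hB.lens_cyc hfg.abs hC hC' hiC hCp hW).loc
  rw [hflat] at this
  exact hl.trans this.symm

end Slide

end Carter

namespace Carter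

/-! ### Between lists of roots and diagrams -/

section Conversion

variable {ι M N : Type*} [AddCommGroup M] [Module ℝ M] [AddCommGroup N] [Module ℝ N]
  {P : RootPairing ι ℝ M N}

lemma even_length_of_bicolored {A A' : List ι} (hA : A.Pairwise P.IsOrthogonal)
    (hA' : A'.Pairwise P.IsOrthogonal) (v : Fin (A ++ A').length)
    (c : (diagram P (A ++ A')).Walk v v) : Even c.length := by
  have hcol : (diagram P (A ++ A')).Colorable 2 := by
    refine ⟨SimpleGraph.Coloring.mk (fun a => if a.1 < A.length then (0 : Fin 2) else 1) ?_⟩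
    rintro ⟨a, ha⟩ ⟨b, hb⟩ ⟨hne, hadj⟩ hab
    have hne' : a ≠ b := fun h => hne (Fin.ext h)
    simp only [List.get_eq_getElem] at hadj
    rw [List.length_append] at ha hb
    have hs : Std.Symm P.IsOrthogonal := ⟨fun _ _ h => h.symm⟩
    rw [List.pairwise_iff_getElem] at hA hA'
    by_cases h1 : a < A.length <;> by_cases h2 : b < A.length <;> simp [h1, h2] at hab
    · rw [List.getElem_append_left h1, List.getElem_append_left h2] at hadj
      rcases lt_or_gt_of_ne hne' with h | h
      · exact hadj (hA a b h1 h2 h)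
      · exact hadj (hA b a h2 h1 h).symm
    · rw [List.getElem_append_right (by omega), List.getElem_append_right (by omega)] at hadj
      rcases lt_or_gt_of_ne hne' with h | h
      · exact hadj (hA' _ _ (by omega) (by omega) (by omega))
      · exact hadj (hA' _ _ (by omega) (by omega) (by omega)).symm
  exact SimpleGraph.two_colorable_iff_forall_loop_even.1 hcol v c

/-- The two orthogonal blocks are a 2-colouring of the diagram, so the evenness of the cycles is
automatic. -/
lemma isCarter_of_bicolored {A A' : List ι} (hi : Indep P (A ++ A'))
    (hA : A.Pairwise P.IsOrthogonal) (hA' : A'.Pairwise P.IsOrthogonal) :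
    IsCarter P (A ++ A') where
  linearIndependent := hi
  even_cycles := by
    rintro n ⟨v, c, -, rfl⟩
    exact even_length_of_bicolored hA hA' v c
  bicolored := ⟨A, A', rfl, hA, hA'⟩

lemma perm_map_comp {n : ℕ} {ψ : ℕ → ℕ} (hψ : ∀ i < n, ψ i < n)
    (hinj : ∀ i < n, ∀ j < n, ψ i = ψ j → i = j) (f : ℕ → ι) :
    ((List.range n).map f).Perm ((List.range n).map fun i => f (ψ i)) := by
  have h1 : ((List.range n).map ψ).Perm (List.range n) := by
    refine List.Subperm.perm_of_length_le (List.subperm_of_subset ?_ ?_) (by simp)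
    · refine List.Nodup.map_on ?_ List.nodup_range
      intro i hi j hj h
      exact hinj i (List.mem_range.1 hi) j (List.mem_range.1 hj) h
    · intro y hy
      obtain ⟨i, hi, rfl⟩ := List.mem_map.1 hy
      exact List.mem_range.2 (hψ i (List.mem_range.1 hi))
  have h2 := (h1.map f).symm
  rwa [List.map_map] at h2

lemma HasShape.exists_seq {n : ℕ} {Ω : List ι} {G : SimpleGraph (Fin n)}
    (h : HasShape P Ω G) (hn : 0 < n) : ∃ f : ℕ → ι, Ω.Perm ((List.range n).map f) ∧
      ∀ i j, i < n → j < n → i ≠ j → ∀ (hi : i < n) (hj : j < n),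
        (G.Adj ⟨i, hi⟩ ⟨j, hj⟩ → |P.pairing (f i) (f j)| = 1) ∧
        (¬ G.Adj ⟨i, hi⟩ ⟨j, hj⟩ → P.pairing (f i) (f j) = 0) := by
  obtain ⟨e, he⟩ := h
  set f : ℕ → ι := fun i => if h : i < n then Ω.get (e ⟨i, h⟩) else Ω.get (e ⟨0, hn⟩)
  have hf : ∀ i (hi : i < n), f i = Ω.get (e ⟨i, hi⟩) := fun i hi => dif_pos hi
  refine ⟨f, ?_, fun i j _ _ hij hi hj => ?_⟩
  · have h1 : (List.range n).map f = (List.finRange n).map fun u => Ω.get (e u) := by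
      rw [← List.map_coe_finRange_eq_range, List.map_map]
      exact List.map_congr_left fun u _ => hf u.1 u.2
    have h2 : Ω = (List.finRange Ω.length).map Ω.get := by simp
    have h3 : (List.finRange n).map (fun u => Ω.get (e u)) = ((List.finRange n).map e).map Ω.get := by
      rw [List.map_map]; rfl
    rw [h1, h3]
    conv_lhs => rw [h2]
    refine List.Perm.map _ ?_
    rw [List.perm_ext_iff_of_nodup (List.nodup_finRange _)
      ((List.nodup_finRange _).map e.injective)]
    intro a
    simpa using ⟨e.symm a, by simp⟩
  · rw [hf i hi, hf j hj]
    exact he _ _ (fun h => hij (by simpa using congrArg Fin.val h))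

lemma hasDiagram_of_seq {n : ℕ} {Ω : List ι} {D : SignedDiagram (Fin n)} {f : ℕ → ι}
    (hnd : Ω.Nodup) (hp : Ω.Perm ((List.range n).map f))
    (h : ∀ i j : Fin n, i ≠ j → (D.solid.Adj i j → P.pairing (f i) (f j) = -1) ∧
      (D.dotted.Adj i j → P.pairing (f i) (f j) = 1) ∧
      (¬ D.underlying.Adj i j → P.pairing (f i) (f j) = 0)) : HasDiagram P Ω D := by
  classical
  have hmem : ∀ i : Fin n, f i ∈ Ω := fun i =>
    hp.mem_iff.2 (List.mem_map.2 ⟨i, List.mem_range.2 i.2, rfl⟩)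
  set e₀ : Fin n → Fin Ω.length := fun i => ⟨Ω.idxOf (f i), List.idxOf_lt_length_of_mem (hmem i)⟩
  have he₀ : ∀ i, Ω.get (e₀ i) = f i := fun i => by simp [e₀]
  have hinj : Function.Injective e₀ := by
    intro i j hij
    have h1 : f i = f j := by rw [← he₀ i, ← he₀ j, hij]
    exact Fin.ext (List.inj_on_of_nodup_map (hp.nodup_iff.1 hnd) (List.mem_range.2 i.2)
      (List.mem_range.2 j.2) h1)
  have hbij : Function.Bijective e₀ := by
    rw [Fintype.bijective_iff_injective_and_card]
    refine ⟨hinj, ?_⟩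
    rw [Fintype.card_fin, Fintype.card_fin, hp.length_eq]
    simp
  refine ⟨Equiv.ofBijective e₀ hbij, fun u v huv => ?_⟩
  rw [Equiv.ofBijective_apply, Equiv.ofBijective_apply, he₀, he₀]
  exact h u v huv

end Conversion

end Carter

namespace Carter

/-! ### The pure cycle and the square with two paths as lens figures -/

section LensDiagrams

variable {ι M N : Type*} [AddCommGroup M] [Module ℝ M] [AddCommGroup N] [Module ℝ N]
  {P : RootPairing ι ℝ M N}

lemma abs_lensGram {k j y z : ℕ} (hyz : y ≠ z) (h : lensGram k j y z ≠ 0) :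
    |(lensGram k j y z : ℝ)| = 1 := by
  have : |lensGram k j y z| = 1 := by
    unfold lensGram at h ⊢
    rw [if_neg hyz] at h ⊢
    split_ifs <;> simp_all
  exact_mod_cast this

lemma HasShape.exists_lens {k j : ℕ} {Ω : List ι} {G : SimpleGraph (Fin (2 * k + 2))}
    (h : HasShape P Ω G) {ψ : ℕ → ℕ} (hψ : ∀ i < 2 * k + 2, ψ i < 2 * k + 2)
    (hinj : ∀ i < 2 * k + 2, ∀ j < 2 * k + 2, ψ i = ψ j → i = j)
    (hadj : ∀ y z (hy : y < 2 * k + 2) (hz : z < 2 * k + 2), y ≠ z →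
      (G.Adj ⟨ψ y, hψ y hy⟩ ⟨ψ z, hψ z hz⟩ ↔ lensGram k j y z ≠ 0)) :
    ∃ a, Ω.Perm ((List.range (2 * k + 2)).map a) ∧ HasAbsGram P (2 * k + 2) (lensGram k j) a := by
  obtain ⟨f, hf, hf2⟩ := h.exists_seq (by omega)
  refine ⟨fun y => f (ψ y), hf.trans (perm_map_comp hψ hinj f), fun y hy z hz => ?_⟩
  by_cases hyz : y = z
  · rw [hyz, P.pairing_same]; simp [lensGram]
  have h1 := hf2 (ψ y) (ψ z) (hψ y hy) (hψ z hz) (fun h => hyz (hinj y hy z hz h)) (hψ y hy) (hψ z hz)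
  rw [hadj y z hy hz hyz] at h1
  by_cases h0 : lensGram k j y z = 0
  · rw [h1.2 (by simpa using h0), h0]; simp
  · rw [h1.1 h0, abs_lensGram hyz h0]

lemma HasGram.hasDiagram_of_lens {k j : ℕ} {Ω : List ι} {D : SignedDiagram (Fin (2 * k + 2))}
    {f : ℕ → ι} (hg : HasGram P (2 * k + 2) (lensGram k j) f) (hnd : Ω.Nodup)
    (hp : Ω.Perm ((List.range (2 * k + 2)).map f)) {φ : ℕ → ℕ}
    (hφ : ∀ i < 2 * k + 2, φ i < 2 * k + 2)
    (hinj : ∀ i < 2 * k + 2, ∀ j < 2 * k + 2, φ i = φ j → i = j)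
    (hD : ∀ u v : Fin (2 * k + 2), u ≠ v →
      (D.solid.Adj u v → lensGram k j (φ u) (φ v) = -1) ∧
      (D.dotted.Adj u v → lensGram k j (φ u) (φ v) = 1) ∧
      (lensGram k j (φ u) (φ v) ≠ 0 → D.underlying.Adj u v)) : HasDiagram P Ω D := by
  refine hasDiagram_of_seq (f := fun i => f (φ i)) hnd (hp.trans (perm_map_comp hφ hinj f))
    fun u v huv => ?_
  obtain ⟨h1, h2, h3⟩ := hD u v huv
  rw [hg _ (hφ u u.2) _ (hφ v v.2)]
  refine ⟨fun h => by rw [h1 h]; simp, fun h => by rw [h2 h]; simp, fun h => ?_⟩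
  have : lensGram k j (φ u) (φ v) = 0 := by
    by_contra h'
    exact h (h3 h')
  rw [this]; simp

lemma lensGram_eq_neg_one {k j y z : ℕ} (hj : j < k)
    (h : ((z = y + 2 ∨ y = z + 2 ∨ (y = 0 ∧ z = 1) ∨ (y = 1 ∧ z = 0)) ∧ y ≤ 2 * k ∧ z ≤ 2 * k) ∨
      (y = 2 * k + 1 ∧ z = 2 + 2 * j) ∨ (z = 2 * k + 1 ∧ y = 2 + 2 * j)) :
    lensGram k j y z = -1 := by
  unfold lensGram
  rcases h with h | h
  · rw [if_neg (by omega), if_pos h]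
  · rw [if_neg (by omega), if_neg (by omega), if_neg (by omega), if_pos h]

lemma lensGram_eq_one {k j y z : ℕ} (hj : j < k)
    (h : (y = 2 * k + 1 ∧ z = 1 + 2 * j) ∨ (z = 2 * k + 1 ∧ y = 1 + 2 * j)) :
    lensGram k j y z = 1 := by
  unfold lensGram
  rw [if_neg (by omega), if_neg (by omega), if_pos h]

/-- The vertices of the cycle, in the order of their distances from the vertex `k + 1`. -/
def cycleOfLens (k y : ℕ) : ℕ :=
  if y = 2 * k + 1 then 0 else if y % 2 = 1 then k + 2 + y / 2 else k + 1 - y / 2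

/-- The inverse of `cycleOfLens`. -/
def lensOfCycle (k i : ℕ) : ℕ :=
  if i = 0 then 2 * k + 1 else if i ≤ k + 1 then 2 * (k + 1 - i) else 1 + 2 * (i - (k + 2))

/-- The vertices of the diagram `D_l(a_k)`, in the order of their distances from the vertex `k`. -/
def squareOfLens (k y : ℕ) : ℕ :=
  if y = 2 * k + 1 then 2 * k + 1 else if y % 2 = 1 then k - 1 - y / 2 else k + y / 2

/-- The inverse of `squareOfLens`. -/
def lensOfSquare (k i : ℕ) : ℕ :=
  if i = 2 * k + 1 then 2 * k + 1 else if i < k then 1 + 2 * (k - 1 - i) else 2 * (i - k)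

lemma cycleOfLens_spec {k y : ℕ} (hy : y < 2 * k + 2) :
    (y = 2 * k + 1 ∧ cycleOfLens k y = 0) ∨
      (∃ t < k, y = 1 + 2 * t ∧ cycleOfLens k y = k + 2 + t) ∨
      (∃ t ≤ k, y = 2 * t ∧ cycleOfLens k y + t = k + 1) := by
  unfold cycleOfLens
  split_ifs with h1 h2
  · exact .inl ⟨h1, rfl⟩
  · exact .inr (.inl ⟨y / 2, by omega, by omega, rfl⟩)
  · exact .inr (.inr ⟨y / 2, by omega, by omega, by omega⟩)

lemma lensOfCycle_spec {k i : ℕ} (hi : i < 2 * k + 2) :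
    (i = 0 ∧ lensOfCycle k i = 2 * k + 1) ∨
      (1 ≤ i ∧ i ≤ k + 1 ∧ lensOfCycle k i + 2 * i = 2 * k + 2) ∨
      (k + 2 ≤ i ∧ i < 2 * k + 2 ∧ lensOfCycle k i + 2 * k + 3 = 2 * i) := by
  unfold lensOfCycle
  split_ifs <;> omega

lemma squareOfLens_spec {k y : ℕ} (hy : y < 2 * k + 2) :
    (y = 2 * k + 1 ∧ squareOfLens k y = 2 * k + 1) ∨
      (∃ t < k, y = 1 + 2 * t ∧ squareOfLens k y + t + 1 = k) ∨
      (∃ t ≤ k, y = 2 * t ∧ squareOfLens k y = k + t) := by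
  unfold squareOfLens
  split_ifs with h1 h2
  · exact .inl ⟨h1, rfl⟩
  · exact .inr (.inl ⟨y / 2, by omega, by omega, by omega⟩)
  · exact .inr (.inr ⟨y / 2, by omega, by omega, by omega⟩)

lemma lensOfSquare_spec {k i : ℕ} (hi : i < 2 * k + 2) :
    (i = 2 * k + 1 ∧ lensOfSquare k i = 2 * k + 1) ∨
      (i < k ∧ lensOfSquare k i + 2 * i + 1 = 2 * k) ∨
      (k ≤ i ∧ i ≤ 2 * k ∧ lensOfSquare k i + 2 * k = 2 * i) := by
  unfold lensOfSquare
  split_ifs <;> omega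

set_option maxHeartbeats 1000000 in
lemma cycleOfLens_adj {k j : ℕ} (hj : j + 1 = k) (hj0 : 0 < j) {y z : ℕ} (hy : y < 2 * k + 2)
    (hz : z < 2 * k + 2) (hyz : y ≠ z) :
    CycAdj (2 * k + 2) (cycleOfLens k y) (cycleOfLens k z) ↔ lensGram k j y z ≠ 0 := by
  rw [lensGram_zero_iff]
  unfold CycAdj
  rcases cycleOfLens_spec hy with ⟨rfl, h⟩ | ⟨s, hs, rfl, h⟩ | ⟨s, hs, rfl, h⟩ <;>
    rcases cycleOfLens_spec hz with ⟨rfl, h'⟩ | ⟨t, ht, rfl, h'⟩ | ⟨t, ht, rfl, h'⟩ <;>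
    constructor
  all_goals rintro (h1 | h1 | h1 | h1) <;> omega

lemma cycleOfLens_lt {k y : ℕ} (hy : y < 2 * k + 2) : cycleOfLens k y < 2 * k + 2 := by
  rcases cycleOfLens_spec hy with h | ⟨s, hs, h, h1⟩ | ⟨s, hs, h, h1⟩ <;> omega

lemma cycleOfLens_inj {k y z : ℕ} (hy : y < 2 * k + 2) (hz : z < 2 * k + 2)
    (h : cycleOfLens k y = cycleOfLens k z) : y = z := by
  rcases cycleOfLens_spec hy with h1 | ⟨s, hs, h1⟩ | ⟨s, hs, h1⟩ <;>
    rcases cycleOfLens_spec hz with h2 | ⟨t, ht, h2⟩ | ⟨t, ht, h2⟩ <;> omega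

lemma squareOfLens_lt {k y : ℕ} (hy : y < 2 * k + 2) : squareOfLens k y < 2 * k + 2 := by
  rcases squareOfLens_spec hy with h | ⟨s, hs, h, h1⟩ | ⟨s, hs, h, h1⟩ <;> omega

lemma squareOfLens_inj {k y z : ℕ} (hy : y < 2 * k + 2) (hz : z < 2 * k + 2)
    (h : squareOfLens k y = squareOfLens k z) : y = z := by
  rcases squareOfLens_spec hy with h1 | ⟨s, hs, h1⟩ | ⟨s, hs, h1⟩ <;>
    rcases squareOfLens_spec hz with h2 | ⟨t, ht, h2⟩ | ⟨t, ht, h2⟩ <;> omega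

lemma pureCycle_adj {l : ℕ} {u v : Fin l} (huv : u ≠ v) :
    (pureCycle l).underlying.Adj u v ↔ CycAdj l u v := by
  have : (u : ℕ) ≠ v := fun h => huv (Fin.ext h)
  simp only [SignedDiagram.underlying, pureCycle, SimpleGraph.sup_adj, SimpleGraph.fromRel_adj,
    CycAdj]
  have := u.2
  have := v.2
  simp only [ne_eq, huv, not_false_iff, true_and]
  omega

lemma diagramDa_adj {k : ℕ} {u v : Fin (2 * k + 2)} (huv : u ≠ v) :
    (diagramDa (2 * k + 2) k).underlying.Adj u v ↔
      (((u : ℕ) + 1 = v ∧ (v : ℕ) < 2 * k + 1) ∨ ((v : ℕ) + 1 = u ∧ (u : ℕ) < 2 * k + 1) ∨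
        ((u : ℕ) = 2 * k + 1 ∧ ((v : ℕ) + 1 = k ∨ (v : ℕ) = k + 1)) ∨
        ((v : ℕ) = 2 * k + 1 ∧ ((u : ℕ) + 1 = k ∨ (u : ℕ) = k + 1))) := by
  have : (u : ℕ) ≠ v := fun h => huv (Fin.ext h)
  simp only [SignedDiagram.underlying, diagramDa, SimpleGraph.sup_adj, SimpleGraph.fromRel_adj]
  have := u.2
  have := v.2
  simp only [ne_eq, huv, not_false_iff, true_and]
  omega

lemma HasShape.exists_lens_of_pureCycle {k j : ℕ} (hj : j + 1 = k) (hj0 : 0 < j) {Ω : List ι}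
    (h : HasShape P Ω (pureCycle (2 * k + 2)).underlying) :
    ∃ a, Ω.Perm ((List.range (2 * k + 2)).map a) ∧
      HasAbsGram P (2 * k + 2) (lensGram k j) a := by
  refine h.exists_lens (ψ := cycleOfLens k) (fun _ => cycleOfLens_lt)
    (fun _ hy _ hz => cycleOfLens_inj hy hz) fun y z hy hz hyz => ?_
  rw [pureCycle_adj (fun h => hyz (cycleOfLens_inj hy hz (by simpa using h)))]
  exact cycleOfLens_adj hj hj0 hy hz hyz

set_option maxHeartbeats 1000000 in
lemma HasShape.exists_lens_of_diagramDa {k : ℕ} (hk : 2 ≤ k) {Ω : List ι}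
    (h : HasShape P Ω (diagramDa (2 * k + 2) k).underlying) :
    ∃ a, Ω.Perm ((List.range (2 * k + 2)).map a) ∧
      HasAbsGram P (2 * k + 2) (lensGram k 0) a := by
  refine h.exists_lens (ψ := squareOfLens k) (fun _ => squareOfLens_lt)
    (fun _ hy _ hz => squareOfLens_inj hy hz) fun y z hy hz hyz => ?_
  rw [diagramDa_adj (fun h => hyz (squareOfLens_inj hy hz (by simpa using h))), lensGram_zero_iff]
  simp only
  rcases squareOfLens_spec hy with ⟨rfl, h⟩ | ⟨s, hs, rfl, h⟩ | ⟨s, hs, rfl, h⟩ <;>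
    rcases squareOfLens_spec hz with ⟨rfl, h'⟩ | ⟨t, ht, rfl, h'⟩ | ⟨t, ht, rfl, h'⟩ <;>
    constructor
  all_goals first
    | (rintro (h1 | h1 | ⟨h1, h2 | h2⟩ | ⟨h1, h2 | h2⟩) <;> omega)
    | (rintro (h1 | ⟨h1 | h1 | h1 | h1, h2, h3⟩ | h1 | h1 | h1 | h1) <;> omega)

lemma HasGram.hasDiagram_pureCycle {k j : ℕ} (hj : j + 1 = k) {Ω : List ι} {f : ℕ → ι}
    (hg : HasGram P (2 * k + 2) (lensGram k j) f) (hnd : Ω.Nodup)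
    (hp : Ω.Perm ((List.range (2 * k + 2)).map f)) : HasDiagram P Ω (pureCycle (2 * k + 2)) := by
  refine hg.hasDiagram_of_lens hnd hp (φ := lensOfCycle k) (fun i hi => ?_) (fun i hi j hj h => ?_)
    fun u v huv => ?_
  · have := lensOfCycle_spec hi; omega
  · have := lensOfCycle_spec hi
    have := lensOfCycle_spec hj
    omega
  · have hu := lensOfCycle_spec u.2
    have hv := lensOfCycle_spec v.2
    have hne : (u : ℕ) ≠ v := fun h => huv (Fin.ext h)
    rw [pureCycle_adj huv]
    simp only [pureCycle, SimpleGraph.fromRel_adj, CycAdj]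
    generalize lensOfCycle k u = y at *
    generalize lensOfCycle k v = z at *
    generalize (u : ℕ) = s at *
    generalize (v : ℕ) = t at *
    refine ⟨fun h => lensGram_eq_neg_one (by omega) ?_, fun h => lensGram_eq_one (by omega) ?_,
      fun h => ?_⟩
    · replace h := h.2
      rcases hu with hu | hu | hu <;> rcases hv with hv | hv | hv <;> omega
    · replace h := h.2
      omega
    · rw [lensGram_zero_iff] at h
      rcases hu with hu | hu | hu <;> rcases hv with hv | hv | hv <;> omega

lemma HasGram.hasDiagram_diagramDa {k : ℕ} (hk : 2 ≤ k) {Ω : List ι} {f : ℕ → ι}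
    (hg : HasGram P (2 * k + 2) (lensGram k 0) f) (hnd : Ω.Nodup)
    (hp : Ω.Perm ((List.range (2 * k + 2)).map f)) : HasDiagram P Ω (diagramDa (2 * k + 2) k) := by
  refine hg.hasDiagram_of_lens hnd hp (φ := lensOfSquare k) (fun i hi => ?_) (fun i hi j hj h => ?_)
    fun u v huv => ?_
  · have := lensOfSquare_spec hi; omega
  · have := lensOfSquare_spec hi
    have := lensOfSquare_spec hj
    omega
  · have hu := lensOfSquare_spec u.2
    have hv := lensOfSquare_spec v.2
    have hne : (u : ℕ) ≠ v := fun h => huv (Fin.ext h)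
    rw [diagramDa_adj huv]
    simp only [diagramDa, SimpleGraph.fromRel_adj]
    generalize lensOfSquare k u = y at *
    generalize lensOfSquare k v = z at *
    generalize (u : ℕ) = s at *
    generalize (v : ℕ) = t at *
    refine ⟨fun h => lensGram_eq_neg_one (by omega) ?_, fun h => lensGram_eq_one (by omega) ?_,
      fun h => ?_⟩
    · replace h := h.2
      rcases hu with hu | hu | hu <;> rcases hv with hv | hv | hv <;> omega
    · replace h := h.2
      omega
    · rw [lensGram_zero_iff] at h
      rcases hu with hu | hu | hu <;> rcases hv with hv | hv | hv <;> omega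

/-- The pure cycle and the square with two paths attached to opposite vertices are equivalent. -/
theorem diagramsEquivalent_pureCycle_diagramDa [Finite ι] (P : RootPairing ι ℝ M N)
    [P.IsRootSystem] [P.IsCrystallographic] {k : ℕ} (hk : 2 ≤ k) :
    DiagramsEquivalent P (pureCycle (2 * k + 2)) (diagramDa (2 * k + 2) k) := by
  obtain ⟨B, hB⟩ := exists_isForm P
  constructor
  · rintro Ω ⟨hi, -, A, A', rfl, hA, hA'⟩ hΩ
    obtain ⟨a, ha, hg⟩ := hΩ.exists_lens_of_pureCycle (j := k - 1) (by omega) (by omega)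
    obtain ⟨f, C, C', hC, hC', hp, hfg, hl⟩ := hB.lens_flip (by omega) hA hA' hi ha hg
    rw [show k - 1 - (k - 1) = 0 by omega] at hfg
    have hiC := hl.indep hi
    exact ⟨C ++ C', isCarter_of_bicolored hiC hC hC', hfg.hasDiagram_diagramDa hk hiC.nodup hp,
      hl.equivalent⟩
  · rintro Ω ⟨hi, -, A, A', rfl, hA, hA'⟩ hΩ
    obtain ⟨a, ha, hg⟩ := hΩ.exists_lens_of_diagramDa hk
    obtain ⟨f, C, C', hC, hC', hp, hfg, hl⟩ := hB.lens_flip (by omega) hA hA' hi ha hg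
    have hiC := hl.indep hi
    exact ⟨C ++ C', isCarter_of_bicolored hiC hC hC',
      hfg.hasDiagram_pureCycle (by omega) hiC.nodup hp, hl.equivalent⟩

end LensDiagrams

end Carter

namespace Carter

/-! ### Moves computed in integral coordinates -/

section Machine

variable {ι M N : Type*} [AddCommGroup M] [Module ℝ M] [AddCommGroup N] [Module ℝ N]
  {P : RootPairing ι ℝ M N}

/-- An elementary transformation of a list at a given place. -/
inductive Move
  | left (k : ℕ)
  | right (k : ℕ)
  | neg (k : ℕ)
  | rot

/-- The value of a bilinear form with Gram matrix `g` at two vectors of coordinates. -/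
def gramForm (g : ℕ → ℕ → ℤ) (d : ℕ) (v w : List ℤ) : ℤ :=
  ((List.range d).map fun i => ((List.range d).map fun j =>
    v.getD i 0 * g i j * w.getD j 0).sum).sum

/-- The reflection in the vector `v`, in coordinates. -/
def gramReflect (g : ℕ → ℕ → ℤ) (d : ℕ) (v w : List ℤ) : List ℤ :=
  (List.range d).map fun i => w.getD i 0 - gramForm g d w v * v.getD i 0

/-- The action of an elementary transformation on a list of vectors of coordinates. -/
def Move.act (g : ℕ → ℕ → ℤ) (d : ℕ) : Move → List (List ℤ) → List (List ℤ)
  | left 0, v :: w :: L => gramReflect g d v w :: v :: L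
  | left (k + 1), v :: L => v :: (left k).act g d L
  | right 0, v :: w :: L => w :: gramReflect g d w v :: L
  | right (k + 1), v :: L => v :: (right k).act g d L
  | neg 0, v :: L => gramReflect g d v v :: L
  | neg (k + 1), v :: L => v :: (neg k).act g d L
  | rot, v :: L => L ++ [v]
  | _, L => L

/-- The result of a sequence of elementary transformations of a list of vectors of coordinates. -/
def runMoves (g : ℕ → ℕ → ℤ) (d : ℕ) (ms : List Move) (L : List (List ℤ)) : List (List ℤ) :=
  ms.foldl (fun L m => m.act g d L) L

/-- The unit vectors of coordinates with the indices in the list. -/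
def unitVectors (d : ℕ) (s : List ℕ) : List (List ℤ) :=
  s.map fun k => (List.range d).map fun i => if i = k then 1 else 0

/-- The vector of coordinates represents the root. -/
structure Represents (P : RootPairing ι ℝ M N) (d : ℕ) (f : ℕ → ι) (v : List ℤ) (i : ι) : Prop where
  root : P.root i = ∑ k ∈ Finset.range d, (v.getD k 0 : ℝ) • P.root (f k)
  coroot : P.coroot i = ∑ k ∈ Finset.range d, (v.getD k 0 : ℝ) • P.coroot (f k)

variable {d : ℕ} {g : ℕ → ℕ → ℤ} {f : ℕ → ι}

lemma sum_map_range {A : Type*} [AddCommMonoid A] (d : ℕ) (h : ℕ → A) :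
    ((List.range d).map h).sum = ∑ i ∈ Finset.range d, h i := by
  simp [Finset.sum, Multiset.range]

lemma gramForm_eq (v w : List ℤ) : gramForm g d v w =
    ∑ i ∈ Finset.range d, ∑ j ∈ Finset.range d, v.getD i 0 * g i j * w.getD j 0 := by
  simp only [gramForm, sum_map_range]

lemma gramForm_comm (hcomm : ∀ y z, g y z = g z y) (v w : List ℤ) :
    gramForm g d v w = gramForm g d w v := by
  rw [gramForm_eq, gramForm_eq, Finset.sum_comm]
  exact Finset.sum_congr rfl fun i _ => Finset.sum_congr rfl fun j _ => by rw [hcomm j i]; ring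

lemma Represents.pairing (hg : HasGram P d g f) {v w : List ℤ} {i j : ι}
    (hv : Represents P d f v i) (hw : Represents P d f w j) :
    P.pairing i j = gramForm g d v w := by
  rw [← P.root_coroot_eq_pairing, hv.root, hw.coroot, gramForm_eq, map_sum, Finset.sum_comm]
  push_cast
  refine Finset.sum_congr rfl fun l hl => ?_
  rw [map_sum, LinearMap.sum_apply]
  refine Finset.sum_congr rfl fun k hk => ?_
  have h5 := hg k (Finset.mem_range.mp hk) l (Finset.mem_range.mp hl)
  rw [← P.root_coroot_eq_pairing] at h5
  simp only [map_smul, LinearMap.smul_apply, smul_eq_mul, h5]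
  ring

/-- As the matrix is symmetric, roots and coroots are reflected by the same formula, and one list of
integers describes both. -/
lemma Represents.reflect (hg : HasGram P d g f) (hcomm : ∀ y z, g y z = g z y) {v w : List ℤ}
    {i j : ι} (hv : Represents P d f v i) (hw : Represents P d f w j) :
    Represents P d f (gramReflect g d v w) (P.reflectionPerm i j) := by
  have h1 := hw.pairing hg hv
  have h2 := hv.pairing hg hw
  rw [gramForm_comm hcomm] at h2
  have hget : ∀ k ∈ Finset.range d, ((gramReflect g d v w).getD k 0 : ℝ) =
      w.getD k 0 - gramForm g d w v * v.getD k 0 := by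
    intro k hk
    rw [Finset.mem_range] at hk
    have : (gramReflect g d v w).getD k 0 = w.getD k 0 - gramForm g d w v * v.getD k 0 := by
      simp [gramReflect, List.getD, hk]
    rw [this]; push_cast; rfl
  constructor
  · rw [P.root_reflectionPerm, P.reflection_apply_root, h1, hw.root, hv.root, Finset.smul_sum,
      ← Finset.sum_sub_distrib]
    exact Finset.sum_congr rfl fun k hk => by rw [hget k hk, sub_smul, mul_smul]
  · rw [P.coroot_reflectionPerm, P.coreflection_apply_coroot, h2, hw.coroot, hv.coroot,
      Finset.smul_sum, ← Finset.sum_sub_distrib]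
    exact Finset.sum_congr rfl fun k hk => by rw [hget k hk, sub_smul, mul_smul]

lemma Represents.unit (f : ℕ → ι) {k : ℕ} (hk : k < d) :
    Represents P d f ((List.range d).map fun i => if i = k then 1 else 0) (f k) := by
  have hget : ∀ i ∈ Finset.range d,
      ((((List.range d).map fun i => if i = k then (1 : ℤ) else 0).getD i 0 : ℤ) : ℝ) =
        if i = k then 1 else 0 := by
    intro i hi
    rw [Finset.mem_range] at hi
    simp [List.getD, hi]
  constructor <;>
  · rw [Finset.sum_congr rfl (fun i hi => by rw [hget i hi, ite_smul, one_smul, zero_smul])]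
    simp [hk]

lemma forall₂_unitVectors (f : ℕ → ι) {s : List ℕ} (hs : ∀ k ∈ s, k < d) :
    List.Forall₂ (Represents P d f) (unitVectors d s) (s.map f) := by
  induction s with
  | nil => exact List.Forall₂.nil
  | cons k s ih =>
    exact List.Forall₂.cons (Represents.unit f (hs k (by simp)))
      (ih fun k hk => hs k (by simp [hk]))

lemma Move.exists_act (hg : HasGram P d g f) (hcomm : ∀ y z, g y z = g z y) (m : Move)
    {L : List (List ℤ)} {Ω : List ι} (h : List.Forall₂ (Represents P d f) L Ω) :
    ∃ Ω', List.Forall₂ (Represents P d f) (m.act g d L) Ω' ∧ Loc P Ω Ω' := by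
  -- A move at depth `k` is treated by recursion behind a growing prefix `S`. A rotation involves
  -- the whole list and is handled separately.
  have key : ∀ m : Move, m ≠ .rot → ∀ {L : List (List ℤ)} {Ω : List ι},
      List.Forall₂ (Represents P d f) L Ω → ∀ S : List ι,
      ∃ Ω', List.Forall₂ (Represents P d f) (m.act g d L) Ω' ∧ Loc P (S ++ Ω) (S ++ Ω') := by
    intro m hm L
    induction m, L using Move.act.induct with
    | case1 v w L =>
      intro Ω h S
      obtain _ | ⟨hv, _ | ⟨hw, hL⟩⟩ := h
      exact ⟨_, .cons (hv.reflect hg hcomm hw) (.cons hv hL), Loc.hurwitz ..⟩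
    | case2 k v L ih =>
      intro Ω h S
      obtain _ | ⟨hv, hL⟩ := h
      rename_i i Ω
      obtain ⟨Ω', h1, h2⟩ := ih (by simp) hL (S ++ [i])
      exact ⟨i :: Ω', .cons hv h1, by simpa using h2⟩
    | case3 v w L =>
      intro Ω h S
      obtain _ | ⟨hv, _ | ⟨hw, hL⟩⟩ := h
      exact ⟨_, .cons hw (.cons (hw.reflect hg hcomm hv) hL), Loc.permRight ..⟩
    | case4 k v L ih =>
      intro Ω h S
      obtain _ | ⟨hv, hL⟩ := h
      rename_i i Ω
      obtain ⟨Ω', h1, h2⟩ := ih (by simp) hL (S ++ [i])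
      exact ⟨i :: Ω', .cons hv h1, by simpa using h2⟩
    | case5 v L =>
      intro Ω h S
      obtain _ | ⟨hv, hL⟩ := h
      exact ⟨_, .cons (hv.reflect hg hcomm hv) hL, Loc.neg ..⟩
    | case6 k v L ih =>
      intro Ω h S
      obtain _ | ⟨hv, hL⟩ := h
      rename_i i Ω
      obtain ⟨Ω', h1, h2⟩ := ih (by simp) hL (S ++ [i])
      exact ⟨i :: Ω', .cons hv h1, by simpa using h2⟩
    | case7 v L => exact absurd rfl hm
    | case8 m L => 
      intro Ω h S
      refine ⟨Ω, ?_, Loc.refl _⟩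
      rw [Move.act] <;> assumption
  cases m with
  | rot =>
    cases h with
    | nil => exact ⟨[], by simp [Move.act], Loc.refl _⟩
    | cons hv hL =>
      exact ⟨_, by rw [Move.act]; exact List.rel_append hL (.cons hv .nil), Loc.rot _ _⟩
  | left k => simpa using key _ (by simp) h []
  | right k => simpa using key _ (by simp) h []
  | neg k => simpa using key _ (by simp) h []

lemma exists_runMoves (hg : HasGram P d g f) (hcomm : ∀ y z, g y z = g z y) (ms : List Move)
    {L : List (List ℤ)} {Ω : List ι} (h : List.Forall₂ (Represents P d f) L Ω) :
    ∃ Ω', List.Forall₂ (Represents P d f) (runMoves g d ms L) Ω' ∧ Loc P Ω Ω' := by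
  induction ms generalizing L Ω with
  | nil => exact ⟨Ω, h, Loc.refl _⟩
  | cons m ms ih =>
    obtain ⟨Ω₁, h1, l1⟩ := m.exists_act hg hcomm h
    obtain ⟨Ω', h2, l2⟩ := ih h1
    exact ⟨Ω', h2, l1.trans l2⟩

/-- Elementary transformations of a list of roots with a known Gram matrix: the Gram matrix of the
outcome is computed in coordinates. -/
theorem HasGram.exists_loc (hg : HasGram P d g f) (hcomm : ∀ y z, g y z = g z y) (ms : List Move)
    {s : List ℕ} (hs : ∀ k ∈ s, k < d) :
    ∃ Ω', Loc P (s.map f) Ω' ∧ ∃ f' : ℕ → ι, Ω' = (List.range s.length).map f' ∧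
      HasGram P s.length (fun y z => gramForm g d ((runMoves g d ms (unitVectors d s)).getD y [])
        ((runMoves g d ms (unitVectors d s)).getD z [])) f' := by
  obtain ⟨Ω', h, hl⟩ := exists_runMoves hg hcomm ms (forall₂_unitVectors (P := P) f hs)
  have hlen : Ω'.length = s.length := by rw [← hl.length_eq, List.length_map]
  have hlen' := h.length_eq
  refine ⟨Ω', hl, fun i => if h : i < Ω'.length then Ω'[i] else f 0, ?_, ?_⟩
  · rw [← hlen]
    refine List.ext_getElem (by simp) fun i h1 h2 => ?_
    simp [h1]
  · intro y hy z hz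
    rw [← hlen] at hy hz
    have hrep : ∀ y (hy : y < Ω'.length), Represents P d f
        ((runMoves g d ms (unitVectors d s)).getD y []) Ω'[y] := by
      intro y hy
      rw [List.getD_eq_getElem _ _ (hlen' ▸ hy)]
      exact h.get (hlen' ▸ hy) hy
    simp only [hy, hz, dif_pos]
    exact (hrep y hy).pairing hg (hrep z hz)

end Machine

end Carter

namespace Carter

/-! ### Decidable certificates for transformations -/

section Certificates

instance decidableWordsCommute {τ : Type*} (R : τ → τ → Prop) [DecidableRel R] (U V : List τ) :
    Decidable (WordsCommute R U V) :=
  inferInstanceAs (Decidable (∀ u ∈ U, ∀ v ∈ V, R u v))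

instance decidableIsForest {τ : Type*} (R : τ → τ → Prop) [DecidableRel R] :
    DecidablePred (IsForest R)
  | [] => isTrue trivial
  | v :: L =>
    have := decidableIsForest R L
    inferInstanceAs (Decidable (L.Pairwise (fun a b => R v a ∨ R v b) ∧ IsForest R L))

lemma IsForest.map {τ σ : Type*} {R : τ → τ → Prop} {R' : σ → σ → Prop} {φ : τ → σ} {L : List τ}
    (h : IsForest R L) (hR : ∀ a ∈ L, ∀ b ∈ L, R a b → R' (φ a) (φ b)) :
    IsForest R' (L.map φ) := by
  induction L with
  | nil => trivial
  | cons v L ih =>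
    refine ⟨?_, ih h.2 fun a ha b hb => hR a (by simp [ha]) b (by simp [hb])⟩
    rw [List.pairwise_map]
    refine h.1.imp_of_mem fun ha hb hab => ?_
    exact hab.imp (hR v (by simp) _ (by simp [ha])) (hR v (by simp) _ (by simp [hb]))

/-- The symmetric matrix with diagonal entries `2` and with the given entries at the edges. -/
def edgeGram (E : List (ℕ × ℕ × ℤ)) (y z : ℕ) : ℤ :=
  if y = z then 2 else
    ((E.find? fun e => (e.1 == y && e.2.1 == z) || (e.1 == z && e.2.1 == y)).map
      fun e => e.2.2).getD 0

lemma edgeGram_comm (E : List (ℕ × ℕ × ℤ)) (y z : ℕ) : edgeGram E y z = edgeGram E z y := by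
  unfold edgeGram
  refine if_congr eq_comm rfl ?_
  congr 3
  funext e
  exact Bool.or_comm _ _

/-- The words form a forest with respect to the matrix, and each of them is of one colour in the
connected diagram of the matrix. -/
def IsArrangement (d : ℕ) (g : ℕ → ℕ → ℤ) (par : ℕ → ℕ) (col : ℕ → Bool) (W : List (List ℕ)) : Prop :=
  (∀ y < d, y ≠ 0 → par y < y ∧ g y (par y) ≠ 0 ∧ col y ≠ col (par y)) ∧
  W.flatten.Perm (List.range d) ∧
  IsForest (WordsCommute fun y z => g y z = 0) W ∧
  ∀ U ∈ W, ∀ y ∈ U, ∀ z ∈ U, col y = col z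

instance (d : ℕ) (g : ℕ → ℕ → ℤ) (par : ℕ → ℕ) (col : ℕ → Bool) (W : List (List ℕ)) :
    Decidable (IsArrangement d g par col W) := by
  unfold IsArrangement; infer_instance

variable {ι M N : Type*} [AddCommGroup M] [Module ℝ M] [AddCommGroup N] [Module ℝ N]
  {P : RootPairing ι ℝ M N} {B : LinearMap.BilinForm ℝ M}

/-- A bicolored list is equivalent to every arrangement of its roots in a forest of words. -/
lemma IsForm.cyc_of_isArrangement (hB : IsForm P B) {d : ℕ} {g : ℕ → ℕ → ℤ} {par : ℕ → ℕ}
    {col : ℕ → Bool} {W : List (List ℕ)} (hW : IsArrangement d g par col W) {f : ℕ → ι}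
    (hg : HasAbsGram P d g f) {A A' : List ι}
    (hA : A.Pairwise P.IsOrthogonal) (hA' : A'.Pairwise P.IsOrthogonal) (hi : Indep P (A ++ A'))
    (hp : (A ++ A').Perm ((List.range d).map f)) :
    Cyc P.IsOrthogonal (A ++ A') (W.flatten.map f) := by
  obtain ⟨hpar, hperm, hforest, hcol⟩ := hW
  have hmem : ∀ y < d, f y ∈ A ++ A' := fun y hy =>
    hp.mem_iff.2 (List.mem_map.2 ⟨y, List.mem_range.2 hy, rfl⟩)
  have hinj : ∀ y < d, ∀ z < d, y ≠ z → f y ≠ f z := by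
    intro y hy z hz hyz h
    exact hyz (List.inj_on_of_nodup_map (hp.nodup_iff.1 hi.nodup) (List.mem_range.2 hy)
      (List.mem_range.2 hz) h)
  have hlt : ∀ U ∈ W, ∀ y ∈ U, y < d := fun U hU y hy =>
    List.mem_range.1 (hperm.mem_iff.1 (List.mem_flatten.2 ⟨U, hU, hy⟩))
  -- The parents connect every vertex to `0`, so the block of a root is determined by its colour and
  -- by the block of `f 0`.
  have hcolour : ∀ y < d, (f y ∈ A ↔ if col y = col 0 then f 0 ∈ A else f 0 ∉ A) := by
    intro y
    induction y using Nat.strong_induction_on with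
    | _ y ih =>
      intro hy
      by_cases hy0 : y = 0
      · simp [hy0]
      obtain ⟨h1, h2, h3⟩ := hpar y hy hy0
      have h4 := ih _ h1 (by omega)
      have h5 := mem_left_iff hA hA' (hmem y hy) (hmem _ (by omega))
        (hinj y hy _ (by omega) (by omega)) fun ho =>
          h2 ((hB.isOrthogonal_iff_of_absGram hg hy (by omega)).1 ho)
      rw [h5, h4]
      cases hc : col y <;> cases hc' : col (par y) <;> cases hc0 : col 0 <;> simp_all
  rw [List.map_flatten]
  refine Cyc.of_blocks (fun _ _ h => h.symm) hA hA' hi.nodup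
    (hforest.map fun U hU V hV h => ?_) ?_ ?_
  · intro x hx y hy
    obtain ⟨u, hu, rfl⟩ := List.mem_map.1 hx
    obtain ⟨v, hv, rfl⟩ := List.mem_map.1 hy
    exact (hB.isOrthogonal_iff_of_absGram hg (hlt U hU u hu) (hlt V hV v hv)).2 (h u hu v hv)
  · rw [← List.map_flatten]
    exact (hperm.map f).trans hp.symm
  · intro U hU
    obtain ⟨V, hV, rfl⟩ := List.mem_map.1 hU
    rcases V with _ | ⟨y, V⟩
    · simp
    have hor : ∀ z < d, f z ∈ A ∨ f z ∈ A' := fun y hy => List.mem_append.1 (hmem y hy)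
    have hsame : ∀ z ∈ y :: V, (f z ∈ A ↔ f y ∈ A) := by
      intro z hz
      rw [hcolour z (hlt _ hV z hz), hcolour y (hlt _ hV y (by simp)),
        hcol _ hV z hz y (by simp)]
    by_cases h : f y ∈ A
    · refine .inl fun x hx => ?_
      obtain ⟨z, hz, rfl⟩ := List.mem_map.1 hx
      exact (hsame z hz).2 h
    · refine .inr fun x hx => ?_
      obtain ⟨z, hz, rfl⟩ := List.mem_map.1 hx
      exact (hor z (hlt _ hV z hz)).resolve_left fun h' => h ((hsame z hz).1 h')

/-- The elementary transformations lead from the diagram `E`, arranged in the words `W`, to the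
diagram `E'` with its vertices at the places given by `σ`, in a bicolored order with `c` vertices
in the first block. -/
def Transforms (d : ℕ) (E E' : List (ℕ × ℕ × ℤ)) (W : List (List ℕ)) (ms : List Move)
    (σ : List ℕ) (c : ℕ) : Prop :=
  let L := runMoves (edgeGram E) d ms (unitVectors d W.flatten)
  σ.Perm (List.range d) ∧
  (∀ y < d, ∀ z < d, gramForm (edgeGram E) d (L.getD (σ.getD y 0) []) (L.getD (σ.getD z 0) []) =
    edgeGram E' y z) ∧
  (∀ y < d, ∀ z < d, y ≠ z → (σ.getD y 0 < c ↔ σ.getD z 0 < c) → edgeGram E' y z = 0)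

instance (d : ℕ) (E E' : List (ℕ × ℕ × ℤ)) (W : List (List ℕ)) (ms : List Move)
    (σ : List ℕ) (c : ℕ) : Decidable (Transforms d E E' W ms σ c) := by
  unfold Transforms; infer_instance

/-- The list is arranged along the words, its signs are adjusted, and the moves are run. The two
halves of the outcome, before and after place `c`, are the new orthogonal blocks, and `σ` only
renames their vertices. -/
theorem IsForm.exists_of_transforms (hB : IsForm P B) {d : ℕ} {E E' : List (ℕ × ℕ × ℤ)}
    {par : ℕ → ℕ} {col : ℕ → Bool} {W : List (List ℕ)} {ms : List Move} {σ : List ℕ} {c : ℕ}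
    (hW : IsArrangement d (edgeGram E) par col W) (hc : c ≤ d) (ht : Transforms d E E' W ms σ c)
    {a b : ℕ → ι} (hab : IsSigned P a b) (hg : HasGram P d (edgeGram E) b) {A A' : List ι}
    (hA : A.Pairwise P.IsOrthogonal) (hA' : A'.Pairwise P.IsOrthogonal) (hi : Indep P (A ++ A'))
    (hp : (A ++ A').Perm ((List.range d).map a)) :
    ∃ (f : ℕ → ι) (C C' : List ι), C.Pairwise P.IsOrthogonal ∧ C'.Pairwise P.IsOrthogonal ∧
      (C ++ C').Perm ((List.range d).map f) ∧ HasGram P d (edgeGram E') f ∧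
      Loc P (A ++ A') (C ++ C') := by
  obtain ⟨hσ, hgram, hcol⟩ := ht
  have hga : HasAbsGram P d (edgeGram E) a := fun i hi j hj => by
    rw [← hab.abs_pairing, hg.abs i hi j hj]
  have hlen : W.flatten.length = d := by simpa using hW.2.1.length_eq
  have hσlen : σ.length = d := by simpa using hσ.length_eq
  obtain ⟨Ω', hl, f', rfl, hg'⟩ := hg.exists_loc (edgeGram_comm E) ms (s := W.flatten)
    fun k hk => List.mem_range.1 (hW.2.1.mem_iff.1 hk)
  rw [hlen] at hl hg'
  have hσlt : ∀ y < d, σ.getD y 0 < d := fun y hy => by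
    rw [List.getD_eq_getElem _ _ (by omega)]
    exact List.mem_range.1 (hσ.mem_iff.1 (List.getElem_mem _))
  have hfg : HasGram P d (edgeGram E') (fun y => f' (σ.getD y 0)) := fun y hy z hz =>
    (hg' _ (hσlt y hy) _ (hσlt z hz)).trans (congrArg _ (hgram y hy z hz))
  have hsurj : ∀ x < d, ∃ y < d, σ.getD y 0 = x := by
    intro x hx
    obtain ⟨y, hy, hyx⟩ := List.mem_iff_getElem.1 (hσ.mem_iff.2 (List.mem_range.2 hx))
    exact ⟨y, by omega, by rw [List.getD_eq_getElem _ _ hy, hyx]⟩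
  have horth : ∀ x < d, ∀ x' < d, x ≠ x' → (x < c ↔ x' < c) → P.IsOrthogonal (f' x) (f' x') := by
    intro x hx x' hx' hne hcc
    obtain ⟨y, hy, rfl⟩ := hsurj x hx
    obtain ⟨z, hz, rfl⟩ := hsurj x' hx'
    refine (hB.isOrthogonal_iff_of_absGram hfg.abs hy hz).2 (hcol y hy z hz ?_ hcc)
    rintro rfl
    exact hne rfl
  have hsplit : (List.range d).map f' =
      (List.range c).map f' ++ (List.range' c (d - c)).map f' := by
    rw [← List.map_append, List.range_eq_range', List.range_eq_range',
      ← Nat.add_sub_cancel' hc, ← List.range'_append_1, Nat.add_sub_cancel' hc, Nat.zero_add]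
  refine ⟨fun y => f' (σ.getD y 0), (List.range c).map f', (List.range' c (d - c)).map f', ?_, ?_,
    ?_, hfg, ?_⟩
  · rw [List.pairwise_map]
    refine List.pairwise_lt_range.imp_of_mem fun hx hy hxy => ?_
    rw [List.mem_range] at hx hy
    exact horth _ (by omega) _ (by omega) (by omega) (by omega)
  · rw [List.pairwise_map]
    refine (List.pairwise_lt_range' (step := 1)).imp_of_mem fun hx hy hxy => ?_
    rw [List.mem_range'_1] at hx hy
    exact horth _ (by omega) _ (by omega) (by omega) (by omega)
  · rw [← hsplit]
    refine (hσ.symm.map f').trans (List.Perm.of_eq ?_)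
    refine List.ext_getElem (by simp [hσlen]) fun i h1 h2 => ?_
    simp at h1
    simp [List.getElem?_eq_getElem h1]
  · rw [← hsplit]
    exact ((hB.cyc_of_isArrangement hW hga hA hA' hi hp).loc.trans (hab.loc _)).trans hl

end Certificates

end Carter

namespace Carter

/-! ### The explicit diagrams with 7 and 8 vertices -/

section FiniteCases

/-- The edges of the hexagon with one dotted edge. -/
def hexagonEdges : List (ℕ × ℕ × ℤ) :=
  [(0, 1, -1), (1, 2, -1), (2, 3, -1), (3, 4, -1), (4, 5, -1), (0, 5, 1)]

/-- The edges of the diagram `E_7(b_2)`. -/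
def edgesE7b2 : List (ℕ × ℕ × ℤ) := hexagonEdges ++ [(0, 6, -1)]

/-- The edges of the diagram `E_7(a_2)`. -/
def edgesE7a2 : List (ℕ × ℕ × ℤ) :=
  [(0, 1, -1), (1, 2, -1), (2, 3, -1), (0, 3, 1), (0, 4, -1), (1, 5, -1), (2, 6, -1)]

/-- The hexagon with vertices attached at two opposite vertices. -/
def edgesOpposite : List (ℕ × ℕ × ℤ) := hexagonEdges ++ [(0, 6, -1), (3, 7, -1)]

/-- The square with a path of one vertex attached to each vertex. -/
def edgesFourTails : List (ℕ × ℕ × ℤ) :=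
  [(0, 5, -1), (0, 6, 1), (0, 7, 1), (1, 4, -1), (1, 6, -1), (1, 7, 1), (2, 6, -1), (3, 7, -1)]

/-- The hexagon with a square attached to one of its edges. -/
def edgesAdjacent : List (ℕ × ℕ × ℤ) := hexagonEdges ++ [(0, 6, -1), (1, 7, -1), (6, 7, 1)]

/-- Two squares with a common edge, and vertices attached to opposite vertices of the figure. -/
def edgesTwoSquares : List (ℕ × ℕ × ℤ) :=
  [(0, 7, -1), (1, 4, 1), (1, 5, 1), (1, 6, -1), (2, 4, -1), (2, 5, 1), (2, 7, 1), (3, 5, -1),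
    (3, 7, 1)]

/-- The words of the hexagon with a vertex attached. -/
def wordsE7b2 : List (List ℕ) := [[3], [2, 4], [1, 5], [0], [6]]

/-- The square is folded along the diagonal through 1 and 3. -/
def wordsE7a2 : List (List ℕ) := [[3], [4], [6], [0, 2], [1], [5]]

/-- The hexagon is folded along the axis through the two points of attachment. -/
def wordsOpposite : List (List ℕ) := [[7], [3], [2, 4], [1, 5], [0], [6]]

/-- The two colour classes themselves: a list of two words is always a forest. -/
def wordsAdjacent : List (List ℕ) := [[0, 2, 4, 7], [1, 3, 5, 6]]

/-- This is the slide of `IsForm.lens_flip`: vertex 3 passes through 2, 4, 1, 5. The rest are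
rotations, commutations and sign changes. -/
def movesE7b2 : List Move :=
  [.right 0, .right 1, .right 2, .right 3, .rot, .rot, .rot, .rot, .left 2, .left 3, .neg 6, .neg 3]

/-- Here vertex 3 of the square passes outward through 2, 0, 6, 4, and its image closes the hexagon.
-/
def movesE7a2 : List Move :=
  [.rot, .left 5, .left 4, .left 3, .left 2, .left 1, .left 0, .rot, .rot, .rot, .rot, .rot,
    .left 1, .left 0, .rot, .left 1, .left 2, .neg 2, .neg 5]

/-- The same slide of vertex 3 as in `movesE7b2`. Its image keeps the attached vertex 7 as a tail.
-/
def movesOpposite : List Move :=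
  [.right 1, .right 2, .right 3, .right 4, .rot, .rot, .rot, .rot, .rot, .left 3, .left 2, .left 4,
    .left 3]

/-- A pure certificate, justified by the evaluation in `transforms_adjacent`. The sequence does not
follow the pattern of the flip. -/
def movesAdjacent : List Move :=
  [.left 4, .left 3, .left 5, .left 4, .left 4, .left 3, .left 2, .left 1, .left 0, .left 0,
    .left 1, .left 2, .left 3, .left 4, .left 5, .left 6, .left 0, .left 1, .left 2, .left 5,
    .left 4, .left 3, .left 2, .left 1, .left 0, .left 0, .left 1, .left 2, .left 3, .left 4,
    .left 5, .left 6, .left 4, .left 5, .left 0, .left 0, .left 1, .left 2, .left 3, .left 4,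
    .left 5, .left 6, .left 6, .left 0, .left 1, .left 2, .left 3, .left 4, .left 5, .left 6,
    .left 0, .left 6, .left 5, .left 4, .left 3, .left 0, .left 0, .left 1, .left 2, .left 3,
    .left 4, .left 5, .left 6, .left 2, .left 1, .left 3, .left 4, .left 5, .left 6, .left 5,
    .left 6, .right 3, .left 2, .left 1, .left 0, .left 4, .left 5, .right 3, .left 4, .left 2,
    .right 6, .left 5, .left 0, .rot, .left 0, .rot, .left 2, .left 3, .left 5, .left 4, .left 6,
    .left 5]

lemma isArrangement_E7b2 : IsArrangement 7 (edgeGram edgesE7b2)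
    (fun y => if y = 6 then 0 else y - 1) (fun y => [1, 3, 5, 6].contains y) wordsE7b2 := by
  decide +kernel

lemma isArrangement_E7a2 : IsArrangement 7 (edgeGram edgesE7a2)
    (fun y => if 4 ≤ y then y - 4 else y - 1) (fun y => [1, 3, 4, 6].contains y) wordsE7a2 := by
  decide +kernel

lemma isArrangement_opposite : IsArrangement 8 (edgeGram edgesOpposite)
    (fun y => if y = 6 then 0 else if y = 7 then 3 else y - 1) (fun y => [1, 3, 5, 6].contains y)
    wordsOpposite := by
  decide +kernel

lemma isArrangement_adjacent : IsArrangement 8 (edgeGram edgesAdjacent)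
    (fun y => if y = 6 then 0 else if y = 7 then 1 else y - 1) (fun y => [1, 3, 5, 6].contains y)
    wordsAdjacent := by
  decide +kernel

lemma transforms_E7b2_E7a2 : Transforms 7 edgesE7b2 edgesE7a2 wordsE7b2 movesE7b2
    [5, 1, 6, 0, 2, 4, 3] 4 := by
  decide +kernel

lemma transforms_E7a2_E7b2 : Transforms 7 edgesE7a2 edgesE7b2 wordsE7a2 movesE7a2
    [0, 4, 1, 6, 2, 5, 3] 3 := by
  decide +kernel

lemma transforms_opposite : Transforms 8 edgesOpposite edgesFourTails wordsOpposite movesOpposite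
    (List.range 8) 4 := by
  decide +kernel

lemma transforms_adjacent : Transforms 8 edgesAdjacent edgesTwoSquares wordsAdjacent movesAdjacent
    (List.range 8) 4 := by
  decide +kernel

/-- The diagram of the matrix contains no chordless cycle with six or more vertices. -/
def NoLongCycle (d : ℕ) (g : ℕ → ℕ → ℤ) : Prop :=
  ∀ S ∈ (List.range d).sublists, 6 ≤ S.length →
    ∃ y ∈ S, (S.filter fun z => decide (z ≠ y ∧ g y z ≠ 0)).length ≠ 2

instance (d : ℕ) (g : ℕ → ℕ → ℤ) : Decidable (NoLongCycle d g) := by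
  unfold NoLongCycle; infer_instance

lemma noLongCycle_E7a2 : NoLongCycle 7 (edgeGram edgesE7a2) := by decide +kernel

lemma noLongCycle_fourTails : NoLongCycle 8 (edgeGram edgesFourTails) := by decide +kernel

lemma noLongCycle_twoSquares : NoLongCycle 8 (edgeGram edgesTwoSquares) := by decide +kernel

end FiniteCases

/-! ### Absence of long chordless cycles after the transformations -/

section Chordless

variable {ι M N : Type*} [AddCommGroup M] [Module ℝ M] [AddCommGroup N] [Module ℝ N]
  {P : RootPairing ι ℝ M N} {B : LinearMap.BilinForm ℝ M}

lemma exists_neighbours {n i : ℕ} (hn : 3 ≤ n) (hi : i < n) :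
    ∃ p q, p < n ∧ q < n ∧ p ≠ q ∧ p ≠ i ∧ q ≠ i ∧
      ∀ j < n, (j ≠ i ∧ CycAdj n i j ↔ j = p ∨ j = q) := by
  refine ⟨if i = 0 then n - 1 else i - 1, if i + 1 = n then 0 else i + 1, ?_⟩
  unfold CycAdj
  split_ifs with h1 h2 h2
  · omega
  · exact ⟨by omega, by omega, by omega, by omega, by omega, fun j hj => by omega⟩
  · exact ⟨by omega, by omega, by omega, by omega, by omega, fun j hj => by omega⟩
  · exact ⟨by omega, by omega, by omega, by omega, by omega, fun j hj => by omega⟩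

/-- A chordless cycle in a list of roots with a known matrix, described by indices. -/
lemma ChordlessIn.exists_index (hB : IsForm P B) {d n : ℕ} {g : ℕ → ℕ → ℤ} {f a : ℕ → ι}
    {Ω : List ι} (hg : HasAbsGram P d g f) (hΩ : Ω ⊆ (List.range d).map f)
    (h : ChordlessIn P Ω n a) :
    ∃ φ : ℕ → ℕ, (∀ i < n, φ i < d) ∧ (∀ i < n, ∀ j < n, φ i = φ j → i = j) ∧
      ∀ i < n, ∀ j < n, i ≠ j → (g (φ i) (φ j) ≠ 0 ↔ CycAdj n i j) := by
  have : ∀ i, ∃ y, i < n → y < d ∧ f y = a i := by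
    intro i
    by_cases hi : i < n
    · obtain ⟨y, hy, hya⟩ := List.mem_map.1 (hΩ (h.mem i hi))
      exact ⟨y, fun _ => ⟨List.mem_range.1 hy, hya⟩⟩
    · exact ⟨0, fun h => absurd h hi⟩
  choose φ hφ using this
  refine ⟨φ, fun i hi => (hφ i hi).1, fun i hi j hj hij => ?_, fun i hi j hj hij => ?_⟩
  · by_contra hne
    exact h.chordless.ne hi hj hne (by rw [← (hφ i hi).2, ← (hφ j hj).2, hij])
  · rw [← h.linked_iff hi hj hij, ← (hφ i hi).2, ← (hφ j hj).2, Linked,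
      hB.isOrthogonal_iff_of_absGram hg (hφ i hi).1 (hφ j hj).1]

/-- The indices of the cycle would form a set in which every vertex has exactly two neighbours. -/
lemma NoLongCycle.not_chordlessIn (hB : IsForm P B) {d n : ℕ} {g : ℕ → ℕ → ℤ} {f a : ℕ → ι}
    {Ω : List ι} (hn : NoLongCycle d g) (hg : HasAbsGram P d g f) (hΩ : Ω ⊆ (List.range d).map f) :
    ¬ ChordlessIn P Ω n a := by
  classical
  intro h
  have h6 := h.six_le
  obtain ⟨φ, h1, h2, h3⟩ := h.exists_index hB hg hΩ
  set S := (List.range d).filter fun y => decide (∃ i < n, φ i = y)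
  have hmem : ∀ y, y ∈ S ↔ ∃ i < n, φ i = y := by
    intro y
    simp only [S, List.mem_filter, List.mem_range, decide_eq_true_eq, and_iff_right_iff_imp]
    rintro ⟨i, hi, rfl⟩
    exact h1 i hi
  have hnd : S.Nodup := List.nodup_range.filter _
  have hlen : S.length = n := by
    rw [← List.toFinset_card_of_nodup hnd, ← Finset.card_range n]
    symm
    refine Finset.card_bij (fun i _ => φ i) (fun i hi => ?_) (fun i hi j hj hij => ?_)
      fun y hy => ?_
    · rw [List.mem_toFinset, hmem]; exact ⟨i, Finset.mem_range.1 hi, rfl⟩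
    · exact h2 i (Finset.mem_range.1 hi) j (Finset.mem_range.1 hj) hij
    · rw [List.mem_toFinset, hmem] at hy
      obtain ⟨i, hi, rfl⟩ := hy
      exact ⟨i, Finset.mem_range.2 hi, rfl⟩
  obtain ⟨y, hy, hne⟩ := hn S (List.mem_sublists.2 List.filter_sublist) (by omega)
  obtain ⟨i, hi, rfl⟩ := (hmem y).1 hy
  obtain ⟨p, q, hp, hq, hpq, hpi, hqi, hpq'⟩ := exists_neighbours (by omega) hi
  apply hne
  rw [← List.toFinset_card_of_nodup (hnd.filter _)]
  rw [show (S.filter fun z => decide (z ≠ φ i ∧ g (φ i) z ≠ 0)).toFinset = {φ p, φ q} from ?_]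
  · exact Finset.card_pair fun h => hpq (h2 p hp q hq h)
  · ext z
    simp only [List.mem_toFinset, List.mem_filter, hmem, decide_eq_true_eq, Finset.mem_insert,
      Finset.mem_singleton]
    constructor
    · rintro ⟨⟨j, hj, rfl⟩, h4, h5⟩
      have hji : j ≠ i := fun h => h4 (by rw [h])
      rcases (hpq' j hj).1 ⟨hji, (h3 i hi j hj hji.symm).1 h5⟩ with rfl | rfl <;> simp
    · have key : ∀ j < n, (j = p ∨ j = q) → (∃ i < n, φ i = φ j) ∧ φ j ≠ φ i ∧ g (φ i) (φ j) ≠ 0 := by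
        intro j hj hjpq
        obtain ⟨h4, h5⟩ := (hpq' j hj).2 hjpq
        exact ⟨⟨j, hj, rfl⟩, fun h => h4 (h2 j hj i hi h), (h3 i hi j hj h4.symm).2 h5⟩
      rintro (rfl | rfl)
      · exact key p hp (.inl rfl)
      · exact key q hq (.inr rfl)

/-- The square with two paths attached to opposite vertices contains no long cycle. -/
lemma not_chordlessIn_of_lens (hB : IsForm P B) {k n : ℕ} {f a : ℕ → ι} {Ω : List ι}
    (hg : HasAbsGram P (2 * k + 2) (lensGram k 0) f) (hΩ : Ω ⊆ (List.range (2 * k + 2)).map f) :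
    ¬ ChordlessIn P Ω n a := by
  intro h
  have h6 := h.six_le
  obtain ⟨φ, h1, h2, h3⟩ := h.exists_index hB hg hΩ
  -- The path vertices are excluded by induction on the distance from the end of the arm: once those
  -- further out are excluded, only the inner neighbour is left, while a cycle needs two. Four
  -- vertices remain.
  have step : ∀ m, ∀ i < n, φ i + m = 2 * k → ¬ (3 ≤ φ i) := by
    intro m
    induction m using Nat.strong_induction_on with
    | _ m ih =>
      intro i hi him h3i
      obtain ⟨p, q, hp, hq, hpq, hpi, hqi, hpq'⟩ := exists_neighbours (by omega) hi
      have key : ∀ j < n, (j = p ∨ j = q) → φ j + 2 = φ i := by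
        intro j hj hjpq
        obtain ⟨h4, h5⟩ := (hpq' j hj).2 hjpq
        have h6 := (h3 i hi j hj h4.symm).2 h5
        have h7 : φ j ≠ φ i := fun h => h4 (h2 j hj i hi h)
        have h8 := h1 j hj
        rw [lensGram_zero_iff] at h6
        have h9 : ¬ (φ j = φ i + 2 ∧ φ j ≤ 2 * k) := by
          rintro ⟨h9, h10⟩
          exact ih (2 * k - φ j) (by omega) j hj (by omega) (by omega)
        omega
      exact hpq (h2 p hp q hq (by have := key p hp (.inl rfl); have := key q hq (.inr rfl); omega))
  have : ∀ i < n, φ i ∈ ({0, 1, 2, 2 * k + 1} : Finset ℕ) := by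
    intro i hi
    have := h1 i hi
    have h4 := step (2 * k - φ i) i hi
    simp only [Finset.mem_insert, Finset.mem_singleton]
    omega
  have hcard := Finset.card_le_card_of_injOn φ (s := Finset.range n)
    (fun i hi => this i (Finset.mem_range.1 hi))
    (fun i hi j hj => h2 i (by simpa using hi) j (by simpa using hj))
  have := Finset.card_le_four (a := 0) (b := 1) (c := 2) (d := 2 * k + 1)
  rw [Finset.card_range] at hcard
  omega

end Chordless

end Carter

namespace Carter

/-! ### Signs forced by linear independence -/

section Signs

/-- The signs of the matrix are the only possible ones, if the edges from the vertices to their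
parents are solid: each other edge lies in a set for which the sum of the roots would be zero if
the edge had the other sign. -/
def IsRigid (d : ℕ) (g : ℕ → ℕ → ℤ) (par : ℕ → ℕ) (K : List (Finset ℕ)) : Prop :=
  (∀ y < d, g y y = 2) ∧
  ∀ y < d, ∀ z < d, y ≠ z → g y z = 0 ∨ (par y < y ∧ par y = z ∧ g y z = -1) ∨
    (par z < z ∧ par z = y ∧ g y z = -1) ∨
    |g y z| = 1 ∧ ∃ C ∈ K, y ∈ C ∧ z ∈ C ∧ (∀ u ∈ C, u < d) ∧
      (∀ u ∈ C, ∀ v ∈ C, u ≠ v → (u = y ∧ v = z) ∨ (u = z ∧ v = y) ∨ g u v = 0 ∨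
        (par u < u ∧ par u = v ∧ g u v = -1) ∨ (par v < v ∧ par v = u ∧ g u v = -1)) ∧
      ∀ v ∈ C, ∑ u ∈ C, (if (u = y ∧ v = z) ∨ (u = z ∧ v = y) then - g y z else g u v) = 0

set_option synthInstance.maxSize 2000 in
set_option synthInstance.maxHeartbeats 200000 in
instance (d : ℕ) (g : ℕ → ℕ → ℤ) (par : ℕ → ℕ) (K : List (Finset ℕ)) :
    Decidable (IsRigid d g par K) := by
  unfold IsRigid; infer_instance

variable {ι M N : Type*} [AddCommGroup M] [Module ℝ M] [AddCommGroup N] [Module ℝ N]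
  {P : RootPairing ι ℝ M N} {B : LinearMap.BilinForm ℝ M}

/-- The edges to the parents are made solid. With the wrong sign at another edge, the roots of its
set `C` would have a sum orthogonal to all of them, against independence. -/
lemma IsForm.exists_signed (hB : IsForm P B) {d : ℕ} {g : ℕ → ℕ → ℤ} {par : ℕ → ℕ}
    {K : List (Finset ℕ)} (hK : IsRigid d g par K) (hcomm : ∀ y z, g y z = g z y) {Ω : List ι}
    (hi : Indep P Ω) {a : ℕ → ι} (ha : ∀ i < d, a i ∈ Ω)
    (hinj : ∀ i < d, ∀ j < d, i ≠ j → a i ≠ a j) (hg : HasAbsGram P d g a) :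
    ∃ b, IsSigned P a b ∧ HasGram P d g b := by
  obtain ⟨hdiag, hK⟩ := hK
  set b := obtuse P a par
  have hab : IsSigned P a b := obtuse_isSigned a par
  have hb := hg.signed hab
  have hzero : ∀ y < d, ∀ z < d, g y z = 0 → P.pairing (b y) (b z) = g y z := by
    intro y hy z hz h
    have := hb y hy z hz
    rw [h] at this ⊢
    simpa using this
  have hpar : ∀ y < d, ∀ z < d, par y < y → par y = z → g y z = -1 →
      P.pairing (b y) (b z) = g y z ∧ P.pairing (b z) (b y) = g y z := by
    intro y hy z hz h1 h2 h3
    subst h2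
    have h4 : P.pairing (b y) (b (par y)) = -1 :=
      obtuse_pairing h1 (by rw [hg y hy _ hz, h3]; simp)
    have h5 := hB.pairing_eq_of_abs (i := b y) (j := b (par y)) (by rw [h4]; simp)
      (by rw [hb _ hz y hy, hcomm, h3]; simp)
    rw [← h5, h4, h3]
    simp
  refine ⟨b, hab, fun y hy z hz => ?_⟩
  by_cases hyz : y = z
  · rw [hyz, P.pairing_same, hdiag z hz]; simp
  rcases hK y hy z hz hyz with h | ⟨h1, h2, h3⟩ | ⟨h1, h2, h3⟩ | ⟨h1, C, -, hyC, hzC, hCd, hC, hsum⟩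
  · exact hzero y hy z hz h
  · exact (hpar y hy z hz h1 h2 h3).1
  · exact (hpar z hz y hy h1 h2 (by rw [hcomm, h3])).2.trans (by rw [hcomm])
  · have habs : |P.pairing (b y) (b z)| = 1 := by
      rw [hb y hy z hz]; exact_mod_cast h1
    have habs' : |P.pairing (b z) (b y)| = 1 := by
      rw [hb z hz y hy, hcomm]; exact_mod_cast h1
    have hsym := hB.pairing_eq_of_abs habs habs'
    rcases abs_eq_abs.1 (hb y hy z hz) with h | h
    · exact h
    exfalso
    obtain ⟨v, hv, hne⟩ := hB.exists_sum_ne_zero hi hab C ⟨y, hyC⟩ (fun i hi => ha i (hCd i hi))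
      (fun i hi j hj => hinj i (hCd i hi) j (hCd j hj))
    apply hne
    have h2 : ((∑ u ∈ C, (if (u = y ∧ v = z) ∨ (u = z ∧ v = y) then - g y z else g u v) : ℤ) : ℝ)
        = 0 := by rw [hsum v hv]; simp
    rw [← h2]
    push_cast
    refine Finset.sum_congr rfl fun u hu => ?_
    by_cases huv : u = v
    · rw [huv, P.pairing_same, if_neg (by rintro (⟨h3, h4⟩ | ⟨h3, h4⟩) <;> omega),
        hdiag v (hCd v hv)]
      simp
    split_ifs with h3
    · rcases h3 with ⟨rfl, rfl⟩ | ⟨rfl, rfl⟩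
      · exact h
      · rw [← hsym, h]
    · rcases hC u hu v hv huv with h4 | h4 | h4 | ⟨h4, h5, h6⟩ | ⟨h4, h5, h6⟩
      · exact absurd (.inl h4) h3
      · exact absurd (.inr h4) h3
      · exact hzero u (hCd u hu) v (hCd v hv) h4
      · exact (hpar u (hCd u hu) v (hCd v hv) h4 h5 h6).1
      · exact (hpar v (hCd v hv) u (hCd u hu) h4 h5 (by rw [hcomm, h6])).2.trans (by rw [hcomm])

/-- The transformation of a bicolored list of roots with a diagram known up to signs. -/
theorem IsForm.exists_of_isRigid (hB : IsForm P B) {d : ℕ} {E E' : List (ℕ × ℕ × ℤ)}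
    {par : ℕ → ℕ} {col : ℕ → Bool} {W : List (List ℕ)} {ms : List Move} {σ : List ℕ} {c : ℕ}
    {K : List (Finset ℕ)} (hK : IsRigid d (edgeGram E) par K)
    (hW : IsArrangement d (edgeGram E) par col W) (hc : c ≤ d) (ht : Transforms d E E' W ms σ c)
    {a : ℕ → ι} {A A' : List ι} (hA : A.Pairwise P.IsOrthogonal) (hA' : A'.Pairwise P.IsOrthogonal)
    (hi : Indep P (A ++ A')) (hp : (A ++ A').Perm ((List.range d).map a))
    (hg : HasAbsGram P d (edgeGram E) a) :
    ∃ (f : ℕ → ι) (C C' : List ι), C.Pairwise P.IsOrthogonal ∧ C'.Pairwise P.IsOrthogonal ∧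
      (C ++ C').Perm ((List.range d).map f) ∧ HasGram P d (edgeGram E') f ∧
      Loc P (A ++ A') (C ++ C') := by
  obtain ⟨b, hab, hb⟩ := hB.exists_signed hK (edgeGram_comm E) hi (a := a)
    (fun i hi => hp.mem_iff.2 (List.mem_map.2 ⟨i, List.mem_range.2 hi, rfl⟩))
    (fun i hi' j hj hij h => hij (List.inj_on_of_nodup_map (hp.nodup_iff.1 hi.nodup)
      (List.mem_range.2 hi') (List.mem_range.2 hj) h)) hg
  exact hB.exists_of_transforms hW hc ht hab hb hA hA' hi hp

lemma isRigid_E7b2 : IsRigid 7 (edgeGram edgesE7b2) (fun y => if y = 6 then 0 else y - 1)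
    [{0, 1, 2, 3, 4, 5}] := by
  decide +kernel

lemma isRigid_E7a2 : IsRigid 7 (edgeGram edgesE7a2) (fun y => if 4 ≤ y then y - 4 else y - 1)
    [{0, 1, 2, 3}] := by
  decide +kernel

lemma isRigid_opposite : IsRigid 8 (edgeGram edgesOpposite)
    (fun y => if y = 6 then 0 else if y = 7 then 3 else y - 1) [{0, 1, 2, 3, 4, 5}] := by
  decide +kernel

lemma isRigid_adjacent : IsRigid 8 (edgeGram edgesAdjacent)
    (fun y => if y = 6 then 0 else if y = 7 then 1 else y - 1)
    [{0, 1, 2, 3, 4, 5}, {0, 1, 6, 7}] := by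
  decide +kernel

end Signs

/-! ### The two diagrams of type E7 -/

section E7

set_option synthInstance.maxSize 2000 in
set_option synthInstance.maxHeartbeats 200000 in
lemma diagramE7b2_iff : ∀ i j : Fin 7, i ≠ j →
    (diagramE7b2.solid.Adj i j ↔ edgeGram edgesE7b2 i j = -1) ∧
    (diagramE7b2.dotted.Adj i j ↔ edgeGram edgesE7b2 i j = 1) ∧
    (diagramE7b2.underlying.Adj i j ↔ edgeGram edgesE7b2 i j ≠ 0) ∧
    |edgeGram edgesE7b2 i j| ≤ 1 := by
  simp only [SignedDiagram.underlying, diagramE7b2, SimpleGraph.fromRel_adj, SimpleGraph.sup_adj]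
  decide +kernel

set_option synthInstance.maxSize 2000 in
set_option synthInstance.maxHeartbeats 200000 in
lemma diagramE7a2_iff : ∀ i j : Fin 7, i ≠ j →
    (diagramE7a2.solid.Adj i j ↔ edgeGram edgesE7a2 i j = -1) ∧
    (diagramE7a2.dotted.Adj i j ↔ edgeGram edgesE7a2 i j = 1) ∧
    (diagramE7a2.underlying.Adj i j ↔ edgeGram edgesE7a2 i j ≠ 0) ∧
    |edgeGram edgesE7a2 i j| ≤ 1 := by
  simp only [SignedDiagram.underlying, diagramE7a2, SimpleGraph.fromRel_adj, SimpleGraph.sup_adj]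
  decide +kernel

variable {ι M N : Type*} [AddCommGroup M] [Module ℝ M] [AddCommGroup N] [Module ℝ N]

/-- A transformation of matrices gives a transformation of diagrams. -/
lemma canBeTransformed_of_transforms [Finite ι] (P : RootPairing ι ℝ M N)
    [P.IsRootSystem] [P.IsCrystallographic] {d : ℕ} (hd : 0 < d) {D D' : SignedDiagram (Fin d)}
    {E E' : List (ℕ × ℕ × ℤ)} {par : ℕ → ℕ} {col : ℕ → Bool} {W : List (List ℕ)} {ms : List Move}
    {σ : List ℕ} {c : ℕ} {K : List (Finset ℕ)} (hK : IsRigid d (edgeGram E) par K)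
    (hW : IsArrangement d (edgeGram E) par col W) (hc : c ≤ d) (ht : Transforms d E E' W ms σ c)
    (hD : ∀ i j : Fin d, i ≠ j → (D.underlying.Adj i j ↔ edgeGram E i j ≠ 0) ∧
      |edgeGram E i j| ≤ 1)
    (hD' : ∀ i j : Fin d, i ≠ j → (D'.solid.Adj i j ↔ edgeGram E' i j = -1) ∧
      (D'.dotted.Adj i j ↔ edgeGram E' i j = 1) ∧
      (D'.underlying.Adj i j ↔ edgeGram E' i j ≠ 0)) : CanBeTransformed P D D' := by
  obtain ⟨B, hB⟩ := exists_isForm P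
  rintro Ω ⟨hi, -, A, A', rfl, hA, hA'⟩ hΩ
  obtain ⟨a, ha, hg⟩ := hΩ.exists_seq hd
  have hga : HasAbsGram P d (edgeGram E) a := by
    intro i hi j hj
    by_cases hij : i = j
    · rw [hij, P.pairing_same, edgeGram, if_pos rfl]; simp
    obtain ⟨h1, h2⟩ := hg i j hi hj hij hi hj
    obtain ⟨h3, h4⟩ := hD ⟨i, hi⟩ ⟨j, hj⟩ (by simpa using hij)
    simp only at h3 h4
    by_cases h0 : edgeGram E i j = 0
    · rw [h2 (fun h => h3.1 h h0), h0]; simp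
    · rw [h1 (h3.2 h0)]
      have : |edgeGram E i j| = 1 := by
        have := abs_pos.2 h0
        omega
      exact_mod_cast this.symm
  obtain ⟨f, C, C', hC, hC', hp, hfg, hl⟩ := hB.exists_of_isRigid hK hW hc ht hA hA' hi ha hga
  have hiC := hl.indep hi
  refine ⟨C ++ C', isCarter_of_bicolored hiC hC hC', hasDiagram_of_seq hiC.nodup hp ?_,
    hl.equivalent⟩
  intro i j hij
  obtain ⟨h1, h2, h3⟩ := hD' i j hij
  rw [hfg i i.2 j j.2, h1, h2, h3, not_not]
  exact ⟨fun h => by rw [h]; simp, fun h => by rw [h]; simp, fun h => by rw [h]; simp⟩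

/-- The diagrams `E_7(b_2)` and `E_7(a_2)` are equivalent. -/
theorem diagramsEquivalent_E7b2_E7a2 [Finite ι] (P : RootPairing ι ℝ M N)
    [P.IsRootSystem] [P.IsCrystallographic] : DiagramsEquivalent P diagramE7b2 diagramE7a2 :=
  ⟨canBeTransformed_of_transforms P (by norm_num) isRigid_E7b2 isArrangement_E7b2 (by norm_num)
    transforms_E7b2_E7a2 (fun i j h => (diagramE7b2_iff i j h).2.2)
    fun i j h => ⟨(diagramE7a2_iff i j h).1, (diagramE7a2_iff i j h).2.1,
      (diagramE7a2_iff i j h).2.2.1⟩,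
  canBeTransformed_of_transforms P (by norm_num) isRigid_E7a2 isArrangement_E7a2 (by norm_num)
    transforms_E7a2_E7b2 (fun i j h => (diagramE7a2_iff i j h).2.2)
    fun i j h => ⟨(diagramE7b2_iff i j h).1, (diagramE7b2_iff i j h).2.1,
      (diagramE7b2_iff i j h).2.2.1⟩⟩

end E7

end Carter

namespace Carter

/-! ### Figures that can be transformed into figures without long cycles -/

section Resolution

variable {ι M N : Type*} [AddCommGroup M] [Module ℝ M] [AddCommGroup N] [Module ℝ N]
  {P : RootPairing ι ℝ M N}

/-- The list contains the vertices of a square, i.e. of a cycle with four vertices. -/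
def HasSquare (P : RootPairing ι ℝ M N) (Ω : List ι) : Prop :=
  ∃ w ∈ Ω, ∃ x ∈ Ω, ∃ y ∈ Ω, ∃ z ∈ Ω, [w, x, y, z].Nodup ∧
    Linked P w x ∧ Linked P x y ∧ Linked P y z ∧ Linked P z w

lemma HasSquare.mono {Ω Ω' : List ι} (h : HasSquare P Ω) (hs : Ω ⊆ Ω') : HasSquare P Ω' := by
  obtain ⟨w, hw, x, hx, y, hy, z, hz, h⟩ := h
  exact ⟨w, hs hw, x, hs hx, y, hs hy, z, hs hz, h⟩

lemma HasSquare.hasCycle {Ω : List ι} (h : HasSquare P Ω) : HasCycle (diagram P Ω) 4 := by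
  obtain ⟨w, hw, x, hx, y, hy, z, hz, hnd, h1, h2, h3, h4⟩ := h
  obtain ⟨w, rfl⟩ := List.mem_iff_get.1 hw
  obtain ⟨x, rfl⟩ := List.mem_iff_get.1 hx
  obtain ⟨y, rfl⟩ := List.mem_iff_get.1 hy
  obtain ⟨z, rfl⟩ := List.mem_iff_get.1 hz
  have hne : ∀ {i j : Fin Ω.length}, Ω.get i ≠ Ω.get j → i ≠ j := fun h h' => h (by rw [h'])
  simp only [List.nodup_cons, List.mem_cons, List.not_mem_nil, or_false, not_or] at hnd
  obtain ⟨⟨a1, a2, a3⟩, ⟨a4, a5⟩, a6, -⟩ := hnd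
  exact hasCycle_four ⟨hne a1, h1⟩ ⟨hne a4, h2⟩ ⟨hne a6, h3⟩ ⟨(hne a3).symm, h4⟩ (hne a2) (hne a5)

/-- The list is equivalent to a bicolored list with a square and without long chordless cycles. -/
def Resolves (P : RootPairing ι ℝ M N) (Ω : List ι) : Prop :=
  ∃ C C' : List ι, C.Pairwise P.IsOrthogonal ∧ C'.Pairwise P.IsOrthogonal ∧
    Loc P Ω (C ++ C') ∧ (∀ n a, ¬ ChordlessIn P (C ++ C') n a) ∧ HasSquare P (C ++ C')

variable {B : LinearMap.BilinForm ℝ M}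

lemma hasSquare_of_gram (hB : IsForm P B) {d : ℕ} {g : ℕ → ℕ → ℤ} {f : ℕ → ι} {Ω : List ι}
    (hnd : Ω.Nodup) (hg : HasAbsGram P d g f) (hp : Ω.Perm ((List.range d).map f))
    (s : List ℕ) (hs : s.Nodup) (hsd : ∀ i ∈ s, i < d) {i j k l : ℕ} (hs' : s = [i, j, k, l])
    (h1 : g i j ≠ 0) (h2 : g j k ≠ 0) (h3 : g k l ≠ 0) (h4 : g l i ≠ 0) : HasSquare P Ω := by
  subst hs'
  have hmem : ∀ y < d, f y ∈ Ω := fun y hy =>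
    hp.mem_iff.2 (List.mem_map.2 ⟨y, List.mem_range.2 hy, rfl⟩)
  have hi := hsd i (by simp)
  have hj := hsd j (by simp)
  have hk := hsd k (by simp)
  have hl := hsd l (by simp)
  refine ⟨f i, hmem i hi, f j, hmem j hj, f k, hmem k hk, f l, hmem l hl, ?_,
    mt (hB.isOrthogonal_iff_of_absGram hg hi hj).1 h1,
    mt (hB.isOrthogonal_iff_of_absGram hg hj hk).1 h2,
    mt (hB.isOrthogonal_iff_of_absGram hg hk hl).1 h3,
    mt (hB.isOrthogonal_iff_of_absGram hg hl hi).1 h4⟩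
  have : ([i, j, k, l].map f).Nodup := hs.map_on fun x hx y hy hxy =>
    List.inj_on_of_nodup_map (hp.nodup_iff.1 hnd) (List.mem_range.2 (hsd x hx))
      (List.mem_range.2 (hsd y hy)) hxy
  simpa using this

/-- The list of roots with the given matrix can be transformed, in each bicolored order. -/
def Resolvable (P : RootPairing ι ℝ M N) (d : ℕ) (f : ℕ → ι) : Prop :=
  ∀ D D' : List ι, D.Pairwise P.IsOrthogonal → D'.Pairwise P.IsOrthogonal → Indep P (D ++ D') →
    (D ++ D').Perm ((List.range d).map f) → Resolves P (D ++ D')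

/-- Height `k - 1` is the pure cycle. The flip moves the last vertex to height 0, where it closes a
square with `0, 1, 2`. -/
lemma resolvable_of_lens (hB : IsForm P B) {k : ℕ} (hk : 2 ≤ k) {f : ℕ → ι}
    (hg : HasAbsGram P (2 * k + 2) (lensGram k (k - 1)) f) : Resolvable P (2 * k + 2) f := by
  intro D D' hD hD' hi hp
  obtain ⟨f, C, C', hC, hC', hp, hfg, hl⟩ := hB.lens_flip (by omega) hD hD' hi hp hg
  rw [show k - 1 - (k - 1) = 0 by omega] at hfg
  refine ⟨C, C', hC, hC', hl, fun n a => not_chordlessIn_of_lens hB hfg.abs hp.subset, ?_⟩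
  refine hasSquare_of_gram hB (hl.indep hi).nodup hfg.abs hp [0, 1, 2 * k + 1, 2]
    ?_ ?_ rfl ?_ ?_ ?_ ?_
  · simp; omega
  · simp; omega
  all_goals rw [lensGram_zero_iff]; omega

lemma resolvable_of_isRigid (hB : IsForm P B) {d : ℕ} {E E' : List (ℕ × ℕ × ℤ)}
    {par : ℕ → ℕ} {col : ℕ → Bool} {W : List (List ℕ)} {ms : List Move} {σ : List ℕ} {c : ℕ}
    {K : List (Finset ℕ)} (hK : IsRigid d (edgeGram E) par K)
    (hW : IsArrangement d (edgeGram E) par col W) (hc : c ≤ d) (ht : Transforms d E E' W ms σ c)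
    (hn : NoLongCycle d (edgeGram E')) (s : List ℕ) (hs : s.Nodup) (hsd : ∀ i ∈ s, i < d)
    {i j k l : ℕ} (hs' : s = [i, j, k, l]) (h1 : edgeGram E' i j ≠ 0) (h2 : edgeGram E' j k ≠ 0)
    (h3 : edgeGram E' k l ≠ 0) (h4 : edgeGram E' l i ≠ 0) {f : ℕ → ι}
    (hg : HasAbsGram P d (edgeGram E) f) : Resolvable P d f := by
  intro D D' hD hD' hi hp
  obtain ⟨f, C, C', hC, hC', hp, hfg, hl⟩ := hB.exists_of_isRigid hK hW hc ht hD hD' hi hp hg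
  exact ⟨C, C', hC, hC', hl, fun n a => hn.not_chordlessIn hB hfg.abs hp.subset,
    hasSquare_of_gram hB (hl.indep hi).nodup hfg.abs hp s hs hsd hs' h1 h2 h3 h4⟩

lemma resolvable_of_E7b2 (hB : IsForm P B) {f : ℕ → ι}
    (hg : HasAbsGram P 7 (edgeGram edgesE7b2) f) : Resolvable P 7 f :=
  resolvable_of_isRigid hB isRigid_E7b2 isArrangement_E7b2 (by norm_num) transforms_E7b2_E7a2
    noLongCycle_E7a2 [0, 1, 2, 3] (by decide) (by decide) rfl (by decide) (by decide) (by decide)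
    (by decide) hg

lemma resolvable_of_opposite (hB : IsForm P B) {f : ℕ → ι}
    (hg : HasAbsGram P 8 (edgeGram edgesOpposite) f) : Resolvable P 8 f :=
  resolvable_of_isRigid hB isRigid_opposite isArrangement_opposite (by norm_num)
    transforms_opposite noLongCycle_fourTails [0, 6, 1, 7] (by decide) (by decide) rfl (by decide)
    (by decide) (by decide) (by decide) hg

lemma resolvable_of_adjacent (hB : IsForm P B) {f : ℕ → ι}
    (hg : HasAbsGram P 8 (edgeGram edgesAdjacent) f) : Resolvable P 8 f :=
  resolvable_of_isRigid hB isRigid_adjacent isArrangement_adjacent (by norm_num)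
    transforms_adjacent noLongCycle_twoSquares [1, 4, 2, 5] (by decide) (by decide) rfl (by decide)
    (by decide) (by decide) (by decide) hg

end Resolution

/-! ### Components that are pure cycles -/

section Components

variable {ι M N : Type*} [AddCommGroup M] [Module ℝ M] [AddCommGroup N] [Module ℝ N]
  {P : RootPairing ι ℝ M N}

lemma NoCenter.rotSeq {τ : Type*} {r : τ → τ → Prop} {S : τ → Prop} {a : ℕ → τ}
    (h : NoCenter r S a) {s : ℕ} (hs : s < 6) : NoCenter r S (rotSeq 6 s a) := by
  intro v hv
  have := h v hv
  interval_cases s <;> simp [Carter.rotSeq] <;> tauto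

lemma hasAbsGram_extend {d : ℕ} {g : ℕ → ℕ → ℤ} {a : ℕ → ι} (hg : HasAbsGram P d g a) (u : ι)
    (hu : ∀ y < d, |P.pairing (a y) u| = |(g y d : ℝ)| ∧ |P.pairing u (a y)| = |(g d y : ℝ)|)
    (hd : g d d = 2) : HasAbsGram P (d + 1) g (fun y => if y = d then u else a y) := by
  intro y hy z hz
  by_cases hyd : y = d <;> by_cases hzd : z = d
  · simp [hyd, hzd, hd]
  · simp only [hyd, hzd, if_true, if_false]; exact (hu z (by omega)).2
  · simp only [hyd, hzd, if_true, if_false]; exact (hu y (by omega)).1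
  · simp only [hyd, hzd, if_false]; exact hg y (by omega) z (by omega)

variable [P.IsCrystallographic] {B : LinearMap.BilinForm ℝ M} {Ω : List ι} {C : ι → Prop}

lemma IsForm.attached_hexagon (hB : IsForm P B) (hi : Indep P Ω) (hC : IsColouring P Ω C) {n : ℕ}
    {a : ℕ → ι} (h : ChordlessIn P Ω n a) (hev : Even n)
    (hnc : n = 6 → NoCenter (Linked P) (· ∈ Ω) a) {v : ι} (hv : v ∈ Ω) (hva : ∀ i < n, v ≠ a i)
    {i : ℕ} (hin : i < n) (hl : Linked P v (a i)) :
    n = 6 ∧ ∀ j < n, j ≠ i → P.IsOrthogonal v (a j) := by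
  have h6 := h.six_le
  obtain ⟨b, hab, hg⟩ := hB.exists_cycleGram hi (by omega) h.mem
    (fun i hi j hj => h.chordless.ne hi hj) (hB.cycle_absGram hi h)
  obtain ⟨L, e, hL, he⟩ := hB.exists_isFrame (by omega) hg
  obtain ⟨h1, -, -, -, -, -, h2⟩ := hB.hexagon_pairing hi hC h hev hnc hab he hL hv hva hin hl
  exact ⟨h1, h2⟩

/-- A resolvable component of a list of roots, given by a sequence. -/
structure IsResolvableComponent (P : RootPairing ι ℝ M N) (Ω : List ι) (d : ℕ) (f : ℕ → ι) :
    Prop where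
  pos : 0 < d
  mem : ∀ i < d, f i ∈ Ω
  inj : ∀ i < d, ∀ j < d, i ≠ j → f i ≠ f j
  orth : ∀ w ∈ Ω, (∀ i < d, w ≠ f i) → ∀ i < d, P.IsOrthogonal w (f i)
  resolvable : Resolvable P d f

lemma ChordlessIn.isResolvableComponent_cycle (hB : IsForm P B) (hi : Indep P Ω) {n : ℕ}
    {a : ℕ → ι} (h : ChordlessIn P Ω n a) (hev : Even n)
    (ho : ∀ w ∈ Ω, (∀ i < n, w ≠ a i) → ∀ i < n, P.IsOrthogonal w (a i)) :
    ∃ d f, IsResolvableComponent P Ω d f := by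
  have h6 := h.six_le
  obtain ⟨k, rfl⟩ : ∃ k, n = 2 * k + 2 := by
    obtain ⟨c, hc⟩ := hev
    exact ⟨c - 1, by omega⟩
  have hsurj : ∀ i < 2 * k + 2, ∃ y < 2 * k + 2, cycleOfLens k y = i := by
    intro i hi
    have := Finset.surj_on_of_inj_on_of_card_le (s := Finset.range (2 * k + 2))
      (t := Finset.range (2 * k + 2)) (fun y _ => cycleOfLens k y)
      (fun y hy => Finset.mem_range.2 (cycleOfLens_lt (Finset.mem_range.1 hy)))
      (fun y z hy hz h => cycleOfLens_inj (Finset.mem_range.1 hy) (Finset.mem_range.1 hz) h)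
      le_rfl i (Finset.mem_range.2 hi)
    obtain ⟨y, hy, rfl⟩ := this
    exact ⟨y, Finset.mem_range.1 hy, rfl⟩
  have hinj : ∀ i < 2 * k + 2, ∀ j < 2 * k + 2, i ≠ j → cycleOfLens k i ≠ cycleOfLens k j :=
    fun i hi j hj hij h => hij (cycleOfLens_inj hi hj h)
  refine ⟨2 * k + 2, fun y => a (cycleOfLens k y), by omega, fun i hi => h.mem _ (cycleOfLens_lt hi),
    fun i hi j hj hij => h.chordless.ne (cycleOfLens_lt hi) (cycleOfLens_lt hj) (hinj i hi j hj hij),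
    fun w hw hwa i hi => ho w hw (fun i hi => ?_) _ (cycleOfLens_lt hi), ?_⟩
  · obtain ⟨y, hy, rfl⟩ := hsurj i hi
    exact hwa y hy
  · refine resolvable_of_lens hB (by omega) fun y hy z hz => ?_
    by_cases hyz : y = z
    · rw [hyz, P.pairing_same, lensGram, if_pos rfl]; simp
    have hadj := cycleOfLens_adj (k := k) (j := k - 1) (by omega) (by omega) hy hz hyz
    have hne := hinj y hy z hz hyz
    by_cases h0 : lensGram k (k - 1) y z = 0
    · rw [(h.orth (cycleOfLens_lt hy) (cycleOfLens_lt hz) hne fun h' => hadj.1 h' h0).1, h0]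
      simp
    · rw [abs_lensGram hyz h0]
      exact (hB.simple_edge hi h (cycleOfLens_lt hy) (cycleOfLens_lt hz) (hadj.2 h0)).1

end Components

end Carter

namespace Carter

/-! ### Components that contain a hexagon -/

section Hexagons

variable {ι M N : Type*} [AddCommGroup M] [Module ℝ M] [AddCommGroup N] [Module ℝ N]
  {P : RootPairing ι ℝ M N} {B : LinearMap.BilinForm ℝ M} {Ω : List ι} {C : ι → Prop} {a : ℕ → ι}

/-- The sequence extended by one root. -/
def extend (d : ℕ) (u : ι) (a : ℕ → ι) (y : ℕ) : ι := if y = d then u else a y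

lemma extend_inj {d : ℕ} {u : ι} {a : ℕ → ι}
    (ha : ∀ i < d, ∀ j < d, i ≠ j → a i ≠ a j) (hu : ∀ i < d, u ≠ a i) :
    ∀ i < d + 1, ∀ j < d + 1, i ≠ j → extend d u a i ≠ extend d u a j := by
  intro i hi j hj hij
  unfold extend
  split_ifs with h1 h2 h2
  · omega
  · exact hu j (by omega)
  · exact (hu i (by omega)).symm
  · exact ha i (by omega) j (by omega) hij

lemma forall_extend {d : ℕ} {u : ι} {a : ℕ → ι} {p : ι → Prop} :
    (∀ i < d + 1, p (extend d u a i)) ↔ (∀ i < d, p (a i)) ∧ p u := by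
  constructor
  · intro h
    refine ⟨fun i hi => ?_, ?_⟩
    · have := h i (by omega)
      rwa [extend, if_neg (by omega)] at this
    · have := h d (by omega)
      rwa [extend, if_pos rfl] at this
  · rintro ⟨h1, h2⟩ i hi
    unfold extend
    split_ifs with h
    · exact h2
    · exact h1 i (by omega)

/-- The roots attached to a hexagon: a root attached to the vertex `i`. -/
structure Attached (P : RootPairing ι ℝ M N) (Ω : List ι) (a : ℕ → ι) (v : ι) (i : ℕ) : Prop where
  mem : v ∈ Ω
  ne : ∀ i < 6, v ≠ a i
  lt : i < 6
  linked : Linked P v (a i)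

lemma Attached.rotSeq {v : ι} {i : ℕ} (h : Attached P Ω a v i) {s j : ℕ} (hs : s < 6) (hj : j < 6)
    (hij : i = j + s ∨ i + 6 = j + s) : Attached P Ω (rotSeq 6 s a) v j where
  mem := h.mem
  ne k hk := by
    obtain ⟨l, hl, -, hl2⟩ := exists_rotSeq_eq a hs hk
    rw [hl2]; exact h.ne l hl
  lt := hj
  linked := by
    rw [rotSeq_eq a h.lt (by omega)]
    exact h.linked

/-- A hexagon in a bicolored list of independent roots, no root being attached to three vertices. -/
structure IsHexagon (P : RootPairing ι ℝ M N) (B : LinearMap.BilinForm ℝ M) (Ω : List ι)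
    (C : ι → Prop) (a : ℕ → ι) : Prop where
  form : IsForm P B
  indep : Indep P Ω
  colouring : IsColouring P Ω C
  chordless : ChordlessIn P Ω 6 a
  noCenter : NoCenter (Linked P) (· ∈ Ω) a

lemma IsHexagon.rotSeq (h : IsHexagon P B Ω C a) {s : ℕ} (hs : s < 6) :
    IsHexagon P B Ω C (rotSeq 6 s a) :=
  ⟨h.form, h.indep, h.colouring, h.chordless.rotSeq hs, h.noCenter.rotSeq hs⟩

lemma IsHexagon.ne (h : IsHexagon P B Ω C a) : ∀ i < 6, ∀ j < 6, i ≠ j → a i ≠ a j :=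
  fun _ hi _ hj => h.chordless.chordless.ne hi hj

variable [P.IsCrystallographic]

lemma IsHexagon.orth (h : IsHexagon P B Ω C a) {v : ι} {i j : ℕ} (hv : Attached P Ω a v i)
    (hj : j < 6) (hji : j ≠ i) : P.IsOrthogonal v (a j) :=
  (h.form.attached_hexagon h.indep h.colouring h.chordless (by decide) (fun _ => h.noCenter) hv.mem
    hv.ne hv.lt hv.linked).2 j hj hji

lemma IsHexagon.orth_of_orth (h : IsHexagon P B Ω C a) {v w : ι} {i : ℕ} (hv : Attached P Ω a v i)
    (hw : w ∈ Ω) (hwa : ∀ i < 6, w ≠ a i) (hwv : w ≠ v)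
    (hwo : ∀ i < 6, P.IsOrthogonal w (a i)) : P.IsOrthogonal w v :=
  h.form.orth_of_orth_hexagon h.indep h.colouring h.chordless (by decide) (fun _ => h.noCenter)
    hv.mem hv.ne hv.lt hv.linked hw hwa hwv hwo

lemma IsHexagon.two_attached (h : IsHexagon P B Ω C a) {v w : ι} {j : ℕ} (hv : Attached P Ω a v 0)
    (hw : Attached P Ω a w j) (hwv : w ≠ v) : (j = 3 ∧ P.IsOrthogonal w v) ∨
      ((j = 1 ∨ j = 5) ∧ |P.pairing w v| = 1 ∧ |P.pairing v w| = 1) :=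
  h.form.two_attached h.indep h.colouring h.chordless h.noCenter hv.mem hv.ne hv.linked hw.mem hw.ne
    hwv hw.lt hw.linked

/-- After rotation to `i = 0`, `two_attached` leaves the positions 1, 3 and 5. The parity form
excludes a third attached root. -/
lemma IsHexagon.odd (h : IsHexagon P B Ω C a) {v w : ι} {i j : ℕ} (hv : Attached P Ω a v i)
    (hw : Attached P Ω a w j) (hwv : w ≠ v) : Odd (i + j) := by
  have hi := hv.lt
  have hj := hw.lt
  have := (h.rotSeq hi).two_attached (hv.rotSeq hi (by norm_num : 0 < 6) (by omega))
    (hw.rotSeq (j := if i ≤ j then j - i else j + 6 - i) hi (by split_ifs <;> omega)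
      (by split_ifs <;> omega)) hwv
  rw [Nat.odd_iff]
  split_ifs at this <;> omega

lemma IsHexagon.absGram (h : IsHexagon P B Ω C a) {E : List (ℕ × ℕ × ℤ)}
    (hE : ∀ y < 6, ∀ z < 6, edgeGram E y z = cycleGram 6 y z) : HasAbsGram P 6 (edgeGram E) a := by
  intro y hy z hz
  rw [hE y hy z hz]
  exact h.form.cycle_absGram h.indep h.chordless y hy z hz

lemma IsHexagon.abs_pairing (h : IsHexagon P B Ω C a) {v : ι} {i : ℕ} (hv : Attached P Ω a v i)
    {y : ℕ} (hy : y < 6) : |P.pairing (a y) v| = (if y = i then 1 else 0) ∧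
      |P.pairing v (a y)| = (if y = i then 1 else 0) := by
  split_ifs with hyi
  · subst hyi
    have := h.form.simple_attached h.indep h.colouring h.chordless hv.mem hv.ne hv.lt hv.linked
    exact ⟨this.1, this.2.1⟩
  · have := h.orth hv hy hyi
    rw [this.1, this.2]
    simp

lemma IsHexagon.seven (h : IsHexagon P B Ω C a) {v : ι} (hv : Attached P Ω a v 0)
    {E : List (ℕ × ℕ × ℤ)} (hE : ∀ y < 6, ∀ z < 6, edgeGram E y z = cycleGram 6 y z)
    (hE' : ∀ y < 6, |edgeGram E y 6| = if y = 0 then 1 else 0) :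
    HasAbsGram P 7 (edgeGram E) (extend 6 v a) := by
  refine hasAbsGram_extend (h.absGram hE) v (fun y hy => ?_) (if_pos rfl)
  obtain ⟨h1, h2⟩ := h.abs_pairing hv hy
  have h3 : |(edgeGram E y 6 : ℝ)| = if y = 0 then 1 else 0 := by exact_mod_cast hE' y hy
  rw [h1, h2, edgeGram_comm E 6 y, h3]
  exact ⟨rfl, rfl⟩

lemma IsHexagon.component_one (h : IsHexagon P B Ω C a) {v : ι} (hv : Attached P Ω a v 0)
    (ho : ∀ w j, Attached P Ω a w j → w = v) : IsResolvableComponent P Ω 7 (extend 6 v a) where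
  pos := by norm_num
  mem := forall_extend.2 ⟨h.chordless.mem, hv.mem⟩
  inj := extend_inj h.ne hv.ne
  orth w hw hwf := by
    obtain ⟨h1, h2⟩ := forall_extend.1 hwf
    have h3 : ∀ i < 6, P.IsOrthogonal w (a i) := fun i hi => by
      by_contra hl
      exact h2 (ho w i ⟨hw, h1, hi, hl⟩)
    exact forall_extend.2 ⟨h3, h.orth_of_orth hv hw h1 h2 h3⟩
  resolvable := resolvable_of_E7b2 h.form (h.seven hv (by decide) (by decide))

lemma IsHexagon.component_two (h : IsHexagon P B Ω C a) {v w : ι} {j : ℕ}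
    (hv : Attached P Ω a v 0) (hw : Attached P Ω a w j) (hwv : w ≠ v)
    (hr : Resolvable P 8 (extend 7 w (extend 6 v a))) :
    IsResolvableComponent P Ω 8 (extend 7 w (extend 6 v a)) where
  pos := by norm_num
  mem := forall_extend.2 ⟨forall_extend.2 ⟨h.chordless.mem, hv.mem⟩, hw.mem⟩
  inj := extend_inj (extend_inj h.ne hv.ne) (forall_extend.2 ⟨hw.ne, hwv⟩)
  orth u hu huf := by
    obtain ⟨h0, h3⟩ := forall_extend.1 huf
    obtain ⟨h1, h2⟩ := forall_extend.1 h0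
    have h4 : ∀ i < 6, P.IsOrthogonal u (a i) := fun i hi => by
      by_contra hl
      have ha : Attached P Ω a u i := ⟨hu, h1, hi, hl⟩
      -- The sums of three positions in pairs cannot all be odd.
      have o1 := h.odd hv ha h2
      have o2 := h.odd hw ha h3
      have o3 := h.odd hv hw hwv
      rw [Nat.odd_iff] at o1 o2 o3
      omega
    exact forall_extend.2 ⟨forall_extend.2 ⟨h4, h.orth_of_orth hv hu h1 h2 h4⟩,
      h.orth_of_orth hw hu h1 h3 h4⟩
  resolvable := hr

lemma IsHexagon.component_opposite (h : IsHexagon P B Ω C a) {v w : ι}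
    (hv : Attached P Ω a v 0) (hw : Attached P Ω a w 3) (hwv : w ≠ v)
    (ho : P.IsOrthogonal w v) : IsResolvableComponent P Ω 8 (extend 7 w (extend 6 v a)) := by
  refine h.component_two hv hw hwv (resolvable_of_opposite h.form ?_)
  refine hasAbsGram_extend (h.seven hv (by decide) (by decide)) w ?_ (if_pos rfl)
  intro y hy
  rw [edgeGram_comm _ 7 y]
  have hE : ∀ y < 6, |edgeGram edgesOpposite y 7| = if y = 3 then 1 else 0 := by decide
  by_cases hy6 : y = 6
  · subst hy6
    have : edgeGram edgesOpposite 6 7 = 0 := by decide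
    rw [this, extend, if_pos rfl, ho.1, ho.2]
    simp
  · obtain ⟨h1, h2⟩ := h.abs_pairing hw (y := y) (by omega)
    have h3 : |(edgeGram edgesOpposite y 7 : ℝ)| = if y = 3 then 1 else 0 := by
      exact_mod_cast hE y (by omega)
    rw [extend, if_neg hy6, h1, h2, h3]
    exact ⟨rfl, rfl⟩

lemma IsHexagon.component_adjacent (h : IsHexagon P B Ω C a) {v w : ι}
    (hv : Attached P Ω a v 0) (hw : Attached P Ω a w 1) (hwv : w ≠ v)
    (h1 : |P.pairing w v| = 1) (h2 : |P.pairing v w| = 1) :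
    IsResolvableComponent P Ω 8 (extend 7 w (extend 6 v a)) := by
  refine h.component_two hv hw hwv (resolvable_of_adjacent h.form ?_)
  refine hasAbsGram_extend (h.seven hv (by decide) (by decide)) w ?_ (if_pos rfl)
  intro y hy
  rw [edgeGram_comm _ 7 y]
  have hE : ∀ y < 6, |edgeGram edgesAdjacent y 7| = if y = 1 then 1 else 0 := by decide
  by_cases hy6 : y = 6
  · subst hy6
    have : edgeGram edgesAdjacent 6 7 = 1 := by decide
    rw [this, extend, if_pos rfl, h1, h2]
    simp
  · obtain ⟨h3, h4⟩ := h.abs_pairing hw (y := y) (by omega)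
    have h5 : |(edgeGram edgesAdjacent y 7 : ℝ)| = if y = 1 then 1 else 0 := by
      exact_mod_cast hE y (by omega)
    rw [extend, if_neg hy6, h3, h4, h5]
    exact ⟨rfl, rfl⟩

lemma IsHexagon.exists_component_of_attached_zero (h : IsHexagon P B Ω C a) {v : ι}
    (hv : Attached P Ω a v 0) : ∃ d f, IsResolvableComponent P Ω d f := by
  by_cases ho : ∀ w j, Attached P Ω a w j → w = v
  · exact ⟨_, _, h.component_one hv ho⟩
  push Not at ho
  obtain ⟨w, j, hw, hwv⟩ := ho
  rcases h.two_attached hv hw hwv with ⟨rfl, h1⟩ | ⟨rfl | rfl, h1, h2⟩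
  · exact ⟨_, _, h.component_opposite hv hw hwv h1⟩
  · exact ⟨_, _, h.component_adjacent hv hw hwv h1 h2⟩
  -- Rotation by 5 puts `w` at vertex 0 and `v` at vertex 1, so the roles are exchanged.
  · exact ⟨_, _, (h.rotSeq (by norm_num : 5 < 6)).component_adjacent
      (hw.rotSeq (by norm_num) (by norm_num) (by norm_num))
      (hv.rotSeq (by norm_num) (by norm_num) (by norm_num)) hwv.symm h2 h1⟩

end Hexagons

/-! ### Splitting off components and the exclusion of long cycles -/

section Induction

variable {ι M N : Type*} [AddCommGroup M] [Module ℝ M] [AddCommGroup N] [Module ℝ N]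
  {P : RootPairing ι ℝ M N} {B : LinearMap.BilinForm ℝ M} {Ω : List ι}

/-- There is no long chordless cycle, other than a hexagon with a root which is linked to three of
its vertices. -/
def Good (P : RootPairing ι ℝ M N) (Ω : List ι) : Prop :=
  ∀ n a, ChordlessIn P Ω n a → Even n → ¬ (n = 6 → NoCenter (Linked P) (· ∈ Ω) a)

/-- A shortest bad walk would be exactly a cycle that `Good` forbids. The hexagons with a centre,
which `Good` tolerates, are sums of three squares. -/
lemma Good.onlyFourCycles {A A' : List ι} (h : Good P (A ++ A'))
    (hA : A.Pairwise P.IsOrthogonal) (hA' : A'.Pairwise P.IsOrthogonal) (hnd : (A ++ A').Nodup) :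
    OnlyFourCycles (diagram P (A ++ A')) := by
  by_contra hcon
  obtain ⟨n, a, h6, hev, ha, hnc⟩ := exists_isChordless (even_length_of_bicolored hA hA') hcon
  have hinj : Function.Injective (A ++ A').get := List.nodup_iff_injective_get.1 hnd
  have hadj : ∀ i j, i ≠ j → ((diagram P (A ++ A')).Adj i j ↔
      Linked P ((A ++ A').get i) ((A ++ A').get j)) := fun i j hij => ⟨fun h => h.2, fun h => ⟨hij, h⟩⟩
  refine h n (fun i => (A ++ A').get (a i)) ⟨h6, fun i _ => List.get_mem _ _, ?_, ?_⟩ hev ?_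
  · exact fun i j hij hj h => ha.inj i j hij hj (hinj h)
  · intro i j hij hj
    rw [← hadj _ _ (ha.inj i j hij hj)]
    exact ha.adj i j hij hj
  · rintro rfl v hv
    obtain ⟨x, rfl⟩ := List.mem_iff_get.1 hv
    have hx := hnc rfl x trivial
    have hlink : ∀ i j, i < j → j < 6 → Linked P ((A ++ A').get (a i)) ((A ++ A').get (a j)) →
        (j = i + 1 ∨ (i = 0 ∧ j + 1 = 6)) := by
      intro i j hij hj hl
      exact (ha.adj i j hij hj).1 ((hadj _ _ (ha.inj i j hij hj)).2 hl)
    -- A root is linked to itself but not adjacent to itself, so `x` has to be shown distinct from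
    -- the three vertices. If it were one of them, two alternate vertices of the hexagon would be
    -- linked.
    have key : ∀ s, s ≤ 1 → Linked P ((A ++ A').get x) ((A ++ A').get (a s)) →
        Linked P ((A ++ A').get x) ((A ++ A').get (a (s + 2))) →
        Linked P ((A ++ A').get x) ((A ++ A').get (a (s + 4))) →
        (diagram P (A ++ A')).Adj x (a s) ∧ (diagram P (A ++ A')).Adj x (a (s + 2)) ∧
          (diagram P (A ++ A')).Adj x (a (s + 4)) := by
      intro s hs h0 h2 h4
      have e0 : x ≠ a s := by
        rintro rfl
        have := hlink s (s + 2) (by omega) (by omega) h2; omega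
      have e2 : x ≠ a (s + 2) := by
        rintro rfl
        have := hlink (s + 2) (s + 4) (by omega) (by omega) h4; omega
      have e4 : x ≠ a (s + 4) := by
        rintro rfl
        have := hlink (s + 2) (s + 4) (by omega) (by omega) h2.symm; omega
      exact ⟨(hadj _ _ e0).2 h0, (hadj _ _ e2).2 h2, (hadj _ _ e4).2 h4⟩
    exact ⟨fun h => hx.1 (key 0 (by norm_num) h.1 h.2.1 h.2.2),
      fun h => hx.2 (key 1 (by norm_num) h.1 h.2.1 h.2.2)⟩

lemma isColouring_append {A A' : List ι} (hA : A.Pairwise P.IsOrthogonal)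
    (hA' : A'.Pairwise P.IsOrthogonal) : IsColouring P (A ++ A') (· ∈ A) :=
  fun _ hx _ hy hxy hl => mem_left_iff hA hA' hx hy hxy hl

/-- If nothing is attached to the forbidden cycle, the cycle is a component. Otherwise it is a
hexagon, which is rotated so that an attached root sits at vertex 0. -/
lemma exists_isResolvableComponent [P.IsCrystallographic] (hB : IsForm P B) {A A' : List ι}
    (hA : A.Pairwise P.IsOrthogonal) (hA' : A'.Pairwise P.IsOrthogonal) (hi : Indep P (A ++ A'))
    (hg : ¬ Good P (A ++ A')) : ∃ d f, IsResolvableComponent P (A ++ A') d f := by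
  simp only [Good] at hg
  push Not at hg
  obtain ⟨n, a, h, hev, hnc⟩ := hg
  have hC := isColouring_append hA hA'
  by_cases ho : ∀ w ∈ A ++ A', (∀ i < n, w ≠ a i) → ∀ i < n, P.IsOrthogonal w (a i)
  · exact h.isResolvableComponent_cycle hB hi hev ho
  push Not at ho
  obtain ⟨v, hv, hva, i, hin, hl⟩ := ho
  obtain ⟨rfl, -⟩ := hB.attached_hexagon hi hC h hev hnc hv hva hin hl
  have hh : IsHexagon P B (A ++ A') (· ∈ A) a := ⟨hB, hi, hC, h, hnc rfl⟩
  have ha : Attached P (A ++ A') a v i := ⟨hv, hva, hin, hl⟩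
  exact (hh.rotSeq hin).exists_component_of_attached_zero
    (ha.rotSeq hin (by norm_num) (by omega))

/-- Consecutive vertices of a cycle are linked, so the cycle lies in one part. The absence of a
centre passes to `D`, which offers fewer candidates. -/
lemma good_append {C D : List ι} (hC : ∀ n a, ¬ ChordlessIn P C n a) (hD : Good P D)
    (hCD : ∀ x ∈ C, ∀ y ∈ D, P.IsOrthogonal x y) {L : List ι} (hL : L.Perm (C ++ D)) : Good P L := by
  intro n a h hev hnc
  have h6 := h.six_le
  have hor : ∀ i < n, a i ∈ C ∨ a i ∈ D := fun i hi =>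
    List.mem_append.1 (hL.mem_iff.1 (h.mem i hi))
  have hlink : ∀ i, i + 1 < n → Linked P (a i) (a (i + 1)) := fun i hi =>
    (h.chordless.adj i (i + 1) (by omega) hi).2 (.inl rfl)
  by_cases h0 : a 0 ∈ C
  · refine hC n a ⟨h6, fun i => ?_, h.chordless⟩
    induction i with
    | zero => exact fun _ => h0
    | succ i ih =>
      intro hi
      exact (hor _ hi).resolve_right fun hd => hlink i hi (hCD _ (ih (by omega)) _ hd)
  · refine hD n a ⟨h6, fun i => ?_, h.chordless⟩ hev fun hn v hv =>
      hnc hn v (hL.mem_iff.2 (List.mem_append_right _ hv))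
    induction i with
    | zero => exact fun hi => (hor 0 hi).resolve_left h0
    | succ i ih =>
      intro hi
      exact (hor _ hi).resolve_left fun hc => hlink i hi (hCD _ hc _ (ih (by omega))).symm

/-- The list is split into two orthogonal parts. -/
lemma cyc_filter {A A' : List ι} (hA : A.Pairwise P.IsOrthogonal)
    (hA' : A'.Pairwise P.IsOrthogonal) (p : ι → Bool)
    (hp : ∀ x ∈ A ++ A', ∀ y ∈ A ++ A', p x = true → p y = false → P.IsOrthogonal x y) :
    Cyc P.IsOrthogonal (A ++ A')
      ((A.filter p ++ A'.filter p) ++ (A.filter (fun x => !p x) ++ A'.filter fun x => !p x)) := by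
  have hs : ∀ a b : ι, P.IsOrthogonal a b → P.IsOrthogonal b a := fun _ _ h => h.symm
  have h1 := Cyc.perm_append (List.filter_append_perm p A).symm [] A' hs hA
  have h2 := Cyc.perm_append (List.filter_append_perm p A').symm
    (A.filter p ++ A.filter fun x => !p x) [] hs hA'
  have h3 := Cyc.move_append (R := P.IsOrthogonal) (A.filter p) (A.filter fun x => !p x)
    (A'.filter p) (A'.filter fun x => !p x) (fun x hx y hy => by
      rw [List.mem_filter] at hx hy
      exact (hp y (List.mem_append_right _ hy.1) x (List.mem_append_left _ hx.1) hy.2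
        (by simpa using hx.2)).symm)
  simp only [List.append_nil, List.nil_append, List.append_assoc] at h1 h2 h3 ⊢
  exact (h1.trans h2).trans h3

/-- Induction on the length. A resolvable component is orthogonal to the rest, so both parts are
transformed independently, and the component supplies the square. -/
theorem exists_good [P.IsCrystallographic] (hB : IsForm P B) (A A' : List ι)
    (hA : A.Pairwise P.IsOrthogonal) (hA' : A'.Pairwise P.IsOrthogonal) (hi : Indep P (A ++ A')) :
    ∃ C C' : List ι, C.Pairwise P.IsOrthogonal ∧ C'.Pairwise P.IsOrthogonal ∧
      Loc P (A ++ A') (C ++ C') ∧ Good P (C ++ C') ∧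
      (¬ Good P (A ++ A') → HasSquare P (C ++ C')) := by
  classical
  induction hn : (A ++ A').length using Nat.strong_induction_on generalizing A A' with
  | _ n ih =>
    by_cases hg : Good P (A ++ A')
    · exact ⟨A, A', hA, hA', .refl _, hg, fun h => absurd hg h⟩
    obtain ⟨d, f, hf⟩ := exists_isResolvableComponent hB hA hA' hi hg
    set p : ι → Bool := fun x => decide (∃ i < d, f i = x)
    have hpt : ∀ x, p x = true ↔ ∃ i < d, f i = x := fun x => by simp [p]
    have hpf : ∀ x, p x = false → ∀ i < d, x ≠ f i := by
      intro x hx i hi h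
      have := (hpt x).2 ⟨i, hi, h.symm⟩
      rw [this] at hx
      exact absurd hx (by simp)
    have hcyc := cyc_filter hA hA' p (fun x _ y hy hpx hpy => by
      obtain ⟨i, hi, rfl⟩ := (hpt x).1 hpx
      exact (hf.orth y hy (hpf y hpy) i hi).symm)
    have hi' := hcyc.loc.indep hi
    obtain ⟨C₁, C₁', hC₁, hC₁', l₁, hch, hsq⟩ := hf.resolvable (A.filter p) (A'.filter p)
      (hA.filter _) (hA'.filter _) hi'.of_append_left (by
        rw [← List.filter_append, List.perm_ext_iff_of_nodup (hi.nodup.filter _)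
          (List.nodup_range.map_on fun i hi j hj hij => by
            by_contra hne
            exact hf.inj i (List.mem_range.1 hi) j (List.mem_range.1 hj) hne hij)]
        intro x
        rw [List.mem_filter, hpt, List.mem_map]
        constructor
        · rintro ⟨-, i, hi, rfl⟩
          exact ⟨i, List.mem_range.2 hi, rfl⟩
        · rintro ⟨i, hi, rfl⟩
          exact ⟨hf.mem i (List.mem_range.1 hi), i, List.mem_range.1 hi, rfl⟩)
    obtain ⟨C₂, C₂', hC₂, hC₂', l₂, hgood, -⟩ := ih
      (A.filter (fun x => !p x) ++ A'.filter fun x => !p x).length (by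
        rw [← hn, ← List.filter_append]
        refine List.length_filter_lt_length_iff_exists.2 ⟨f 0, hf.mem 0 hf.pos, ?_⟩
        rw [(hpt (f 0)).2 ⟨0, hf.pos, rfl⟩]
        simp) _ _ (hA.filter _) (hA'.filter _)
      (hi'.perm List.perm_append_comm).of_append_left rfl
    have h1 : ∀ x ∈ A.filter p ++ A'.filter p, ∀ y ∈ A.filter (fun x => !p x) ++
        A'.filter (fun x => !p x), P.IsOrthogonal x y := by
      intro x hx y hy
      rw [← List.filter_append, List.mem_filter] at hx hy
      obtain ⟨i, hi, rfl⟩ := (hpt x).1 hx.2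
      exact (hf.orth y hy.1 (hpf y (by simpa using hy.2)) i hi).symm
    have h2 : ∀ x ∈ C₁ ++ C₁', ∀ y ∈ A.filter (fun x => !p x) ++
        A'.filter (fun x => !p x), P.IsOrthogonal x y :=
      fun x hx y hy => (l₁.forall_isOrthogonal_iff y).1 (fun x hx => h1 x hx y hy) x hx
    have h3 : ∀ x ∈ C₁ ++ C₁', ∀ y ∈ C₂ ++ C₂', P.IsOrthogonal x y :=
      fun x hx y hy => ((l₂.forall_isOrthogonal_iff x).1 (fun y hy => (h2 x hx y hy).symm) y hy).symm
    -- The middle blocks belong to different parts and may be exchanged, which makes the whole list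
    -- bicolored again.
    have h4 := Cyc.move_append (R := P.IsOrthogonal) C₁ C₁' C₂ C₂' fun x hx y hy =>
      h3 x (List.mem_append_right _ hx) y (List.mem_append_left _ hy)
    have hloc : Loc P (A ++ A') ((C₁ ++ C₂) ++ (C₁' ++ C₂')) := by
      refine hcyc.loc.trans ((l₁.append_right _ h1).trans
        ((l₂.append_left _ fun y hy x hx => (h2 x hx y hy).symm).trans ?_))
      have := h4.loc
      simp only [List.append_assoc] at this ⊢
      exact this
    have hperm : ((C₁ ++ C₂) ++ (C₁' ++ C₂')).Perm ((C₁ ++ C₁') ++ (C₂ ++ C₂')) := by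
      have := h4.perm.symm
      simp only [List.append_assoc] at this ⊢
      exact this
    refine ⟨C₁ ++ C₂, C₁' ++ C₂', ?_, ?_, hloc, good_append hch hgood h3 hperm,
      fun _ => hsq.mono fun x hx => hperm.mem_iff.2 (List.mem_append_left _ hx)⟩
    · exact List.pairwise_append.2 ⟨hC₁, hC₂, fun x hx y hy =>
        h3 x (List.mem_append_left _ hx) y (List.mem_append_left _ hy)⟩
    · exact List.pairwise_append.2 ⟨hC₁', hC₂', fun x hx y hy =>
        h3 x (List.mem_append_right _ hx) y (List.mem_append_right _ hy)⟩

/-- The exclusion of long cycles. -/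
theorem exists_isCarter_onlyFourCycles [Finite ι] (P : RootPairing ι ℝ M N) [P.IsRootSystem]
    [P.IsCrystallographic] {Ω : List ι} (hΩ : IsCarter P Ω) {l : ℕ}
    (hl : HasCycle (diagram P Ω) l) :
    ∃ Ω' : List ι, IsCarter P Ω' ∧ Equivalent P Ω Ω' ∧ HasCycle (diagram P Ω') 4 ∧
      OnlyFourCycles (diagram P Ω') := by
  obtain ⟨B, hB⟩ := exists_isForm P
  obtain ⟨hi, -, A, A', rfl, hA, hA'⟩ := hΩ
  -- In the good case nothing is changed: the given cycle is a sum of 4-cycles, so a 4-cycle exists.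
  by_cases hg : Good P (A ++ A')
  · have h4 := hg.onlyFourCycles hA hA' (Indep.nodup hi)
    exact ⟨A ++ A', isCarter_of_bicolored hi hA hA', (Loc.refl (P := P) _).equivalent,
      hasCycle_four_of_onlyFourCycles h4 hl, h4⟩
  · obtain ⟨C, C', hC, hC', hloc, hgood, hsq⟩ := exists_good hB A A' hA hA' hi
    have hiC := hloc.indep hi
    exact ⟨C ++ C', isCarter_of_bicolored hiC hC hC', hloc.equivalent, (hsq hg).hasCycle,
      hgood.onlyFourCycles hC hC' hiC.nodup⟩

end Induction

end Carter

theorem mainTheorem1 {ι M N : Type*} [Finite ι] [AddCommGroup M] [Module ℝ M]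
    [AddCommGroup N] [Module ℝ N] (P : RootPairing ι ℝ M N)
    [P.IsRootSystem] [P.IsCrystallographic] [P.IsReduced] :
    -- equivalence preserves the conjugacy class of the described element
    (∀ Ω Ω' : List ι, Carter.Equivalent P Ω Ω' →
      IsConj (Carter.weylElement P Ω) (Carter.weylElement P Ω')) ∧
    -- exclusion of long cycles
    (∀ Ω : List ι, Carter.IsCarter P Ω →
      (∃ l : ℕ, 4 < l ∧ Carter.HasCycle (Carter.diagram P Ω) l) →
      ∃ Ω' : List ι, Carter.IsCarter P Ω' ∧ Carter.Equivalent P Ω Ω' ∧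
        Carter.HasCycle (Carter.diagram P Ω') 4 ∧
        Carter.OnlyFourCycles (Carter.diagram P Ω')) ∧
    -- `D_l(b_{l/2-1})` and `D_l(a_{l/2-1})`, `l > 4` even; the case `l = 6` is `D_6(b_2)`, `D_6(a_2)`
    (∀ l : ℕ, 4 < l → Even l →
      Carter.DiagramsEquivalent P (Carter.pureCycle l) (Carter.diagramDa l (l / 2 - 1))) ∧
    -- `E_7(b_2)` and `E_7(a_2)`
    Carter.DiagramsEquivalent P Carter.diagramE7b2 Carter.diagramE7a2 := by
  refine ⟨fun Ω Ω' h => h.isConj P,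
    fun Ω hΩ ⟨l, _, hl⟩ => Carter.exists_isCarter_onlyFourCycles P hΩ hl, fun l hl hev => ?_,
    Carter.diagramsEquivalent_E7b2_E7a2 P⟩
  obtain ⟨k, rfl⟩ : ∃ k, l = 2 * k + 2 := by
    obtain ⟨c, hc⟩ := hev
    exact ⟨c - 1, by omega⟩
  rw [show (2 * k + 2) / 2 - 1 = k by omega]
  exact Carter.diagramsEquivalent_pureCycle_diagramDa P (by omega)
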